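/- For $\theta=(\theta_1,\theta_2,\theta_3,\theta_4)=(\mu,\sigma,\alpha,\beta)\in\Theta_M=\mathbb R\times(0,\infty)\times(0,2]\times[-1,1]$, let $f(x;\theta)=\frac1{2\pi}\int_{-\infty}^{\infty}e^{-itx}\varphi(t)\,dt$, $x\in\mathbb R$, be the density of the stable law with $(M_0)$ characteristic function $$\varphi(t)=\exp\Big(-|\sigma t|^\alpha\big\{1+i\beta\,\mathrm{sign}(t)\tan\tfrac{\pi\alpha}{2}\,(|\sigma t|^{1-\alpha}-1)\big\}+i\mu t\Big)\ (\alpha\ne1),\qquad \varphi(t)=\exp\Big(-|\sigma t|-i\sigma t\,\tfrac{2\beta}{\pi}\log|\sigma t|+i\mu t\Big)\ (\alpha=1).$$ Write $'$ for $\partial/\partial x$ and subscripts for partial derivatives in the components of $\theta$, and let $\Theta_M^\circ$ be the interior of $\Theta_M$. Then: (a) For every $x\in\mathbb R$, $\theta\mapsto f(x;\theta)$ is twice continuously differentiable on $\Theta_M^\circ$ (including across $\alpha=1$). For every $\theta\in\Theta_M^\circ$ and $i=1,\dots,4$, $x\mapsto f_{\theta_i}(x;\theta)$ is continuously differentiable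 on $\mathbb R$. The functions $f_{\theta_i}$, $f_{\theta_i}'$, $f_{\theta_i\theta_j}$ $(i,j=1,\dots,4)$ are jointly continuous in $(x,\theta)$ on $\mathbb R\times\Theta_M^\circ$. Moreover, on $\mathbb R\times\Theta_M^\circ$, $f$ is differentiable in $x$, $f'$ is differentiable in $\theta$, the derivatives are interchangeable, i.e. $f_{\theta_i}'=\frac{\partial^2 f}{\partial x\,\partial\theta_i}=\frac{\partial^2 f}{\partial\theta_i\,\partial x}$ and $f_{\theta_i\theta_j}=f_{\theta_j\theta_i}$, and $f_\mu=-f'$, $f_{\theta_i}'=-f_{\mu\theta_i}$. (b) For every fixed $\theta\in\Theta_M^\circ$, as $|x|\to\infty$, $$\begin{array}{lll} f=O(|x|^{-(1+\alpha)}), & f_\mu'=-f_{\mu\mu}=O(|x|^{-(3+\alpha)}), & f_{\sigma\alpha}=O(|x|^{-(1+\alpha)}\log|x|),\\ f_\mu=-f'=O(|x|^{-(2+\alpha)}), & f_\sigma'=-f_{\mu\sigma}=O(|x|^{-(2+\alpha)}), & f_{\sigma\beta}=O(|x|^{-(1+\alpha)}),\\ f_\sigma=O(|x|^{-(1+\alpha)}),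 & f_\alpha'=-f_{\mu\alpha}=O(|x|^{-(2+\alpha)}\log|x|), & f_{\alpha\alpha}=O(|x|^{-(1+\alpha)}\log^2|x|),\\ f_\alpha=O(|x|^{-(1+\alpha)}\log|x|), & f_\beta'=-f_{\mu\beta}=O(|x|^{-(2+\alpha)}), & f_{\alpha\beta}=O(|x|^{-(1+\alpha)}\log|x|),\\ f_\beta=O(|x|^{-(1+\alpha)}), & f_{\sigma\sigma}=O(|x|^{-(1+\alpha)}), & f_{\beta\beta}=O(|x|^{-(1+\alpha)}). \end{array}$$ (c) If in addition $\alpha=1$ (so $\beta\in(-1,1)$), then, as $|x|\to\infty$, $f_{\sigma\sigma}=O(|x|^{-3}\log|x|)$ and $f_{\beta\beta}=O(|x|^{-3}\log|x|)$. -/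

import Mathlib

open MeasureTheory Filter Asymptotics Set

/-- The four coordinates of the parameter vector `θ = (μ, σ, α, β)`. -/
abbrev muIx : Fin 4 := 0
abbrev sigmaIx : Fin 4 := 1
abbrev alphaIx : Fin 4 := 2
abbrev betaIx : Fin 4 := 3

/-- The parameter space: `μ ∈ ℝ`, `σ ∈ (0, ∞)`, `α ∈ (0, 2]`, `β ∈ [-1, 1]`. -/
def ThetaM : Set (Fin 4 → ℝ) :=
  {θ | 0 < θ sigmaIx ∧ θ alphaIx ∈ Set.Ioc (0 : ℝ) 2 ∧ θ betaIx ∈ Set.Icc (-1 : ℝ) 1}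

/-- The characteristic function of the `(M₀)`-parameterized stable law with explicit parameters. -/
noncomputable def m0Chf (μ σ α β t : ℝ) : ℂ :=
  if α = 1 then
    Complex.exp (-((|σ * t| : ℝ) : ℂ)
      - Complex.I * (σ * t * (2 * β / Real.pi) * Real.log |σ * t| : ℝ)
      + Complex.I * (μ * t : ℝ))
  else
    Complex.exp (-((|σ * t| ^ α : ℝ) : ℂ) *
        (1 + Complex.I *
          (β * Real.sign t * Real.tan (Real.pi * α / 2) * (|σ * t| ^ (1 - α) - 1) : ℝ))
      + Complex.I * (μ * t : ℝ))

/-- The characteristic function at the parameter vector `θ`. -/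
noncomputable def m0CharFun (θ : Fin 4 → ℝ) (t : ℝ) : ℂ :=
  m0Chf (θ muIx) (θ sigmaIx) (θ alphaIx) (θ betaIx) t

/-- The `(M₀)` stable density `f(x; θ) = (2π)⁻¹ ∫ e^{-itx} φ(t) dt`, the continuous density of the
law with characteristic function `φ` (see `eq_m0Density_of_charFun`). As `φ(-t)` is the conjugate
of `φ(t)`, the integral is real. -/
noncomputable def m0Density (x : ℝ) (θ : Fin 4 → ℝ) : ℝ :=
  (1 / (2 * Real.pi)) *
    (∫ t : ℝ, Complex.exp (-(Complex.I * (t * x : ℝ))) * m0CharFun θ t).re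

theorem norm_m0CharFun (θ : Fin 4 → ℝ) (t : ℝ) :
    ‖m0CharFun θ t‖ = Real.exp (-|θ sigmaIx * t| ^ θ alphaIx) := by
  unfold m0CharFun m0Chf
  split_ifs with h
  · rw [Complex.norm_exp, h]
    congr 1
    simp [-abs_mul, -Complex.ofReal_mul]
  · rw [Complex.norm_exp]
    congr 1
    simp [-abs_mul, -Complex.ofReal_mul, -Complex.ofReal_sub]

theorem integrable_m0CharFun {θ : Fin 4 → ℝ} (hθ : θ ∈ ThetaM) : Integrable (m0CharFun θ) := by
  obtain ⟨hσ, hα, -⟩ := hθ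
  have hm : AEStronglyMeasurable (m0CharFun θ) := by
    unfold m0CharFun m0Chf
    have hs : Measurable Real.sign :=
      Measurable.ite measurableSet_Iio measurable_const
        (Measurable.ite measurableSet_Ioi measurable_const measurable_const)
    split_ifs <;> exact Measurable.aestronglyMeasurable (by fun_prop)
  have h1 : IntegrableOn (fun t : ℝ => Real.exp (-|θ sigmaIx * t| ^ θ alphaIx)) (Ioi 0) := by
    have := integrableOn_rpow_mul_exp_neg_mul_rpow (s := 0) (p := θ alphaIx)
      (b := θ sigmaIx ^ θ alphaIx) (by norm_num) hα.1 (by positivity)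
    refine this.congr_fun (fun t ht => ?_) measurableSet_Ioi
    have ht' : (0 : ℝ) < t := ht
    simp only [Real.rpow_zero, one_mul]
    rw [abs_of_pos (mul_pos hσ ht'), Real.mul_rpow hσ.le ht'.le, neg_mul]
  have h2 : Integrable (fun t : ℝ => Real.exp (-|θ sigmaIx * t| ^ θ alphaIx)) := by
    rw [← integrableOn_univ, ← Iic_union_Ioi (a := (0 : ℝ))]
    refine IntegrableOn.union ?_ h1
    rw [← Measure.map_neg_eq_self (volume : Measure ℝ)]
    let m : MeasurableEmbedding fun x : ℝ => -x := (Homeomorph.neg ℝ).measurableEmbedding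
    rw [m.integrableOn_map_iff]
    simp_rw [Function.comp_def, mul_neg, abs_neg, neg_preimage, neg_Iic, neg_zero]
    exact Iff.mpr integrableOn_Ici_iff_integrableOn_Ioi h1
  exact (integrable_norm_iff hm).1 (by simpa only [norm_m0CharFun] using h2)

/-- `m0Density` is the density of the law: any continuous density of a probability measure with
characteristic function `m0CharFun θ` equals `m0Density · θ`. -/
theorem eq_m0Density_of_charFun {θ : Fin 4 → ℝ} (hθ : θ ∈ ThetaM)
    (P : Measure ℝ) [IsProbabilityMeasure P] (hP : ∀ t, charFun P t = m0CharFun θ t)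
    (h : ℝ → ℝ) (hc : Continuous h) (h0 : ∀ x, 0 ≤ h x)
    (hd : P = volume.withDensity fun x => ENNReal.ofReal (h x)) (x : ℝ) :
    h x = m0Density x θ := by
  have hi : Integrable h := by
    refine ⟨hc.aestronglyMeasurable, ?_⟩
    rw [hasFiniteIntegral_iff_ofReal (ae_of_all _ h0), ← setLIntegral_univ,
      ← withDensity_apply _ MeasurableSet.univ, ← hd]
    exact measure_lt_top _ _
  have hF : ∀ w : ℝ, FourierTransform.fourier (fun y => (h y : ℂ)) w
      = m0CharFun θ (-(2 * Real.pi) * w) := by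
    intro w
    rw [← hP, charFun_apply_real, hd, integral_withDensity_eq_integral_toReal_smul
      (by fun_prop) (by simp), Real.fourier_real_eq_integral_exp_smul]
    refine integral_congr_ae (ae_of_all _ fun y => ?_)
    simp only [ENNReal.toReal_ofReal (h0 y), Complex.real_smul, smul_eq_mul]
    rw [mul_comm]
    congr 2
    push_cast
    ring
  have hpi : (-(2 * Real.pi)) ≠ 0 := by simp [Real.pi_ne_zero]
  have hFi : Integrable (FourierTransform.fourier fun y => (h y : ℂ)) := by
    rw [funext hF]
    exact (integrable_m0CharFun hθ).comp_mul_left' hpi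
  have key := congrFun (Continuous.fourierInv_fourier_eq (f := fun y => (h y : ℂ))
    (by fun_prop) hi.ofReal hFi) x
  rw [Real.fourierInv_eq', funext hF] at key
  have h2 := Measure.integral_comp_mul_left
    (fun t : ℝ => Complex.exp (-(Complex.I * (t * x : ℝ))) * m0CharFun θ t) (-(2 * Real.pi))
  have h3 : ∀ v : ℝ, Complex.exp (((2 * Real.pi * inner ℝ v x : ℝ) : ℂ) * Complex.I) •
      m0CharFun θ (-(2 * Real.pi) * v) =
      Complex.exp (-(Complex.I * ((-(2 * Real.pi) * v) * x : ℝ))) *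
        m0CharFun θ (-(2 * Real.pi) * v) := by
    intro v
    rw [smul_eq_mul]
    congr 2
    simp
    ring
  simp_rw [h3] at key
  rw [h2] at key
  have h4 := congrArg Complex.re key
  rw [Complex.ofReal_re, Complex.real_smul, Complex.re_ofReal_mul] at h4
  rw [← h4, m0Density]
  congr 1
  rw [abs_inv, abs_neg, abs_of_pos (by positivity), one_div]

/-- The partial derivative of `F` at `θ` in the coordinate `i`. -/
noncomputable def partialTheta (i : Fin 4) (F : (Fin 4 → ℝ) → ℝ) (θ : Fin 4 → ℝ) : ℝ :=
  deriv (fun s : ℝ => F (Function.update θ i s)) (θ i)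

/-- `f' = ∂f/∂x`. -/
noncomputable def fX (x : ℝ) (θ : Fin 4 → ℝ) : ℝ :=
  deriv (fun y : ℝ => m0Density y θ) x

/-- `f_{θᵢ} = ∂f/∂θᵢ`. -/
noncomputable def fTheta (i : Fin 4) (x : ℝ) (θ : Fin 4 → ℝ) : ℝ :=
  partialTheta i (m0Density x) θ

/-- `f_{θᵢ}' = ∂²f/∂x∂θᵢ`. -/
noncomputable def fThetaX (i : Fin 4) (x : ℝ) (θ : Fin 4 → ℝ) : ℝ :=
  deriv (fun y : ℝ => fTheta i y θ) x

/-- `f_{θᵢθⱼ} = ∂²f/∂θᵢ∂θⱼ`. -/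
noncomputable def fThetaTheta (i j : Fin 4) (x : ℝ) (θ : Fin 4 → ℝ) : ℝ :=
  partialTheta i (fTheta j x) θ

/-- `F(x) = O(|x|^{-p} (log |x|)^k)` as `|x| → ∞`. -/
def TailBound (F : ℝ → ℝ) (p : ℝ) (k : ℕ) : Prop :=
  F =O[Bornology.cobounded ℝ] fun x : ℝ => |x| ^ (-p) * Real.log |x| ^ k

/-! Standardising gives `f(x; θ) = σ⁻¹ g((x - μ)/σ, α, β)` with `g = stdDensity` (`m0Density_eq`),
so everything reduces to `g` on `0 < α < 2`, where conjugate symmetry yields `g = π⁻¹ Re ∫₀^∞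
e^{-ity} φ(t) dt`. The exponent of `φ` continues holomorphically to the slit plane as `-z^α - iβ
c(α) z log z · E((α - 1) log z)`, with `c(α) = (α - 1) cot(π(α - 1)/2)` and `E(w) = (e^w - 1)/w`.
Since `c` is smooth on `(0, 2)` and `E` is entire, `α = 1` is an ordinary point of this formula.

Cauchy's theorem replaces the half-line by the segment from `0` to `-i` followed by the ray `t - i`
(`stdKernel_rectangle`, `integral_stdKernel_ofReal`). There the real part of the exponent is at most
`C - t^{a₀}/4`, locally uniformly in the parameters (`exists_re_stdExponent_le`). The resulting
dominating functions allow two differentiations under the integral sign, so `g`, and then `f`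
jointly in `(x, θ)`, is `C²`; the regularity and interchange statements are read off from the first
two Fréchet derivatives.

For the tails as `y → ∞`, the ray contributes `O(e^{-y})`, also after differentiation. On the
segment `z = -iu` the factor `e^{-izy}` is `e^{-uy}`, so the contribution is a Laplace transform
over `(0, 1)`, of which only the imaginary part enters `g`. The terms of size `u` or `u log u` in
the exponent are real there. What remains is `O(u^α |log u|^k)`, a class stable under sums, products
and exponentials (`ImTame`). Each derivative in `α` costs a logarithm and each derivative in `y`
gains a factor `u`; `isBigO_laplace` turns `u^{α+n} |log u|^k` into `y^{-(1+α+n)} log^k y`. The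
other tail follows from the symmetry `(y, β) ↦ (-y, -β)`.

At `α = 1` the two improvements are cancellations. For `f_ββ`, the square of the coefficient `b` of
`β` has imaginary part `2 Re b · Im b = O(u² |log u|)`. For `f_σσ`, which is `σ⁻³ (y² g)''`, the
operator `(y² ·)''` annihilates the leading term `y⁻²` (`laplace_moment_combination`), and the rest
is governed by `im_cexp_stdExponent_one`. -/

/-! ### Differentiation under the integral sign. -/

/-- Twice differentiating an integral depending on a parameter under the integral sign. -/
theorem contDiffOn_two_integral {E F T : Type*} [NormedAddCommGroup E] [NormedSpace ℝ E]
    [NormedAddCommGroup F] [NormedSpace ℝ F] [CompleteSpace F] [MeasurableSpace T]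
    {μ : Measure T} {U : Set E} (hU : IsOpen U) {G : E → T → F} {G1 : E → T → E →L[ℝ] F}
    {G2 : E → T → E →L[ℝ] E →L[ℝ] F}
    (h1 : ∀ᵐ t ∂μ, ∀ q ∈ U, HasFDerivAt (G · t) (G1 q t) q)
    (h2 : ∀ᵐ t ∂μ, ∀ q ∈ U, HasFDerivAt (G1 · t) (G2 q t) q)
    (hc : ∀ᵐ t ∂μ, ContinuousOn (G2 · t) U)
    (m0 : ∀ q ∈ U, AEStronglyMeasurable (G q) μ) (m1 : ∀ q ∈ U, AEStronglyMeasurable (G1 q) μ)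
    (m2 : ∀ q ∈ U, AEStronglyMeasurable (G2 q) μ)
    (hb : ∀ q ∈ U, ∃ s ∈ nhds q, ∃ bound : T → ℝ, Integrable bound μ ∧
      ∀ᵐ t ∂μ, ∀ q' ∈ s, ‖G q' t‖ ≤ bound t ∧ ‖G1 q' t‖ ≤ bound t ∧ ‖G2 q' t‖ ≤ bound t) :
    ContDiffOn ℝ 2 (fun q => ∫ t, G q t ∂μ) U ∧
      (∀ q ∈ U, HasFDerivAt (fun q => ∫ t, G q t ∂μ) (∫ t, G1 q t ∂μ) q) ∧
      (∀ q ∈ U, HasFDerivAt (fun q => ∫ t, G1 q t ∂μ) (∫ t, G2 q t ∂μ) q) := by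
  have d1 : ∀ q ∈ U, HasFDerivAt (fun q => ∫ t, G q t ∂μ) (∫ t, G1 q t ∂μ) q := by
    intro q hq
    obtain ⟨s, hs, bound, hbi, hbd⟩ := hb q hq
    refine hasFDerivAt_integral_of_dominated_of_fderiv_le (s := s ∩ U) (bound := bound)
      (inter_mem hs (hU.mem_nhds hq)) ?_ ?_ (m1 q hq) ?_ hbi ?_
    · filter_upwards [hU.mem_nhds hq] with x hx using m0 x hx
    · exact hbi.mono' (m0 q hq) (hbd.mono fun t ht => (ht q (mem_of_mem_nhds hs)).1)
    · exact hbd.mono fun t ht x hx => (ht x hx.1).2.1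
    · exact h1.mono fun t ht x hx => ht x hx.2
  have d2 : ∀ q ∈ U, HasFDerivAt (fun q => ∫ t, G1 q t ∂μ) (∫ t, G2 q t ∂μ) q := by
    intro q hq
    obtain ⟨s, hs, bound, hbi, hbd⟩ := hb q hq
    refine hasFDerivAt_integral_of_dominated_of_fderiv_le (s := s ∩ U) (bound := bound)
      (inter_mem hs (hU.mem_nhds hq)) ?_ ?_ (m2 q hq) ?_ hbi ?_
    · filter_upwards [hU.mem_nhds hq] with x hx using m1 x hx
    · exact hbi.mono' (m1 q hq) (hbd.mono fun t ht => (ht q (mem_of_mem_nhds hs)).2.1)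
    · exact hbd.mono fun t ht x hx => (ht x hx.1).2.2
    · exact h2.mono fun t ht x hx => ht x hx.2
  have c2 : ContinuousOn (fun q => ∫ t, G2 q t ∂μ) U := by
    intro q hq
    obtain ⟨s, hs, bound, hbi, hbd⟩ := hb q hq
    refine ContinuousAt.continuousWithinAt (continuousAt_of_dominated (bound := bound) ?_ ?_ hbi ?_)
    · filter_upwards [hU.mem_nhds hq] with x hx using m2 x hx
    · filter_upwards [hs] with x hx using hbd.mono fun t ht => (ht x hx).2.2
    · exact hc.mono fun t ht => ht.continuousAt (hU.mem_nhds hq)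
  refine ⟨?_, d1, d2⟩
  have e1 : ContDiffOn ℝ 1 (fun q => ∫ t, G1 q t ∂μ) U := by
    refine (contDiffOn_succ_iff_fderiv_of_isOpen (n := 0) hU).2
      ⟨fun q hq => (d2 q hq).differentiableAt.differentiableWithinAt, by simp, ?_⟩
    exact contDiffOn_zero.2 (c2.congr fun q hq => (d2 q hq).fderiv)
  refine (contDiffOn_succ_iff_fderiv_of_isOpen (n := 1) hU).2
      ⟨fun q hq => (d1 q hq).differentiableAt.differentiableWithinAt, by simp, ?_⟩
  exact e1.congr fun q hq => (d1 q hq).fderiv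

/-! ### Entire and smooth functions that remove the singularity at `α = 1`. -/

/-- The exponential moment `∫₀¹ sᵏ e^{sw} ds`. -/
noncomputable def expMoment (k : ℕ) (w : ℂ) : ℂ :=
  ∫ s in (0 : ℝ)..1, (s : ℂ) ^ k * Complex.exp (s * w)

theorem norm_expMoment_integrand_le (k : ℕ) (w : ℂ) {s : ℝ} (hs : s ∈ Ioc (0 : ℝ) 1) :
    ‖(s : ℂ) ^ k * Complex.exp (s * w)‖ ≤ Real.exp (max 0 w.re) := by
  rw [norm_mul, norm_pow, Complex.norm_exp, Complex.norm_real, Real.norm_of_nonneg hs.1.le]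
  have h1 : s ^ k ≤ 1 := pow_le_one₀ hs.1.le hs.2
  have h2 : ((s : ℂ) * w).re ≤ max 0 w.re := by
    rw [Complex.re_ofReal_mul]
    rcases le_total 0 w.re with h | h
    · rw [max_eq_right h]; nlinarith [hs.2]
    · rw [max_eq_left h]; nlinarith [hs.1]
  calc s ^ k * Real.exp ((s : ℂ) * w).re ≤ 1 * Real.exp (max 0 w.re) := by gcongr
    _ = _ := one_mul _

theorem norm_expMoment_le (k : ℕ) (w : ℂ) : ‖expMoment k w‖ ≤ Real.exp (max 0 w.re) := by
  have := intervalIntegral.norm_integral_le_of_norm_le_const (a := (0 : ℝ)) (b := 1)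
    (C := Real.exp (max 0 w.re)) (f := fun s : ℝ => (s : ℂ) ^ k * Complex.exp (s * w))
    (fun s hs => norm_expMoment_integrand_le k w (by rwa [uIoc_of_le zero_le_one] at hs))
  simpa [expMoment] using this

theorem hasDerivAt_expMoment (k : ℕ) (w : ℂ) :
    HasDerivAt (expMoment k) (expMoment (k + 1) w) w := by
  refine (intervalIntegral.hasDerivAt_integral_of_dominated_loc_of_deriv_le
    (F := fun (w : ℂ) (s : ℝ) => (s : ℂ) ^ k * Complex.exp (s * w))
    (F' := fun (w : ℂ) (s : ℝ) => (s : ℂ) ^ (k + 1) * Complex.exp (s * w))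
    -- The derivative is dominated on the unit ball around `w`, where real parts exceed `w.re` by at
    -- most `1`.
    (bound := fun _ => Real.exp (max 0 (w.re + 1)))
    (Metric.ball_mem_nhds w one_pos) ?_ ?_ ?_ ?_ ?_ ?_).2
  · exact Eventually.of_forall fun x => Continuous.aestronglyMeasurable (by fun_prop)
  · exact Continuous.intervalIntegrable (by fun_prop) _ _
  · exact Continuous.aestronglyMeasurable (by fun_prop)
  · refine ae_of_all _ fun s hs x hx => ?_
    rw [uIoc_of_le zero_le_one] at hs
    refine (norm_expMoment_integrand_le (k + 1) x hs).trans ?_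
    have h3 : x.re - w.re ≤ 1 := by
      have := Complex.abs_re_le_norm (x - w)
      rw [Metric.mem_ball, dist_eq_norm] at hx
      rw [Complex.sub_re] at this
      linarith [le_abs_self (x.re - w.re)]
    gcongr
    linarith
  · exact intervalIntegrable_const
  · refine ae_of_all _ fun s _ x _ => ?_
    have := (((hasDerivAt_id x).const_mul (s : ℂ)).cexp).const_mul ((s : ℂ) ^ k)
    exact this.congr_deriv (by simp only [id]; ring)

theorem continuous_expMoment (k : ℕ) : Continuous (expMoment k) :=
  continuous_iff_continuousAt.2 fun w => (hasDerivAt_expMoment k w).continuousAt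

/-- Identifies `expMoment 0` as `(e^w - 1)/w` with the singularity at `0` filled in. It serves both
for `t^(α-1) - 1` divided by `α - 1` and for `sin x / x`. -/
theorem mul_expMoment_zero (w : ℂ) : w * expMoment 0 w = Complex.exp w - 1 := by
  rcases eq_or_ne w 0 with rfl | hw
  · simp
  have h : ∀ x ∈ uIcc (0 : ℝ) 1, HasDerivAt (fun s : ℝ => Complex.exp (s * w))
      (w * ((x : ℂ) ^ 0 * Complex.exp (x * w))) x := by
    intro x _
    have := ((Complex.ofRealCLM.hasDerivAt (x := x)).mul_const w).cexp
    simpa [mul_comm] using this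
  rw [expMoment, ← intervalIntegral.integral_const_mul,
    intervalIntegral.integral_eq_sub_of_hasDerivAt h
      (Continuous.intervalIntegrable (by fun_prop) _ _)]
  simp

theorem expMoment_zero_zero : expMoment 0 0 = 1 := by simp [expMoment]

theorem contDiff_expMoment (k : ℕ) {n : WithTop ℕ∞} : ContDiff ℂ n (expMoment k) :=
  Differentiable.contDiff fun w => (hasDerivAt_expMoment k w).differentiableAt

/-- The real part of `expMoment 0 (i x)` plays the role of `sin x / x` and is smooth through `0`;
dividing by it defines `cotCoeff` without a case split. -/
theorem sin_eq_mul_expMoment (x : ℝ) :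
    Real.sin x = x * (expMoment 0 (Complex.I * x)).re := by
  have := congrArg Complex.im (mul_expMoment_zero (Complex.I * x))
  rw [mul_comm Complex.I (x : ℂ)] at *
  simpa [Complex.exp_ofReal_mul_I_im, mul_assoc] using this.symm

theorem expMoment_re_ne_zero {x : ℝ} (hx : |x| < Real.pi) :
    (expMoment 0 (Complex.I * x)).re ≠ 0 := by
  rcases eq_or_ne x 0 with rfl | h
  · simp [expMoment_zero_zero]
  · intro h0
    have := sin_eq_mul_expMoment x
    rw [h0, mul_zero] at this
    rw [abs_lt] at hx
    exact h ((Real.sin_eq_zero_iff_of_lt_of_lt hx.1 hx.2).1 this)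

/-- The smooth extension across `α = 1` of `(α - 1) cot (π (α - 1) / 2)`. -/
noncomputable def cotCoeff (α : ℝ) : ℝ :=
  Real.cos (Real.pi * (α - 1) / 2) /
    (Real.pi / 2 * (expMoment 0 (Complex.I * (Real.pi * (α - 1) / 2 : ℝ))).re)

theorem contDiffOn_cotCoeff {n : WithTop ℕ∞} : ContDiffOn ℝ n cotCoeff (Ioo 0 2) := by
  intro α hα
  have hp := Real.pi_pos
  refine ContDiffAt.contDiffWithinAt (ContDiffAt.div (by fun_prop) ?_ ?_)
  · refine contDiffAt_const.mul (ContDiff.contDiffAt ?_)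
    refine Complex.reCLM.contDiff.comp (((contDiff_expMoment 0).restrict_scalars ℝ).comp ?_)
    refine contDiff_const.mul (Complex.ofRealCLM.contDiff.comp ?_)
    exact (contDiff_const.mul (contDiff_id.sub contDiff_const)).div_const 2
  · refine mul_ne_zero (by positivity) (expMoment_re_ne_zero ?_)
    rw [abs_lt]
    constructor <;> nlinarith [hα.1, hα.2]

/-- The division-free form of the cotangent identity, which also makes sense at `α = 1`. -/
theorem cotCoeff_mul_sin (α : ℝ) (hα : α ∈ Ioo (0 : ℝ) 2) :
    cotCoeff α * Real.sin (Real.pi * (α - 1) / 2) =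
      (α - 1) * Real.cos (Real.pi * (α - 1) / 2) := by
  have hp := Real.pi_pos
  have : (expMoment 0 (Complex.I * (Real.pi * (α - 1) / 2 : ℝ))).re ≠ 0 := by
    refine expMoment_re_ne_zero ?_
    rw [abs_lt]
    constructor <;> nlinarith [hα.1, hα.2]
  rw [sin_eq_mul_expMoment, cotCoeff]
  field_simp

theorem cotCoeff_one : cotCoeff 1 = 2 / Real.pi := by
  simp [cotCoeff, expMoment_zero_zero]

/-- A shift of the angle by `π/2` turns `-tan(πα/2)` into `cot(π(α - 1)/2)`. This links `cotCoeff`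
to the tangent in the characteristic function. -/
theorem cotCoeff_eq_tan {α : ℝ} (hα : α ∈ Ioo (0 : ℝ) 2) (h1 : α ≠ 1) :
    cotCoeff α = -((α - 1) * Real.tan (Real.pi * α / 2)) := by
  have hp := Real.pi_pos
  have hs : Real.sin (Real.pi * (α - 1) / 2) ≠ 0 := by
    intro h
    have := (Real.sin_eq_zero_iff_of_lt_of_lt (x := Real.pi * (α - 1) / 2)
      (by nlinarith [hα.1]) (by nlinarith [hα.2])).1 h
    have : α - 1 = 0 := by nlinarith
    exact h1 (by linarith)
  have h2 := cotCoeff_mul_sin α hα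
  have e1 : Real.sin (Real.pi * α / 2) = Real.cos (Real.pi * (α - 1) / 2) := by
    rw [← Real.sin_add_pi_div_two]; congr 1; ring
  have e2 : Real.cos (Real.pi * α / 2) = -Real.sin (Real.pi * (α - 1) / 2) := by
    rw [← Real.cos_add_pi_div_two]; congr 1; ring
  rw [Real.tan_eq_sin_div_cos, e1, e2, div_neg, mul_neg, neg_neg, ← mul_div_assoc, eq_div_iff hs, h2]

theorem hasDerivAt_cotCoeff {α : ℝ} (hα : α ∈ Ioo (0 : ℝ) 2) :
    HasDerivAt cotCoeff (deriv cotCoeff α) α :=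
  (((contDiffOn_cotCoeff (n := 1)).contDiffAt (isOpen_Ioo.mem_nhds hα)).differentiableAt
    (by simp)).hasDerivAt

theorem contDiffOn_deriv_cotCoeff : ContDiffOn ℝ 1 (deriv cotCoeff) (Ioo 0 2) :=
  ((contDiffOn_succ_iff_deriv_of_isOpen (n := 1) isOpen_Ioo).1
    (contDiffOn_cotCoeff (n := 1 + 1))).2.2

theorem hasDerivAt_deriv_cotCoeff {α : ℝ} (hα : α ∈ Ioo (0 : ℝ) 2) :
    HasDerivAt (deriv cotCoeff) (deriv (deriv cotCoeff) α) α :=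
  ((contDiffOn_deriv_cotCoeff.contDiffAt (isOpen_Ioo.mem_nhds hα)).differentiableAt
    (by simp)).hasDerivAt

theorem continuousOn_deriv_deriv_cotCoeff : ContinuousOn (deriv (deriv cotCoeff)) (Ioo 0 2) :=
  ((contDiffOn_succ_iff_deriv_of_isOpen (n := 0) isOpen_Ioo).1
    contDiffOn_deriv_cotCoeff).2.2.continuousOn

/-- A bound on compact parameter ranges for `cotCoeff` and its first two derivatives. -/
theorem exists_cotCoeff_bound {a₀ a₁ : ℝ} (h0 : 0 < a₀) (h1 : a₁ < 2) :
    ∃ C : ℝ, 1 ≤ C ∧ ∀ α ∈ Icc a₀ a₁, |cotCoeff α| ≤ C ∧ |deriv cotCoeff α| ≤ C ∧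
      |deriv (deriv cotCoeff) α| ≤ C := by
  have hsub : Icc a₀ a₁ ⊆ Ioo 0 2 := fun x hx => ⟨h0.trans_le hx.1, hx.2.trans_lt h1⟩
  obtain ⟨C0, hC0⟩ := isCompact_Icc.exists_bound_of_continuousOn
    ((contDiffOn_cotCoeff (n := 0)).continuousOn.mono hsub)
  obtain ⟨C1, hC1⟩ := isCompact_Icc.exists_bound_of_continuousOn
    (contDiffOn_deriv_cotCoeff.continuousOn.mono hsub)
  obtain ⟨C2, hC2⟩ := isCompact_Icc.exists_bound_of_continuousOn
    (continuousOn_deriv_deriv_cotCoeff.mono hsub)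
  refine ⟨max 1 (max C0 (max C1 C2)), le_max_left _ _, fun α hα => ⟨?_, ?_, ?_⟩⟩
  · exact (hC0 α hα).trans (by simp)
  · exact (hC1 α hα).trans (by simp)
  · exact (hC2 α hα).trans (by simp)

/-! ### The coefficients of the exponent and their derivatives in `α`. -/

/-- The `k`-th derivative in `α` of `-z ^ α`. -/
noncomputable def powCoeff (k : ℕ) (α : ℝ) (z : ℂ) : ℂ :=
  -(Complex.log z ^ k * Complex.exp (α * Complex.log z))

/-- The coefficient of `β` in the exponent of the standard stable characteristic function. -/
noncomputable def skewCoeff (α : ℝ) (z : ℂ) : ℂ :=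
  -(Complex.I * z) * (cotCoeff α * (Complex.log z * expMoment 0 ((α - 1 : ℝ) * Complex.log z)))

/-- The derivative of `skewCoeff` in `α`. -/
noncomputable def skewCoeffDeriv (α : ℝ) (z : ℂ) : ℂ :=
  -(Complex.I * z) *
    (deriv cotCoeff α * (Complex.log z * expMoment 0 ((α - 1 : ℝ) * Complex.log z)) +
      cotCoeff α * (Complex.log z ^ 2 * expMoment 1 ((α - 1 : ℝ) * Complex.log z)))

/-- The second derivative of `skewCoeff` in `α`. -/
noncomputable def skewCoeffDerivTwo (α : ℝ) (z : ℂ) : ℂ :=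
  -(Complex.I * z) *
    (deriv (deriv cotCoeff) α * (Complex.log z * expMoment 0 ((α - 1 : ℝ) * Complex.log z)) +
      2 * (deriv cotCoeff α * (Complex.log z ^ 2 * expMoment 1 ((α - 1 : ℝ) * Complex.log z))) +
      cotCoeff α * (Complex.log z ^ 3 * expMoment 2 ((α - 1 : ℝ) * Complex.log z)))

theorem hasDerivAt_powCoeff (k : ℕ) (α : ℝ) (z : ℂ) :
    HasDerivAt (fun α : ℝ => powCoeff k α z) (powCoeff (k + 1) α z) α := by
  have h := ((Complex.ofRealCLM.hasDerivAt (x := α)).mul_const (Complex.log z)).cexp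
  have h2 := (h.const_mul (Complex.log z ^ k)).neg
  refine h2.congr_deriv ?_
  simp [powCoeff]; ring

/-- Differentiating in `α` raises the power of the logarithm and the index of the moment together,
so the derivatives of `skewCoeff` keep the shape of the original. -/
theorem hasDerivAt_expMoment_mul (k : ℕ) (α : ℝ) (w : ℂ) :
    HasDerivAt (fun α : ℝ => w ^ (k + 1) * expMoment k ((α - 1 : ℝ) * w))
      (w ^ (k + 2) * expMoment (k + 1) ((α - 1 : ℝ) * w)) α := by
  have h0 : HasDerivAt (fun α : ℝ => ((α - 1 : ℝ) : ℂ) * w) (1 * w) α := by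
    refine HasDerivAt.mul_const ?_ w
    simpa using ((hasDerivAt_id α).sub_const 1).ofReal_comp
  have h := (((hasDerivAt_expMoment k _).comp α h0)).const_mul (w ^ (k + 1))
  refine h.congr_deriv ?_
  ring

theorem hasDerivAt_skewCoeff {α : ℝ} (hα : α ∈ Ioo (0 : ℝ) 2) (z : ℂ) :
    HasDerivAt (fun α : ℝ => skewCoeff α z) (skewCoeffDeriv α z) α := by
  have h := ((hasDerivAt_cotCoeff hα).ofReal_comp.mul
    (hasDerivAt_expMoment_mul 0 α (Complex.log z))).const_mul (-(Complex.I * z))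
  simp only [zero_add, pow_one] at h
  exact h

theorem hasDerivAt_skewCoeffDeriv {α : ℝ} (hα : α ∈ Ioo (0 : ℝ) 2) (z : ℂ) :
    HasDerivAt (fun α : ℝ => skewCoeffDeriv α z) (skewCoeffDerivTwo α z) α := by
  have h := (((hasDerivAt_deriv_cotCoeff hα).ofReal_comp.mul
    (hasDerivAt_expMoment_mul 0 α (Complex.log z))).add
    ((hasDerivAt_cotCoeff hα).ofReal_comp.mul
    (hasDerivAt_expMoment_mul 1 α (Complex.log z)))).const_mul (-(Complex.I * z))
  simp only [zero_add, pow_one] at h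
  refine h.congr_deriv ?_
  simp only [skewCoeffDerivTwo]
  ring

theorem continuousOn_skewCoeffDerivTwo (z : ℂ) :
    ContinuousOn (fun α : ℝ => skewCoeffDerivTwo α z) (Ioo 0 2) := by
  have h0 : ContinuousOn (fun α => (cotCoeff α : ℂ)) (Ioo 0 2) :=
    Complex.continuous_ofReal.comp_continuousOn (contDiffOn_cotCoeff (n := 0)).continuousOn
  have h1 : ContinuousOn (fun α : ℝ => ((deriv cotCoeff α : ℝ) : ℂ)) (Ioo 0 2) :=
    Complex.continuous_ofReal.comp_continuousOn contDiffOn_deriv_cotCoeff.continuousOn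
  have h2 : ContinuousOn (fun α : ℝ => ((deriv (deriv cotCoeff) α : ℝ) : ℂ)) (Ioo 0 2) :=
    Complex.continuous_ofReal.comp_continuousOn continuousOn_deriv_deriv_cotCoeff
  have he : ∀ k, ContinuousOn
      (fun α : ℝ => expMoment k ((α - 1 : ℝ) * Complex.log z)) (Ioo 0 2) := fun k =>
    ((continuous_expMoment k).comp (by fun_prop)).continuousOn
  have e0 := he 0
  have e1 := he 1
  have e2 := he 2
  unfold skewCoeffDerivTwo
  fun_prop

/-! ### The integrand and its first two derivatives in `(y, α, β)`. -/

/-- The space of the variables `(y, α, β)`. -/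
abbrev StdVar : Type := ℝ × ℝ × ℝ

/-- The admissible values of `(y, α, β)`. -/
def stdDomain : Set StdVar := {q | q.2.1 ∈ Ioo (0 : ℝ) 2}

theorem isOpen_stdDomain : IsOpen stdDomain :=
  isOpen_Ioo.preimage (continuous_fst.comp continuous_snd)

/-- The coordinate `y`, complex valued. -/
noncomputable def coordY : StdVar →L[ℝ] ℂ :=
  Complex.ofRealCLM.comp (ContinuousLinearMap.fst ℝ ℝ (ℝ × ℝ))

/-- The coordinate `α`, complex valued. -/
noncomputable def coordA : StdVar →L[ℝ] ℂ :=
  Complex.ofRealCLM.comp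
    ((ContinuousLinearMap.fst ℝ ℝ ℝ).comp (ContinuousLinearMap.snd ℝ ℝ (ℝ × ℝ)))

/-- The coordinate `β`, complex valued. -/
noncomputable def coordB : StdVar →L[ℝ] ℂ :=
  Complex.ofRealCLM.comp
    ((ContinuousLinearMap.snd ℝ ℝ ℝ).comp (ContinuousLinearMap.snd ℝ ℝ (ℝ × ℝ)))

@[simp] theorem coordY_apply (v : StdVar) : coordY v = v.1 := rfl
@[simp] theorem coordA_apply (v : StdVar) : coordA v = v.2.1 := rfl
@[simp] theorem coordB_apply (v : StdVar) : coordB v = v.2.2 := rfl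

theorem norm_coordY_le : ‖coordY‖ ≤ 1 :=
  ContinuousLinearMap.opNorm_le_bound _ zero_le_one fun v => by
    simpa using norm_fst_le v

theorem norm_coordA_le : ‖coordA‖ ≤ 1 :=
  ContinuousLinearMap.opNorm_le_bound _ zero_le_one fun v => by
    simpa using (norm_fst_le v.2).trans (norm_snd_le v)

theorem norm_coordB_le : ‖coordB‖ ≤ 1 :=
  ContinuousLinearMap.opNorm_le_bound _ zero_le_one fun v => by
    simpa using (norm_snd_le v.2).trans (norm_snd_le v)

/-- The exponent of the integrand `e^{-izy} φ(z)` at parameters `q = (y, α, β)`. -/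
noncomputable def stdPhase (q : StdVar) (z : ℂ) : ℂ :=
  -(Complex.I * z) * q.1 + (powCoeff 0 q.2.1 z + q.2.2 * skewCoeff q.2.1 z)

/-- The derivative of `stdPhase` in `α`. -/
noncomputable def stdPhaseA (q : StdVar) (z : ℂ) : ℂ :=
  powCoeff 1 q.2.1 z + q.2.2 * skewCoeffDeriv q.2.1 z

/-- The second derivative of `stdPhase` in `α`. -/
noncomputable def stdPhaseAA (q : StdVar) (z : ℂ) : ℂ :=
  powCoeff 2 q.2.1 z + q.2.2 * skewCoeffDerivTwo q.2.1 z

/-- The derivative of `stdPhase`. -/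
noncomputable def stdPhaseD (q : StdVar) (z : ℂ) : StdVar →L[ℝ] ℂ :=
  (-(Complex.I * z)) • coordY + (stdPhaseA q z • coordA + skewCoeff q.2.1 z • coordB)

/-- The second derivative of `stdPhase`. -/
noncomputable def stdPhaseDD (q : StdVar) (z : ℂ) : StdVar →L[ℝ] StdVar →L[ℝ] ℂ :=
  (stdPhaseAA q z • coordA + skewCoeffDeriv q.2.1 z • coordB).smulRight coordA +
    (skewCoeffDeriv q.2.1 z • coordA).smulRight coordB

theorem hasFDerivAt_comp_coordA {f : ℝ → ℂ} {f' : ℂ} {q : StdVar} (h : HasDerivAt f f' q.2.1) :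
    HasFDerivAt (fun q : StdVar => f q.2.1) (f' • coordA) q := by
  have h1 : HasFDerivAt (fun q : StdVar => q.2.1)
    ((ContinuousLinearMap.fst ℝ ℝ ℝ).comp (ContinuousLinearMap.snd ℝ ℝ (ℝ × ℝ))) q :=
    ((ContinuousLinearMap.fst ℝ ℝ ℝ).comp (ContinuousLinearMap.snd ℝ ℝ (ℝ × ℝ))).hasFDerivAt
  refine (h.hasFDerivAt.comp q h1).congr_fderiv (ContinuousLinearMap.ext fun v => ?_)
  simp [mul_comm]

theorem hasFDerivAt_coordB_mul {f : StdVar → ℂ} {f' : StdVar →L[ℝ] ℂ} {q : StdVar}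
    (h : HasFDerivAt f f' q) :
    HasFDerivAt (fun q : StdVar => (q.2.2 : ℂ) * f q) ((q.2.2 : ℂ) • f' + f q • coordB) q :=
  (coordB.hasFDerivAt (x := q)).mul h

theorem hasFDerivAt_stdPhase {q : StdVar} (hq : q ∈ stdDomain) (z : ℂ) :
    HasFDerivAt (stdPhase · z) (stdPhaseD q z) q := by
  have h := ((coordY.hasFDerivAt (x := q)).const_mul (-(Complex.I * z))).add
    ((hasFDerivAt_comp_coordA (hasDerivAt_powCoeff 0 q.2.1 z)).add
    (hasFDerivAt_coordB_mul (hasFDerivAt_comp_coordA (hasDerivAt_skewCoeff hq z))))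
  refine h.congr_fderiv (ContinuousLinearMap.ext fun v => ?_)
  simp [stdPhaseD, stdPhaseA]; ring

theorem hasFDerivAt_stdPhaseA {q : StdVar} (hq : q ∈ stdDomain) (z : ℂ) :
    HasFDerivAt (stdPhaseA · z) (stdPhaseAA q z • coordA + skewCoeffDeriv q.2.1 z • coordB) q := by
  have h := (hasFDerivAt_comp_coordA (hasDerivAt_powCoeff 1 q.2.1 z)).add
    (hasFDerivAt_coordB_mul (hasFDerivAt_comp_coordA (hasDerivAt_skewCoeffDeriv hq z)))
  refine h.congr_fderiv (ContinuousLinearMap.ext fun v => ?_)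
  simp [stdPhaseAA]; ring

theorem hasFDerivAt_stdPhaseD {q : StdVar} (hq : q ∈ stdDomain) (z : ℂ) :
    HasFDerivAt (stdPhaseD · z) (stdPhaseDD q z) q := by
  have h1 := (hasFDerivAt_stdPhaseA hq z).smul_const coordA
  have h2 := (hasFDerivAt_comp_coordA (hasDerivAt_skewCoeff hq z)).smul_const coordB
  exact (h1.add h2).const_add _

/-- The integrand `e^{-izy} φ(z)`. -/
noncomputable def stdKernel (q : StdVar) (z : ℂ) : ℂ := Complex.exp (stdPhase q z)

/-- The derivative of `stdKernel` in the parameters. -/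
noncomputable def stdKernelD (q : StdVar) (z : ℂ) : StdVar →L[ℝ] ℂ :=
  stdKernel q z • stdPhaseD q z

/-- The second derivative of `stdKernel` in the parameters. -/
noncomputable def stdKernelDD (q : StdVar) (z : ℂ) : StdVar →L[ℝ] StdVar →L[ℝ] ℂ :=
  stdKernel q z • stdPhaseDD q z + (stdKernelD q z).smulRight (stdPhaseD q z)

theorem hasFDerivAt_stdKernel {q : StdVar} (hq : q ∈ stdDomain) (z : ℂ) :
    HasFDerivAt (stdKernel · z) (stdKernelD q z) q :=
  (hasFDerivAt_stdPhase hq z).cexp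

theorem hasFDerivAt_stdKernelD {q : StdVar} (hq : q ∈ stdDomain) (z : ℂ) :
    HasFDerivAt (stdKernelD · z) (stdKernelDD q z) q :=
  (hasFDerivAt_stdKernel hq z).smul (hasFDerivAt_stdPhaseD hq z)

theorem continuousOn_stdKernelDD (z : ℂ) : ContinuousOn (stdKernelDD · z) stdDomain := by
  have h0 : ContinuousOn (stdKernel · z) stdDomain := fun q hq =>
    (hasFDerivAt_stdKernel hq z).continuousAt.continuousWithinAt
  have h1 : ContinuousOn (stdKernelD · z) stdDomain := fun q hq =>
    (hasFDerivAt_stdKernelD hq z).continuousAt.continuousWithinAt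
  have h2 : ContinuousOn (stdPhaseD · z) stdDomain := fun q hq =>
    (hasFDerivAt_stdPhaseD hq z).continuousAt.continuousWithinAt
  have hA : ContinuousOn (fun q : StdVar => q.2.1) stdDomain := by fun_prop
  have h3 : ContinuousOn (fun q : StdVar => skewCoeffDeriv q.2.1 z) stdDomain := fun q hq =>
    (hasFDerivAt_comp_coordA (hasDerivAt_skewCoeffDeriv hq z)).continuousAt.continuousWithinAt
  have h4 : ContinuousOn (stdPhaseAA · z) stdDomain := by
    have h5 : Continuous (fun q : StdVar => powCoeff 2 q.2.1 z) := by
      unfold powCoeff; fun_prop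
    have h6 : ContinuousOn (fun q : StdVar => skewCoeffDerivTwo q.2.1 z) stdDomain :=
      (continuousOn_skewCoeffDerivTwo z).comp hA fun q hq => hq
    exact h5.continuousOn.add (ContinuousOn.mul (by fun_prop) h6)
  -- On a finite-dimensional space continuity of an operator-valued map can be tested vector by
  -- vector.
  refine continuousOn_clm_apply.2 fun v => ?_
  have h5 : ContinuousOn (fun q => stdKernelD q z v) stdDomain :=
    h1.clm_apply continuousOn_const
  simp only [stdKernelDD, stdPhaseDD, add_apply,
    smul_apply, ContinuousLinearMap.smulRight_apply]
  fun_prop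

/-! ### Measurability in the contour variable. -/

@[fun_prop]
theorem measurable_powCoeff (k : ℕ) (α : ℝ) : Measurable (powCoeff k α) := by
  unfold powCoeff
  exact ((Complex.measurable_log.pow_const k).mul
    (Complex.measurable_exp.comp (Complex.measurable_log.const_mul _))).neg

theorem measurable_expMoment_log (k j : ℕ) (α : ℝ) : Measurable fun z : ℂ =>
    Complex.log z ^ j * expMoment k ((α - 1 : ℝ) * Complex.log z) :=
  (Complex.measurable_log.pow_const j).mul
    ((continuous_expMoment k).measurable.comp (Complex.measurable_log.const_mul _))

@[fun_prop]
theorem measurable_skewCoeff (α : ℝ) : Measurable (skewCoeff α) := by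
  have h := measurable_expMoment_log 0 1 α
  simp only [pow_one] at h
  unfold skewCoeff
  exact (measurable_id.const_mul _).neg.mul (h.const_mul _)

@[fun_prop]
theorem measurable_skewCoeffDeriv (α : ℝ) : Measurable (skewCoeffDeriv α) := by
  have h := measurable_expMoment_log 0 1 α
  simp only [pow_one] at h
  unfold skewCoeffDeriv
  exact (measurable_id.const_mul _).neg.mul
    ((h.const_mul _).add ((measurable_expMoment_log 1 2 α).const_mul _))

@[fun_prop]
theorem measurable_skewCoeffDerivTwo (α : ℝ) : Measurable (skewCoeffDerivTwo α) := by
  have h := measurable_expMoment_log 0 1 α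
  simp only [pow_one] at h
  unfold skewCoeffDerivTwo
  exact (measurable_id.const_mul _).neg.mul
    (((h.const_mul _).add (((measurable_expMoment_log 1 2 α).const_mul _).const_mul _)).add
      ((measurable_expMoment_log 2 3 α).const_mul _))

@[fun_prop]
theorem measurable_stdPhaseA (q : StdVar) : Measurable (stdPhaseA q) := by
  unfold stdPhaseA; fun_prop

@[fun_prop]
theorem measurable_stdPhaseAA (q : StdVar) : Measurable (stdPhaseAA q) := by
  unfold stdPhaseAA; fun_prop

@[fun_prop]
theorem measurable_stdKernel (q : StdVar) : Measurable (stdKernel q) := by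
  unfold stdKernel stdPhase
  fun_prop

theorem stronglyMeasurable_stdPhaseD (q : StdVar) : StronglyMeasurable (stdPhaseD q) := by
  have h0 : StronglyMeasurable fun z : ℂ => -(Complex.I * z) :=
    Measurable.stronglyMeasurable (by fun_prop)
  exact (h0.smul_const _).add
    (((measurable_stdPhaseA q).stronglyMeasurable.smul_const _).add
      ((measurable_skewCoeff _).stronglyMeasurable.smul_const _))

theorem stronglyMeasurable_stdKernelD (q : StdVar) : StronglyMeasurable (stdKernelD q) :=
  (measurable_stdKernel q).stronglyMeasurable.smul (stronglyMeasurable_stdPhaseD q)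

theorem stronglyMeasurable_stdKernelDD (q : StdVar) : StronglyMeasurable (stdKernelDD q) := by
  -- The second derivative is a continuous function of four measurable quantities, so its
  -- measurability follows by composition.
  have hc : Continuous fun p : ℂ × ℂ × ℂ × (StdVar →L[ℝ] ℂ) =>
      p.1 • ((p.2.1 • coordA + p.2.2.1 • coordB).smulRight coordA +
        (p.2.2.1 • coordA).smulRight coordB) + (p.1 • p.2.2.2).smulRight p.2.2.2 := by
    refine continuous_clm_apply.2 fun v => ?_
    simp only [add_apply, smul_apply, ContinuousLinearMap.smulRight_apply]
    fun_prop
  exact hc.comp_stronglyMeasurable ((measurable_stdKernel q).stronglyMeasurable.prodMk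
    ((measurable_stdPhaseAA q).stronglyMeasurable.prodMk
      ((measurable_skewCoeffDeriv q.2.1).stronglyMeasurable.prodMk
        (stronglyMeasurable_stdPhaseD q))))

/-! ### Bounds for the kernel and its derivatives. -/

/-- The size of the coefficients of the exponent at `z`. -/
noncomputable def coeffSize (α : ℝ) (z : ℂ) : ℝ :=
  (1 + ‖Complex.log z‖) ^ 3 * max ‖z‖ (‖z‖ ^ α)

theorem coeffSize_nonneg (α : ℝ) (z : ℂ) : 0 ≤ coeffSize α z :=
  mul_nonneg (by positivity) (le_max_of_le_left (norm_nonneg _))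

theorem norm_le_coeffSize (α : ℝ) (z : ℂ) : ‖z‖ ≤ coeffSize α z := by
  unfold coeffSize
  have h1 : (1 : ℝ) ≤ (1 + ‖Complex.log z‖) ^ 3 :=
    one_le_pow₀ (by linarith [norm_nonneg (Complex.log z)])
  calc ‖z‖ ≤ max ‖z‖ (‖z‖ ^ α) := le_max_left _ _
    _ = 1 * max ‖z‖ (‖z‖ ^ α) := (one_mul _).symm
    _ ≤ _ := by gcongr

theorem norm_cexp_mul_log (α : ℝ) {z : ℂ} (hz : z ≠ 0) :
    ‖Complex.exp (α * Complex.log z)‖ = ‖z‖ ^ α := by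
  rw [Complex.norm_exp, Complex.re_ofReal_mul, Complex.log_re,
    Real.rpow_def_of_pos (norm_pos_iff.2 hz), mul_comm]

/-- The integrand of `z * expMoment` is, up to powers of `s`, `z^(1 + s(α-1))` with `0 ≤ s ≤ 1`; its
modulus lies between `‖z‖` and `‖z‖^α`, which explains the maximum in `coeffSize`. -/
theorem norm_mul_norm_expMoment_log_le (k : ℕ) (α : ℝ) {z : ℂ} (hz : z ≠ 0) :
    ‖z‖ * ‖expMoment k ((α - 1 : ℝ) * Complex.log z)‖ ≤ max ‖z‖ (‖z‖ ^ α) := by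
  have hp := norm_pos_iff.2 hz
  have h := norm_expMoment_le k ((α - 1 : ℝ) * Complex.log z)
  rw [Complex.re_ofReal_mul, Complex.log_re] at h
  calc _ ≤ ‖z‖ * Real.exp (max 0 ((α - 1) * Real.log ‖z‖)) := by gcongr
    _ ≤ _ := by
      rcases le_total 0 ((α - 1) * Real.log ‖z‖) with h0 | h0
      · rw [max_eq_right h0, mul_comm _ (Real.log _), ← Real.rpow_def_of_pos hp]
        nth_rw 1 [← Real.rpow_one ‖z‖]
        rw [← Real.rpow_add hp, add_sub_cancel]
        exact le_max_right _ _
      · rw [max_eq_left h0]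
        simp

theorem norm_powCoeff_le {k : ℕ} (hk : k ≤ 3) (α : ℝ) {z : ℂ} (hz : z ≠ 0) :
    ‖powCoeff k α z‖ ≤ coeffSize α z := by
  rw [powCoeff, norm_neg, norm_mul, norm_pow, norm_cexp_mul_log α hz, coeffSize]
  have h0 := norm_nonneg (Complex.log z)
  gcongr
  · calc ‖Complex.log z‖ ^ k ≤ (1 + ‖Complex.log z‖) ^ k := by gcongr; linarith
      _ ≤ (1 + ‖Complex.log z‖) ^ 3 := pow_le_pow_right₀ (by linarith) hk
  · exact le_max_right _ _

/-- The second `α`-derivative of the skew coefficient contains `log z` to the third power and no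
higher one occurs, hence the cube in `coeffSize`. -/
theorem norm_skew_term_le {j : ℕ} (hj : j ≤ 3) (k : ℕ) (α : ℝ) {z : ℂ} (hz : z ≠ 0) {c C : ℝ}
    (hc : |c| ≤ C) :
    ‖z‖ * ‖(c : ℂ) * (Complex.log z ^ j * expMoment k ((α - 1 : ℝ) * Complex.log z))‖ ≤
      C * coeffSize α z := by
  have h0 := norm_nonneg (Complex.log z)
  have hC := (abs_nonneg c).trans hc
  rw [norm_mul, norm_mul, norm_pow, Complex.norm_real, Real.norm_eq_abs, coeffSize]
  calc _ = |c| * (‖Complex.log z‖ ^ j *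
        (‖z‖ * ‖expMoment k ((α - 1 : ℝ) * Complex.log z)‖)) := by ring
    _ ≤ C * ((1 + ‖Complex.log z‖) ^ 3 * max ‖z‖ (‖z‖ ^ α)) := by
      gcongr
      · calc ‖Complex.log z‖ ^ j ≤ (1 + ‖Complex.log z‖) ^ j := by gcongr; linarith
          _ ≤ (1 + ‖Complex.log z‖) ^ 3 := pow_le_pow_right₀ (by linarith) hj
      · exact norm_mul_norm_expMoment_log_le k α hz

theorem exists_skewCoeff_bound {a₀ a₁ : ℝ} (h0 : 0 < a₀) (h1 : a₁ < 2) :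
    ∃ C : ℝ, 1 ≤ C ∧ ∀ α ∈ Icc a₀ a₁, ∀ z : ℂ, z ≠ 0 →
      ‖skewCoeff α z‖ ≤ C * coeffSize α z ∧ ‖skewCoeffDeriv α z‖ ≤ C * coeffSize α z ∧
      ‖skewCoeffDerivTwo α z‖ ≤ C * coeffSize α z := by
  obtain ⟨C, hC1, hC⟩ := exists_cotCoeff_bound h0 h1
  -- The worst case is the second derivative, with weights `1 + 2 + 1` from the product rule.
  refine ⟨4 * C, by linarith, fun α hα z hz => ?_⟩
  obtain ⟨k0, k1, k2⟩ := hC α hα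
  have hs := coeffSize_nonneg α z
  have hCs : 0 ≤ C * coeffSize α z := by positivity
  have hI : ‖-(Complex.I * z)‖ = ‖z‖ := by simp
  refine ⟨?_, ?_, ?_⟩
  · have e0 := norm_skew_term_le (j := 1) (by norm_num) 0 α hz k0
    rw [pow_one] at e0
    rw [skewCoeff, norm_mul, hI]
    linarith
  · have e0 := norm_skew_term_le (j := 1) (by norm_num) 0 α hz k1
    have e1 := norm_skew_term_le (j := 2) (by norm_num) 1 α hz k0
    rw [pow_one] at e0
    rw [skewCoeffDeriv, norm_mul, hI]
    refine (mul_le_mul_of_nonneg_left (norm_add_le _ _) (norm_nonneg z)).trans ?_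
    rw [mul_add]
    linarith
  · have e0 := norm_skew_term_le (j := 1) (by norm_num) 0 α hz k2
    have e1 := norm_skew_term_le (j := 2) (by norm_num) 1 α hz k1
    have e2 := norm_skew_term_le (j := 3) (by norm_num) 2 α hz k0
    rw [pow_one] at e0
    rw [skewCoeffDerivTwo, norm_mul, hI]
    refine (mul_le_mul_of_nonneg_left (norm_add₃_le) (norm_nonneg z)).trans ?_
    rw [norm_mul (2 : ℂ), Complex.norm_two, mul_add, mul_add]
    linarith

theorem norm_smulRight_le (f g : StdVar →L[ℝ] ℂ) : ‖f.smulRight g‖ ≤ ‖f‖ * ‖g‖ := by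
  refine ContinuousLinearMap.opNorm_le_bound _ (by positivity) fun v => ?_
  rw [ContinuousLinearMap.smulRight_apply, norm_smul]
  calc _ ≤ ‖f‖ * ‖v‖ * ‖g‖ := by gcongr; exact f.le_opNorm v
    _ = _ := by ring

theorem norm_stdPhaseD_le {q : StdVar} {z : ℂ} {W : ℝ} (h1 : ‖z‖ ≤ W) (h2 : ‖stdPhaseA q z‖ ≤ W)
    (h3 : ‖skewCoeff q.2.1 z‖ ≤ W) : ‖stdPhaseD q z‖ ≤ 3 * W := by
  have hW := (norm_nonneg z).trans h1
  have e1 : ‖(-(Complex.I * z)) • coordY‖ ≤ W := by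
    rw [norm_smul]
    calc _ ≤ W * 1 := by
          gcongr
          · simpa using h1
          · exact norm_coordY_le
      _ = W := mul_one W
  have e2 : ‖stdPhaseA q z • coordA‖ ≤ W := by
    rw [norm_smul]
    calc _ ≤ W * 1 := by gcongr; exact norm_coordA_le
      _ = W := mul_one W
  have e3 : ‖skewCoeff q.2.1 z • coordB‖ ≤ W := by
    rw [norm_smul]
    calc _ ≤ W * 1 := by gcongr; exact norm_coordB_le
      _ = W := mul_one W
  have := norm_add_le ((-(Complex.I * z)) • coordY)
    (stdPhaseA q z • coordA + skewCoeff q.2.1 z • coordB)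
  have := norm_add_le (stdPhaseA q z • coordA) (skewCoeff q.2.1 z • coordB)
  rw [stdPhaseD]
  linarith

theorem norm_stdPhaseDD_le {q : StdVar} {z : ℂ} {W : ℝ} (h1 : ‖stdPhaseAA q z‖ ≤ W)
    (h2 : ‖skewCoeffDeriv q.2.1 z‖ ≤ W) : ‖stdPhaseDD q z‖ ≤ 3 * W := by
  have hW := (norm_nonneg _).trans h1
  have key : ∀ (c : ℂ) (f g : StdVar →L[ℝ] ℂ), ‖c‖ ≤ W → ‖f‖ ≤ 1 → ‖g‖ ≤ 1 →
      ‖(c • f).smulRight g‖ ≤ W := by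
    intro c f g hc hf hg
    refine (norm_smulRight_le _ _).trans ?_
    rw [norm_smul]
    calc _ ≤ W * 1 * 1 := by gcongr
      _ = W := by ring
  have e0 : (stdPhaseAA q z • coordA + skewCoeffDeriv q.2.1 z • coordB).smulRight coordA =
      (stdPhaseAA q z • coordA).smulRight coordA +
        (skewCoeffDeriv q.2.1 z • coordB).smulRight coordA :=
    ContinuousLinearMap.ext fun v => by simp [add_smul]
  rw [stdPhaseDD, e0]
  have := norm_add₃_le (a := (stdPhaseAA q z • coordA).smulRight coordA)
    (b := (skewCoeffDeriv q.2.1 z • coordB).smulRight coordA)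
    (c := (skewCoeffDeriv q.2.1 z • coordA).smulRight coordB)
  have := key _ _ _ h1 norm_coordA_le norm_coordA_le
  have := key _ _ _ h2 norm_coordB_le norm_coordA_le
  have := key _ _ _ h2 norm_coordA_le norm_coordB_le
  linarith

/-- The second derivative of `e^p` is `e^p (p'' + p' ⊗ p')`, quadratic in the size `W` of the
coefficients. With `W ≥ 1` all orders share one bound, and `12 = 3 + 3²` comes from `‖p''‖, ‖p'‖ ≤
3W`. -/
theorem norm_stdKernel_derivs_le {q : StdVar} {z : ℂ} {W : ℝ} (hW : 1 ≤ W) (h0 : ‖z‖ ≤ W)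
    (h1 : ‖stdPhaseA q z‖ ≤ W) (h2 : ‖stdPhaseAA q z‖ ≤ W) (h3 : ‖skewCoeff q.2.1 z‖ ≤ W)
    (h4 : ‖skewCoeffDeriv q.2.1 z‖ ≤ W) :
    ‖stdKernel q z‖ ≤ 12 * (‖stdKernel q z‖ * W ^ 2) ∧
    ‖stdKernelD q z‖ ≤ 12 * (‖stdKernel q z‖ * W ^ 2) ∧
    ‖stdKernelDD q z‖ ≤ 12 * (‖stdKernel q z‖ * W ^ 2) := by
  have hn := norm_nonneg (stdKernel q z)
  have hD := norm_stdPhaseD_le h0 h1 h3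
  have hDD := norm_stdPhaseDD_le h2 h4
  have hW2 : W ≤ W ^ 2 := by nlinarith
  have hK : ‖stdKernelD q z‖ ≤ ‖stdKernel q z‖ * (3 * W) := by
    rw [stdKernelD, norm_smul]; gcongr
  refine ⟨?_, ?_, ?_⟩
  · nlinarith
  · nlinarith
  · refine ContinuousLinearMap.opNorm_le_bound _ (by positivity) fun v => ?_
    have e1 : ‖stdPhaseDD q z v‖ ≤ 3 * W * ‖v‖ :=
      ((stdPhaseDD q z).le_opNorm v).trans (by gcongr)
    have e2 : ‖stdKernelD q z v‖ ≤ ‖stdKernel q z‖ * (3 * W) * ‖v‖ :=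
      ((stdKernelD q z).le_opNorm v).trans (by gcongr)
    change ‖stdKernel q z • stdPhaseDD q z v + stdKernelD q z v • stdPhaseD q z‖ ≤ _
    refine (norm_add_le _ _).trans ?_
    rw [norm_smul, norm_smul]
    calc _ ≤ ‖stdKernel q z‖ * (3 * W * ‖v‖) +
          ‖stdKernel q z‖ * (3 * W) * ‖v‖ * (3 * W) := by gcongr
      _ = ‖stdKernel q z‖ * (3 * W + 9 * W ^ 2) * ‖v‖ := by ring
      _ ≤ ‖stdKernel q z‖ * (12 * W ^ 2) * ‖v‖ := by gcongr; linarith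
      _ = _ := by ring

/-- A bound for the derivatives of `stdKernel` on compact ranges of `α` and `β`. -/
theorem exists_stdKernel_derivs_bound {a₀ a₁ : ℝ} (h0 : 0 < a₀) (h1 : a₁ < 2) (K : ℝ) :
    ∃ C : ℝ, 0 ≤ C ∧ ∀ q : StdVar, q.2.1 ∈ Icc a₀ a₁ → |q.2.2| ≤ K → ∀ z : ℂ, z ≠ 0 →
      ‖stdKernel q z‖ ≤ C * (‖stdKernel q z‖ * (1 + coeffSize q.2.1 z) ^ 2) ∧
      ‖stdKernelD q z‖ ≤ C * (‖stdKernel q z‖ * (1 + coeffSize q.2.1 z) ^ 2) ∧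
      ‖stdKernelDD q z‖ ≤ C * (‖stdKernel q z‖ * (1 + coeffSize q.2.1 z) ^ 2) := by
  obtain ⟨C, hC1, hC⟩ := exists_skewCoeff_bound h0 h1
  have hK0 := abs_nonneg K
  refine ⟨12 * ((1 + |K|) * (C + 1)) ^ 2, by positivity, fun q hα hβ z hz => ?_⟩
  obtain ⟨b0, b1, b2⟩ := hC q.2.1 hα z hz
  have hS := coeffSize_nonneg q.2.1 z
  have hβ' : ‖(q.2.2 : ℂ)‖ ≤ |K| := by
    rw [Complex.norm_real]; exact hβ.trans (le_abs_self K)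
  set S := coeffSize q.2.1 z
  have hCS : 0 ≤ C * S := by positivity
  have hKC : 0 ≤ |K| * (C * S) := by positivity
  have hKS : 0 ≤ |K| * S := by positivity
  have hKC' : 0 ≤ |K| * C := by positivity
  have key := norm_stdKernel_derivs_le (q := q) (z := z)
    (W := ((1 + |K|) * (C + 1)) * (1 + S)) (by nlinarith)
    ((norm_le_coeffSize q.2.1 z).trans (by nlinarith)) ?_ ?_ (b0.trans (by nlinarith))
    (b1.trans (by nlinarith))
  · have e : 12 * (‖stdKernel q z‖ * ((1 + |K|) * (C + 1) * (1 + S)) ^ 2) =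
      12 * ((1 + |K|) * (C + 1)) ^ 2 * (‖stdKernel q z‖ * (1 + S) ^ 2) := by ring
    rwa [e] at key
  · have e1 := norm_powCoeff_le (k := 1) (by norm_num) q.2.1 hz
    have e2 : ‖(q.2.2 : ℂ) * skewCoeffDeriv q.2.1 z‖ ≤ |K| * (C * S) := by
      rw [norm_mul]; gcongr
    refine (norm_add_le _ _).trans ?_
    nlinarith
  · have e1 := norm_powCoeff_le (k := 2) (by norm_num) q.2.1 hz
    have e2 : ‖(q.2.2 : ℂ) * skewCoeffDerivTwo q.2.1 z‖ ≤ |K| * (C * S) := by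
      rw [norm_mul]; gcongr
    refine (norm_add_le _ _).trans ?_
    nlinarith

/-- Smoothness in the parameters of the integral of `stdKernel` along a path. -/
theorem contDiffOn_stdKernel_integral {μ : Measure ℝ} {γ : ℝ → ℂ} (hγ : Measurable γ)
    (h0 : ∀ᵐ t ∂μ, γ t ≠ 0)
    (hdom : ∀ a₀ a₁ K : ℝ, 0 < a₀ → a₁ < 2 → ∃ bound : ℝ → ℝ, Integrable bound μ ∧
      ∀ᵐ t ∂μ, ∀ q : StdVar, q.2.1 ∈ Icc a₀ a₁ → |q.1| ≤ K → |q.2.2| ≤ K →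
        ‖stdKernel q (γ t)‖ * (1 + coeffSize q.2.1 (γ t)) ^ 2 ≤ bound t) :
    ContDiffOn ℝ 2 (fun q => ∫ t, stdKernel q (γ t) ∂μ) stdDomain ∧
      (∀ q ∈ stdDomain, HasFDerivAt (fun q => ∫ t, stdKernel q (γ t) ∂μ)
        (∫ t, stdKernelD q (γ t) ∂μ) q) ∧
      (∀ q ∈ stdDomain, HasFDerivAt (fun q => ∫ t, stdKernelD q (γ t) ∂μ)
        (∫ t, stdKernelDD q (γ t) ∂μ) q) := by
  refine contDiffOn_two_integral isOpen_stdDomain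
    (ae_of_all _ fun t q hq => hasFDerivAt_stdKernel hq _)
    (ae_of_all _ fun t q hq => hasFDerivAt_stdKernelD hq _)
    (ae_of_all _ fun t => continuousOn_stdKernelDD _)
    (fun q _ => ((measurable_stdKernel q).comp hγ).aestronglyMeasurable)
    (fun q _ => ((stronglyMeasurable_stdKernelD q).comp_measurable hγ).aestronglyMeasurable)
    (fun q _ => ((stronglyMeasurable_stdKernelDD q).comp_measurable hγ).aestronglyMeasurable)
    fun q hq => ?_
  obtain ⟨q1, q2, q3⟩ := q
  have hq' : q2 ∈ Ioo (0 : ℝ) 2 := hq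
  -- The range of `α` is cut at the midpoints between the given value and the endpoints `0` and `2`,
  -- so that the uniform bounds apply on a neighbourhood.
  obtain ⟨bound, hbi, hbd⟩ := hdom (q2 / 2) ((q2 + 2) / 2) (|q1| + |q3| + 1)
    (by linarith [hq'.1]) (by linarith [hq'.2])
  obtain ⟨C, hC0, hC⟩ := exists_stdKernel_derivs_bound (a₀ := q2 / 2) (a₁ := (q2 + 2) / 2)
    (by linarith [hq'.1]) (by linarith [hq'.2]) (|q1| + |q3| + 1)
  refine ⟨{q : StdVar | q.2.1 ∈ Ioo (q2 / 2) ((q2 + 2) / 2) ∧ |q.1| < |q1| + |q3| + 1 ∧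
    |q.2.2| < |q1| + |q3| + 1}, ?_, fun t => C * bound t, hbi.const_mul C, ?_⟩
  · refine IsOpen.mem_nhds ?_ ⟨⟨by linarith [hq'.1], by linarith [hq'.2]⟩, ?_, ?_⟩
    · refine (isOpen_Ioo.preimage (by fun_prop : Continuous fun q : StdVar => q.2.1)).inter
        (IsOpen.inter ?_ ?_)
      · exact isOpen_lt (f := fun q : StdVar => |q.1|) (by fun_prop) continuous_const
      · exact isOpen_lt (f := fun q : StdVar => |q.2.2|) (by fun_prop) continuous_const
    · change |q1| < |q1| + |q3| + 1
      linarith [abs_nonneg q3]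
    · change |q3| < |q1| + |q3| + 1
      linarith [abs_nonneg q1]
  · filter_upwards [hbd, h0] with t ht htz q hqs
    obtain ⟨hA, hY, hB⟩ := hqs
    have e := hC q (Ioo_subset_Icc_self hA) hB.le (γ t) htz
    have := mul_le_mul_of_nonneg_left (ht q (Ioo_subset_Icc_self hA) hY.le hB.le) hC0
    exact ⟨e.1.trans this, e.2.1.trans this, e.2.2.trans this⟩

/-! ### Decay of the kernel in a horizontal strip. -/

/-- The exponent of the standard stable characteristic function, extended to complex arguments. -/
noncomputable def stdExponent (α β : ℝ) (z : ℂ) : ℂ := powCoeff 0 α z + β * skewCoeff α z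

/-- Jordan's inequality `(2/π)|arg z| ≤ |sin(arg z)| = |Im z|/‖z‖`: in a half-strip the argument is
`O(1/‖z‖)`. This smallness gains one power of `‖z‖` in the skew term. -/
theorem abs_arg_mul_norm_le {z : ℂ} (h : 0 ≤ z.re) (h1 : |z.im| ≤ 1) : |z.arg| * ‖z‖ ≤ 2 := by
  rcases eq_or_ne z 0 with rfl | hz
  · simp
  have hp := norm_pos_iff.2 hz
  have h2 := Real.mul_abs_le_abs_sin (Complex.abs_arg_le_pi_div_two_iff.2 h)
  rw [Complex.sin_arg, abs_div, abs_of_pos hp, le_div_iff₀ hp] at h2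
  have h3 : 2 / Real.pi * |z.arg| * ‖z‖ = 2 / Real.pi * (|z.arg| * ‖z‖) := by ring
  rw [h3] at h2
  have h4 := h2.trans h1
  have hpi := Real.pi_pos
  rw [div_mul_eq_mul_div, div_le_one hpi] at h4
  linarith [Real.pi_le_four]

theorem re_powCoeff_zero (α : ℝ) {z : ℂ} (hz : z ≠ 0) :
    (powCoeff 0 α z).re = -(‖z‖ ^ α * Real.cos (α * z.arg)) := by
  rw [powCoeff, pow_zero, one_mul, Complex.neg_re, Complex.exp_re, Complex.re_ofReal_mul,
    Complex.im_ofReal_mul, Complex.log_re, Complex.log_im,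
    Real.rpow_def_of_pos (norm_pos_iff.2 hz), mul_comm α]

/-- The skew term becomes an average of `log z · z^w` over exponents `w` between `1` and `α`, which
can be estimated pointwise, uniformly through `α = 1`. -/
theorem mul_log_expMoment_eq (α : ℝ) {z : ℂ} (hz : z ≠ 0) :
    z * (Complex.log z * expMoment 0 ((α - 1 : ℝ) * Complex.log z)) =
      ∫ s in (0 : ℝ)..1, Complex.log z * Complex.exp ((1 + s * (α - 1) : ℝ) * Complex.log z) := by
  rw [expMoment, ← mul_assoc, ← intervalIntegral.integral_const_mul]
  refine intervalIntegral.integral_congr fun s _ => ?_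
  simp only [pow_zero, one_mul]
  nth_rw 1 [← Complex.exp_log hz]
  rw [mul_comm (Complex.exp _), mul_assoc, ← Complex.exp_add]
  congr 2
  push_cast
  ring

/-- On the positive axis `log z · z^w` is real, so its imaginary part is proportional to `arg z`
near that axis. -/
theorem abs_im_log_mul_exp_le {w M : ℝ} (h0 : 0 ≤ w) (h2 : w ≤ 2) {z : ℂ} (hz : 1 ≤ ‖z‖)
    (hM : ‖z‖ ^ w ≤ ‖z‖ * M) :
    |(Complex.log z * Complex.exp (w * Complex.log z)).im| ≤
      |z.arg| * ‖z‖ * (2 * Real.log ‖z‖ + 1) * M := by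
  have hp : 0 < ‖z‖ := by linarith
  have hl := Real.log_nonneg hz
  have hn := Real.rpow_nonneg hp.le w
  rw [Complex.mul_im, Complex.exp_re, Complex.exp_im, Complex.re_ofReal_mul,
    Complex.im_ofReal_mul, Complex.log_re, Complex.log_im, mul_comm w (Real.log _),
    ← Real.rpow_def_of_pos hp]
  have e : Real.log ‖z‖ * (‖z‖ ^ w * Real.sin (w * z.arg)) +
      z.arg * (‖z‖ ^ w * Real.cos (w * z.arg)) =
      ‖z‖ ^ w * (Real.log ‖z‖ * Real.sin (w * z.arg) + z.arg * Real.cos (w * z.arg)) := by ring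
  rw [e, abs_mul, abs_of_nonneg hn]
  have h3 : |Real.log ‖z‖ * Real.sin (w * z.arg) + z.arg * Real.cos (w * z.arg)| ≤
      |z.arg| * (2 * Real.log ‖z‖ + 1) := by
    refine (abs_add_le _ _).trans ?_
    rw [abs_mul, abs_mul, abs_of_nonneg hl]
    have h4 : |Real.sin (w * z.arg)| ≤ 2 * |z.arg| := by
      refine (Real.abs_sin_le_abs).trans ?_
      rw [abs_mul, abs_of_nonneg h0]
      gcongr
    have h5 := Real.abs_cos_le_one (w * z.arg)
    have h6 := abs_nonneg z.arg
    calc _ ≤ Real.log ‖z‖ * (2 * |z.arg|) + |z.arg| * 1 := by gcongr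
      _ = _ := by ring
  have h7 := hn.trans hM
  calc _ ≤ (‖z‖ * M) * (|z.arg| * (2 * Real.log ‖z‖ + 1)) := by gcongr
    _ = _ := by ring

/-- The factor `i` turns the real part into the imaginary part of an expression that is real on the
positive axis. In the strip it is therefore smaller than the trivial bound by one power of `‖z‖`. -/
theorem abs_re_skewCoeff_le {α : ℝ} (hα : α ∈ Icc (0 : ℝ) 2) {z : ℂ} (hre : 0 ≤ z.re)
    (him : |z.im| ≤ 1) (hz : 1 ≤ ‖z‖) {M : ℝ} (hM1 : 1 ≤ M) (hM : ‖z‖ ^ (α - 1) ≤ M) :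
    |(skewCoeff α z).re| ≤ |cotCoeff α| * (2 * (2 * Real.log ‖z‖ + 1) * M) := by
  have hp : 0 < ‖z‖ := by linarith
  have hl := Real.log_nonneg hz
  have hz0 : z ≠ 0 := norm_pos_iff.1 hp
  have e : (skewCoeff α z).re = cotCoeff α *
      (z * (Complex.log z * expMoment 0 ((α - 1 : ℝ) * Complex.log z))).im := by
    rw [← Complex.im_ofReal_mul, skewCoeff]
    have : -(Complex.I * z) * ((cotCoeff α : ℂ) *
        (Complex.log z * expMoment 0 ((α - 1 : ℝ) * Complex.log z))) =
        -(Complex.I * ((cotCoeff α : ℂ) *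
        (z * (Complex.log z * expMoment 0 ((α - 1 : ℝ) * Complex.log z))))) := by ring
    rw [this, Complex.neg_re, Complex.I_mul_re, neg_neg]
  rw [e, abs_mul]
  gcongr
  rw [mul_log_expMoment_eq α hz0]
  have hint : IntervalIntegrable (fun s : ℝ => Complex.log z *
      Complex.exp ((1 + s * (α - 1) : ℝ) * Complex.log z)) volume 0 1 :=
    Continuous.intervalIntegrable (by fun_prop) _ _
  have := Complex.imCLM.intervalIntegral_comp_comm hint
  simp only [Complex.imCLM_apply] at this
  rw [← this, ← Real.norm_eq_abs]
  refine (intervalIntegral.norm_integral_le_of_norm_le_const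
    (C := 2 * (2 * Real.log ‖z‖ + 1) * M) fun s hs => ?_).trans (by simp)
  rw [uIoc_of_le zero_le_one] at hs
  rw [Real.norm_eq_abs]
  refine (abs_im_log_mul_exp_le (M := M) ?_ ?_ hz ?_).trans ?_
  · nlinarith [hs.1, hs.2, hα.1, hα.2]
  · nlinarith [hs.1, hs.2, hα.1, hα.2]
  · rw [Real.rpow_add hp, Real.rpow_one]
    gcongr
    rcases le_total 0 (α - 1) with h | h
    · refine le_trans (Real.rpow_le_rpow_of_exponent_le hz ?_) hM
      nlinarith [hs.2]
    · refine le_trans (Real.rpow_le_one_of_one_le_of_nonpos hz ?_) hM1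
      nlinarith [hs.1]
  · have := abs_arg_mul_norm_le hre him
    gcongr

theorem norm_log_le {z : ℂ} (hz : 1 ≤ ‖z‖) : 1 + ‖Complex.log z‖ ≤ 5 * ‖z‖ := by
  have h1 := Complex.norm_le_abs_re_add_abs_im (Complex.log z)
  rw [Complex.log_re, Complex.log_im, abs_of_nonneg (Real.log_nonneg hz)] at h1
  have h2 := Complex.abs_arg_le_pi z
  have h3 := Real.log_le_sub_one_of_pos (x := ‖z‖) (by linarith)
  linarith [Real.pi_le_four]

theorem coeffSize_le_pow {α : ℝ} (hα : α ≤ 2) {z : ℂ} (hz : 1 ≤ ‖z‖) :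
    coeffSize α z ≤ 125 * ‖z‖ ^ 5 := by
  have h1 : max ‖z‖ (‖z‖ ^ α) ≤ ‖z‖ ^ 2 := by
    refine max_le (by nlinarith) ?_
    rw [← Real.rpow_natCast]
    exact Real.rpow_le_rpow_of_exponent_le hz (by simpa using hα)
  have h2 := norm_log_le hz
  calc coeffSize α z ≤ (5 * ‖z‖) ^ 3 * ‖z‖ ^ 2 := by unfold coeffSize; gcongr
    _ = _ := by ring

theorem norm_stdExponent_le {a₀ a₁ : ℝ} (h0 : 0 < a₀) (h1 : a₁ < 2) (K : ℝ) :
    ∃ C : ℝ, 0 ≤ C ∧ ∀ α ∈ Icc a₀ a₁, ∀ β : ℝ, |β| ≤ K → ∀ z : ℂ, z ≠ 0 →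
      ‖stdExponent α β z‖ ≤ C * coeffSize α z := by
  obtain ⟨C, hC1, hC⟩ := exists_skewCoeff_bound h0 h1
  refine ⟨1 + |K| * C, by positivity, fun α hα β hβ z hz => ?_⟩
  have e1 := norm_powCoeff_le (k := 0) (by norm_num) α hz
  have e2 : ‖(β : ℂ) * skewCoeff α z‖ ≤ |K| * (C * coeffSize α z) := by
    rw [norm_mul, Complex.norm_real, Real.norm_eq_abs]
    exact mul_le_mul (hβ.trans (le_abs_self K)) (hC α hα z hz).1 (norm_nonneg _) (abs_nonneg K)
  refine (norm_add_le _ _).trans ?_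
  linarith

/-- On the strip `-1 ≤ Im z ≤ 0` the real part of the exponent tends to `-∞` like `-|z|^α`. -/
theorem exists_re_stdExponent_le {a₀ a₁ : ℝ} (h0 : 0 < a₀) (h1 : a₁ < 2) (K : ℝ) :
    ∃ C : ℝ, ∀ α ∈ Icc a₀ a₁, ∀ β : ℝ, |β| ≤ K → ∀ z : ℂ, 0 ≤ z.re → |z.im| ≤ 1 → 1 ≤ ‖z‖ →
      (stdExponent α β z).re ≤ C - z.re ^ a₀ / 4 := by
  obtain ⟨B, hB1, hB⟩ := exists_cotCoeff_bound h0 h1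
  obtain ⟨C, hC0, hC⟩ := norm_stdExponent_le h0 h1 K
  -- With this `m`, `‖z‖^(α-m)` dominates both `1` and `‖z‖^(α-1)`; half of the gain `m` then
  -- absorbs the logarithm.
  set m := min a₀ 1 with hm
  have hm0 : 0 < m := lt_min h0 one_pos
  set D := |K| * (B * (2 * (4 / m + 1))) with hD
  have hD0 : 0 ≤ D := by positivity
  -- Beyond `T0` the skew term is at most `‖z‖^α / 4`, half of what the main term provides.
  obtain ⟨T0, hT0⟩ := ((tendsto_rpow_atTop (half_pos hm0)).eventually_ge_atTop
    (4 * D)).exists_forall_of_atTop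
  set T := max T0 8
  -- For `‖z‖ < T` the exponent is bounded crudely; the summand `T^a₀ / 4` pays for the subtracted
  -- `z.re^a₀ / 4`.
  refine ⟨C * (125 * T ^ 5) + T ^ a₀ / 4, fun α hα β hβ z hre him hz => ?_⟩
  have hp : 0 < ‖z‖ := by linarith
  have hz0 : z ≠ 0 := norm_pos_iff.1 hp
  have hrez := Complex.re_le_norm z
  rcases lt_or_ge ‖z‖ T with hzT | hzT
  · have e1 := (Complex.re_le_norm _).trans (hC α hα β hβ z hz0)
    have e2 := coeffSize_le_pow (hα.2.trans h1.le) hz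
    have e3 : C * coeffSize α z ≤ C * (125 * T ^ 5) := by
      refine mul_le_mul_of_nonneg_left (e2.trans ?_) hC0
      gcongr
    have e4 : z.re ^ a₀ ≤ T ^ a₀ := by gcongr; exact hrez.trans hzT.le
    linarith
  · have hz8 : 8 ≤ ‖z‖ := (le_max_right _ _).trans hzT
    have hD4 := hT0 ‖z‖ ((le_max_left _ _).trans hzT)
    have hα2 : α < 2 := hα.2.trans_lt h1
    have hα0 : 0 < α := h0.trans_le hα.1
    have harg := abs_arg_mul_norm_le hre him
    have hcos : 1 / 2 ≤ Real.cos (α * z.arg) := by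
      have h5 : |z.arg| ≤ 1 / 4 := by
        have := abs_nonneg z.arg
        nlinarith
      have h6 : |α * z.arg| ≤ 1 / 2 := by
        rw [abs_mul, abs_of_pos hα0]
        nlinarith [abs_nonneg z.arg]
      have h7 := Real.one_sub_sq_div_two_le_cos (x := α * z.arg)
      have h8 := abs_le.1 h6
      nlinarith
    have hpow : (powCoeff 0 α z).re ≤ -(‖z‖ ^ α / 2) := by
      rw [re_powCoeff_zero α hz0]
      have := Real.rpow_nonneg hp.le α
      nlinarith
    have hsk : |(skewCoeff α z).re| ≤ B * (2 * (4 / m + 1)) * (‖z‖ ^ α * ‖z‖ ^ (-(m / 2))) := by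
      have hM := abs_re_skewCoeff_le (M := ‖z‖ ^ (α - m)) ⟨hα0.le, hα2.le⟩ hre him hz
        (Real.one_le_rpow hz (by linarith [min_le_left a₀ 1, hα.1]))
        (Real.rpow_le_rpow_of_exponent_le hz (by linarith [min_le_right a₀ 1]))
      have hlog := Real.log_le_rpow_div hp.le (half_pos hm0)
      have h9 : 1 ≤ ‖z‖ ^ (m / 2) := Real.one_le_rpow hz (by linarith)
      have h10 : 2 * Real.log ‖z‖ + 1 ≤ (4 / m + 1) * ‖z‖ ^ (m / 2) := by
        have : ‖z‖ ^ (m / 2) / (m / 2) = 2 / m * ‖z‖ ^ (m / 2) := by field_simp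
        rw [this] at hlog
        have e : 4 / m = 2 * (2 / m) := by ring
        rw [e]
        linarith
      have hl := Real.log_nonneg hz
      have hBα := (hB α hα).1
      calc _ ≤ _ := hM
        _ ≤ B * (2 * ((4 / m + 1) * ‖z‖ ^ (m / 2)) * ‖z‖ ^ (α - m)) := by gcongr
        _ = B * (2 * (4 / m + 1)) * (‖z‖ ^ (m / 2) * ‖z‖ ^ (α - m)) := by ring
        _ = _ := by
          rw [← Real.rpow_add hp, ← Real.rpow_add hp]
          congr 2
          ring
    have hfin : (β * (skewCoeff α z).re) ≤ ‖z‖ ^ α / 4 := by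
      have h11 : 4 * D * ‖z‖ ^ (-(m / 2)) ≤ 1 := by
        rw [Real.rpow_neg hp.le]
        have h12 := Real.rpow_pos_of_pos hp (m / 2)
        rw [← div_eq_mul_inv, div_le_one h12]
        exact hD4
      calc β * (skewCoeff α z).re ≤ |β| * |(skewCoeff α z).re| := by
            rw [← abs_mul]; exact le_abs_self _
        _ ≤ |K| * (B * (2 * (4 / m + 1)) * (‖z‖ ^ α * ‖z‖ ^ (-(m / 2)))) := by
            exact mul_le_mul (hβ.trans (le_abs_self K)) hsk (abs_nonneg _) (abs_nonneg K)
        _ = (4 * D * ‖z‖ ^ (-(m / 2))) * (‖z‖ ^ α / 4) := by rw [hD]; ring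
        _ ≤ 1 * (‖z‖ ^ α / 4) := by
            gcongr
        _ = _ := one_mul _
    have hza : z.re ^ a₀ ≤ ‖z‖ ^ α :=
      (Real.rpow_le_rpow hre hrez h0.le).trans
        (Real.rpow_le_rpow_of_exponent_le hz hα.1)
    have hT1 : 0 ≤ T := by linarith [le_max_right T0 8]
    have hCT : 0 ≤ C * (125 * T ^ 5) + T ^ a₀ / 4 := by
      have := Real.rpow_nonneg hT1 a₀
      positivity
    rw [stdExponent, Complex.add_re, Complex.re_ofReal_mul]
    linarith

/-! ### The deformed contour and domination along it. -/

/-- The vertical part of the contour. -/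
noncomputable def vertPath (u : ℝ) : ℂ := -(Complex.I * u)

/-- The horizontal part of the contour. -/
noncomputable def horPath (t : ℝ) : ℂ := t - Complex.I

theorem continuous_vertPath : Continuous vertPath := by unfold vertPath; fun_prop

theorem continuous_horPath : Continuous horPath := by unfold horPath; fun_prop

theorem norm_vertPath {u : ℝ} (hu : 0 < u) : ‖vertPath u‖ = u := by
  simp [vertPath, abs_of_pos hu]

theorem vertPath_ne_zero {u : ℝ} (hu : 0 < u) : vertPath u ≠ 0 := by
  rw [← norm_pos_iff, norm_vertPath hu]; exact hu

theorem log_vertPath {u : ℝ} (hu : 0 < u) :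
    Complex.log (vertPath u) = Real.log u - Complex.I * (Real.pi / 2 : ℝ) := by
  have h : vertPath u = (u : ℂ) * (-Complex.I) := by simp [vertPath, mul_comm]
  rw [h, Complex.log_ofReal_mul hu (by simp), Complex.log_neg_I]
  push_cast
  ring

theorem horPath_re (t : ℝ) : (horPath t).re = t := by simp [horPath]

theorem horPath_im (t : ℝ) : (horPath t).im = -1 := by simp [horPath]

theorem one_le_norm_horPath (t : ℝ) : 1 ≤ ‖horPath t‖ := by
  have := Complex.abs_im_le_norm (horPath t)
  simpa [horPath_im] using this

theorem norm_horPath_le {t : ℝ} (ht : 0 ≤ t) : ‖horPath t‖ ≤ 1 + t := by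
  have := Complex.norm_le_abs_re_add_abs_im (horPath t)
  rw [horPath_re, horPath_im, abs_of_nonneg ht] at this
  norm_num at this
  linarith

theorem horPath_ne_zero (t : ℝ) : horPath t ≠ 0 := by
  rw [← norm_pos_iff]; linarith [one_le_norm_horPath t]

/-- Depth below the real axis turns into exponential decay in `y`: at `Im z = -1` the first factor
is `e^{-y}`. This is the gain from moving the contour. -/
theorem norm_stdKernel (q : StdVar) (z : ℂ) :
    ‖stdKernel q z‖ = Real.exp (q.1 * z.im) * Real.exp (stdExponent q.2.1 q.2.2 z).re := by
  rw [stdKernel, Complex.norm_exp, ← Real.exp_add]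
  congr 1
  change (-(Complex.I * z) * (q.1 : ℂ) + stdExponent q.2.1 q.2.2 z).re = _
  simp
  ring

theorem integrableOn_one_add_pow_mul_exp (n : ℕ) {a c : ℝ} (ha : 0 < a) (hc : 0 < c) :
    IntegrableOn (fun t : ℝ => (1 + t) ^ n * Real.exp (-c * t ^ a)) (Ioi 0) := by
  have h1 := integrableOn_rpow_mul_exp_neg_mul_rpow (s := 0) (by norm_num) ha hc
  have h2 := integrableOn_rpow_mul_exp_neg_mul_rpow (s := n)
    (by linarith [Nat.cast_nonneg (α := ℝ) n]) ha hc
  refine Integrable.mono' ((h1.add h2).const_mul (2 ^ n)) ?_ ?_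
  · exact Measurable.aestronglyMeasurable (by fun_prop)
  · refine (ae_restrict_iff' measurableSet_Ioi).2 (ae_of_all _ fun t ht => ?_)
    have ht' : (0 : ℝ) < t := ht
    rw [Real.norm_of_nonneg (by positivity)]
    simp only [Pi.add_apply, Real.rpow_zero, one_mul, Real.rpow_natCast]
    have h3 : (1 + t) ^ n ≤ 2 ^ n * (1 + t ^ n) := by
      rcases le_total t 1 with h | h
      · calc (1 + t) ^ n ≤ 2 ^ n := by gcongr; linarith
          _ ≤ _ := le_mul_of_one_le_right (by positivity) (by linarith [pow_nonneg ht'.le n])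
      · calc (1 + t) ^ n ≤ (2 * t) ^ n := by gcongr; linarith
          _ = 2 ^ n * t ^ n := mul_pow _ _ _
          _ ≤ _ := by gcongr; linarith
    calc _ ≤ 2 ^ n * (1 + t ^ n) * Real.exp (-c * t ^ a) := by gcongr
      _ = _ := by ring

/-- Domination on the horizontal part of the contour. -/
theorem exists_horPath_bound {a₀ a₁ : ℝ} (h0 : 0 < a₀) (h1 : a₁ < 2) (K : ℝ) :
    ∃ bound : ℝ → ℝ, IntegrableOn bound (Ioi 0) ∧ ∀ t ∈ Ioi (0 : ℝ), ∀ q : StdVar,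
      q.2.1 ∈ Icc a₀ a₁ → |q.2.2| ≤ K →
      ‖stdKernel q (horPath t)‖ * (1 + coeffSize q.2.1 (horPath t)) ^ 2 ≤
        Real.exp (-q.1) * bound t := by
  obtain ⟨C, hC⟩ := exists_re_stdExponent_le h0 h1 K
  -- The degree `10` is twice the degree `5` of the polynomial bound on `coeffSize`, and `126 = 125
  -- + 1`.
  refine ⟨fun t => Real.exp C * 126 ^ 2 * ((1 + t) ^ 10 * Real.exp (-(1 / 4) * t ^ a₀)),
    (integrableOn_one_add_pow_mul_exp 10 h0 (by norm_num)).const_mul _,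
    fun t ht q hα hβ => ?_⟩
  have ht' : (0 : ℝ) < t := ht
  have e1 := hC q.2.1 hα q.2.2 hβ (horPath t) (by rw [horPath_re]; exact ht'.le)
    (by rw [horPath_im]; norm_num) (one_le_norm_horPath t)
  rw [horPath_re] at e1
  have e2 : 1 + coeffSize q.2.1 (horPath t) ≤ 126 * (1 + t) ^ 5 := by
    have h2 := coeffSize_le_pow (hα.2.trans h1.le) (one_le_norm_horPath t)
    have h3 : ‖horPath t‖ ^ 5 ≤ (1 + t) ^ 5 := by gcongr; exact norm_horPath_le ht'.le
    have h4 : (1 : ℝ) ≤ (1 + t) ^ 5 := one_le_pow₀ (by linarith)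
    linarith
  have e3 := coeffSize_nonneg q.2.1 (horPath t)
  rw [norm_stdKernel, horPath_im]
  calc _ ≤ Real.exp (q.1 * -1) * Real.exp (C - t ^ a₀ / 4) * (126 * (1 + t) ^ 5) ^ 2 := by
        gcongr
    _ = _ := by
        have : Real.exp (C - t ^ a₀ / 4) = Real.exp C * Real.exp (-(1 / 4) * t ^ a₀) := by
          rw [← Real.exp_add]; congr 1; ring
        rw [this, mul_neg_one]
        ring

theorem rpow_mul_log_bound {m : ℝ} (hm : 0 < m) {u : ℝ} (h0 : 0 < u) (h1 : u ≤ 1) :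
    u ^ m * (3 + |Real.log u|) ≤ 3 + 1 / m := by
  have h2 := (Real.abs_log_mul_self_rpow_lt u m h0 h1 hm).le
  rw [abs_mul, abs_of_nonneg (Real.rpow_nonneg h0.le m)] at h2
  have h3 : u ^ m ≤ 1 := Real.rpow_le_one h0.le h1 hm.le
  nlinarith

theorem norm_log_vertPath_le {u : ℝ} (hu : 0 < u) :
    1 + ‖Complex.log (vertPath u)‖ ≤ 3 + |Real.log u| := by
  rw [log_vertPath hu]
  have h1 := norm_sub_le (Real.log u : ℂ) (Complex.I * (Real.pi / 2 : ℝ))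
  rw [norm_mul, Complex.norm_I, one_mul, Complex.norm_real, Complex.norm_real, Real.norm_eq_abs,
    Real.norm_eq_abs, abs_of_pos Real.pi_div_two_pos] at h1
  linarith [Real.pi_le_four]

/-- The base `u` or `u^α` is at most `u^m` with `m = min a₀ 1`. Splitting `u^m` into three equal
factors lets each absorb one of the three logarithms. -/
theorem exists_coeffSize_vertPath_le {a₀ : ℝ} (h0 : 0 < a₀) :
    ∃ S : ℝ, ∀ α : ℝ, a₀ ≤ α → ∀ u ∈ Ioo (0 : ℝ) 1, coeffSize α (vertPath u) ≤ S := by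
  set m := min a₀ 1
  have hm : 0 < m := lt_min h0 one_pos
  refine ⟨(3 + 1 / (m / 3)) ^ 3, fun α hα u hu => ?_⟩
  have e1 := rpow_mul_log_bound (m := m / 3) (by positivity) hu.1 hu.2.le
  have e2 := norm_log_vertPath_le hu.1
  have e3 : max u (u ^ α) ≤ u ^ m := by
    refine max_le ?_ ?_
    · nth_rw 1 [← Real.rpow_one u]
      exact Real.rpow_le_rpow_of_exponent_ge hu.1 hu.2.le (min_le_right _ _)
    · exact Real.rpow_le_rpow_of_exponent_ge hu.1 hu.2.le ((min_le_left _ _).trans hα)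
  have e4 : u ^ m = (u ^ (m / 3)) ^ 3 := by
    rw [← Real.rpow_natCast, ← Real.rpow_mul hu.1.le]
    congr 1; push_cast; ring
  have e5 := Real.rpow_nonneg hu.1.le (m / 3)
  rw [coeffSize, norm_vertPath hu.1]
  calc _ ≤ (3 + |Real.log u|) ^ 3 * (u ^ (m / 3)) ^ 3 := by
        rw [← e4]
        gcongr
        exact le_max_of_le_left hu.1.le
    _ = (u ^ (m / 3) * (3 + |Real.log u|)) ^ 3 := by ring
    _ ≤ _ := by gcongr

theorem vertPath_im (u : ℝ) : (vertPath u).im = -u := by simp [vertPath]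

/-- Domination on the vertical part of the contour. -/
theorem exists_vertPath_bound {a₀ a₁ : ℝ} (h0 : 0 < a₀) (h1 : a₁ < 2) (K : ℝ) :
    ∃ C : ℝ, 0 ≤ C ∧ ∀ u ∈ Ioo (0 : ℝ) 1, ∀ q : StdVar, q.2.1 ∈ Icc a₀ a₁ → |q.2.2| ≤ K →
      ‖stdKernel q (vertPath u)‖ * (1 + coeffSize q.2.1 (vertPath u)) ^ 2 ≤
        C * Real.exp (-u * q.1) := by
  obtain ⟨S, hS⟩ := exists_coeffSize_vertPath_le h0
  obtain ⟨C, hC0, hC⟩ := norm_stdExponent_le h0 h1 K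
  refine ⟨Real.exp (C * S) * (1 + S) ^ 2, by positivity, fun u hu q hα hβ => ?_⟩
  have e1 := (Complex.re_le_norm _).trans
    (hC q.2.1 hα q.2.2 hβ (vertPath u) (vertPath_ne_zero hu.1))
  have e2 := hS q.2.1 hα.1 u hu
  have e3 := coeffSize_nonneg q.2.1 (vertPath u)
  have e4 : C * coeffSize q.2.1 (vertPath u) ≤ C * S := by gcongr
  rw [norm_stdKernel, vertPath_im]
  calc _ ≤ Real.exp (q.1 * -u) * Real.exp (C * S) * (1 + S) ^ 2 := by
        gcongr
        exact e1.trans e4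
    _ = _ := by rw [show q.1 * -u = -u * q.1 by ring]; ring

/-- The contribution of the vertical part of the contour. -/
noncomputable def vertInt (q : StdVar) : ℂ := ∫ u in Ioo (0 : ℝ) 1, stdKernel q (vertPath u)

/-- The contribution of the horizontal part of the contour. -/
noncomputable def horInt (q : StdVar) : ℂ := ∫ t in Ioi (0 : ℝ), stdKernel q (horPath t)

theorem vertInt_smooth : ContDiffOn ℝ 2 vertInt stdDomain ∧
    (∀ q ∈ stdDomain, HasFDerivAt vertInt
      (∫ u in Ioo (0 : ℝ) 1, stdKernelD q (vertPath u)) q) ∧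
    (∀ q ∈ stdDomain, HasFDerivAt (fun q => ∫ u in Ioo (0 : ℝ) 1, stdKernelD q (vertPath u))
      (∫ u in Ioo (0 : ℝ) 1, stdKernelDD q (vertPath u)) q) := by
  refine contDiffOn_stdKernel_integral continuous_vertPath.measurable ?_ fun a₀ a₁ K h0 h1 => ?_
  · exact (ae_restrict_iff' measurableSet_Ioo).2 (ae_of_all _ fun u hu => vertPath_ne_zero hu.1)
  · obtain ⟨C, hC0, hC⟩ := exists_vertPath_bound h0 h1 K
    refine ⟨fun _ => C * Real.exp |K|, integrable_const _, ?_⟩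
    refine (ae_restrict_iff' measurableSet_Ioo).2 (ae_of_all _ fun u hu q hα hY hβ => ?_)
    refine (hC u hu q hα hβ).trans ?_
    beta_reduce
    gcongr
    calc -u * q.1 ≤ |u| * |q.1| := by rw [← abs_mul, neg_mul]; exact neg_le_abs _
      _ ≤ 1 * |K| := by
        refine mul_le_mul ?_ (hY.trans (le_abs_self K)) (abs_nonneg _) zero_le_one
        rw [abs_of_pos hu.1]; exact hu.2.le
      _ = _ := one_mul _

theorem horInt_smooth : ContDiffOn ℝ 2 horInt stdDomain ∧
    (∀ q ∈ stdDomain, HasFDerivAt horInt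
      (∫ t in Ioi (0 : ℝ), stdKernelD q (horPath t)) q) ∧
    (∀ q ∈ stdDomain, HasFDerivAt (fun q => ∫ t in Ioi (0 : ℝ), stdKernelD q (horPath t))
      (∫ t in Ioi (0 : ℝ), stdKernelDD q (horPath t)) q) := by
  refine contDiffOn_stdKernel_integral continuous_horPath.measurable
    (ae_of_all _ horPath_ne_zero) fun a₀ a₁ K h0 h1 => ?_
  obtain ⟨bound, hbi, hbd⟩ := exists_horPath_bound h0 h1 K
  refine ⟨fun t => Real.exp |K| * |bound t|, hbi.abs.const_mul _, ?_⟩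
  refine (ae_restrict_iff' measurableSet_Ioi).2 (ae_of_all _ fun t ht q hα hY hβ => ?_)
  refine (hbd t ht q hα hβ).trans ?_
  calc Real.exp (-q.1) * bound t ≤ Real.exp (-q.1) * |bound t| := by
        gcongr; exact le_abs_self _
    _ ≤ Real.exp |K| * |bound t| := by
        gcongr
        exact (neg_le_abs _).trans (hY.trans (le_abs_self K))

/-! ### The standard density and Cauchy's theorem. -/

/-- The standard stable density `f(y; 0, 1, α, β)`, by integration along the contour. -/
noncomputable def stdDensity (q : StdVar) : ℝ :=
  (1 / Real.pi) * ((vertInt q).im + (horInt q).re)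

theorem contDiffOn_stdDensity : ContDiffOn ℝ 2 stdDensity stdDomain := by
  refine contDiffOn_const.mul (ContDiffOn.add ?_ ?_)
  · exact Complex.imCLM.contDiff.comp_contDiffOn vertInt_smooth.1
  · exact Complex.reCLM.contDiff.comp_contDiffOn horInt_smooth.1

/-- For positive arguments the exponent is the logarithm of the characteristic function. -/
theorem cexp_stdExponent {α : ℝ} (hα : α ∈ Ioo (0 : ℝ) 2) (β : ℝ) {t : ℝ} (ht : 0 < t) :
    Complex.exp (stdExponent α β t) = m0Chf 0 1 α β t := by
  have hlog : Complex.log (t : ℂ) = (Real.log t : ℝ) := (Complex.ofReal_log ht.le).symm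
  have hpow : powCoeff 0 α t = -((t ^ α : ℝ) : ℂ) := by
    rw [powCoeff, hlog, Real.rpow_def_of_pos ht, pow_zero, one_mul, mul_comm (α : ℂ)]
    push_cast
    rfl
  unfold m0Chf
  simp only [one_mul, zero_mul, Complex.ofReal_zero, mul_zero, add_zero, abs_of_pos ht]
  split_ifs with h1
  · subst h1
    rw [stdExponent, hpow, skewCoeff, hlog, cotCoeff_one]
    simp only [sub_self, Complex.ofReal_zero, zero_mul, expMoment_zero_zero, Real.rpow_one]
    congr 1
    push_cast
    ring
  · have h2 : (α - 1) ≠ 0 := sub_ne_zero.2 h1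
    -- Away from `α = 1`, the factor `α - 1` in `cotCoeff` cancels the denominator hidden in
    -- `expMoment 0`, which leaves `tan(πα/2)(t^α - t)`.
    have hsk : skewCoeff α t =
        Complex.I * (Real.tan (Real.pi * α / 2) * (t ^ α - t) : ℝ) := by
      have h3 := mul_expMoment_zero (((α - 1 : ℝ) : ℂ) * (Real.log t : ℝ))
      have h4 : Complex.exp (((α - 1 : ℝ) : ℂ) * (Real.log t : ℝ)) = (t ^ (α - 1) : ℝ) := by
        rw [Real.rpow_def_of_pos ht, mul_comm]; push_cast; rfl
      rw [h4] at h3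
      have h5 : (t : ℂ) * ((t ^ (α - 1) : ℝ) : ℂ) = (t ^ α : ℝ) := by
        rw [← Complex.ofReal_mul, ← Real.rpow_one_add' ht.le (by simpa using hα.1.ne'),
          add_sub_cancel]
      rw [skewCoeff, hlog, cotCoeff_eq_tan hα h1]
      set E := expMoment 0 (((α - 1 : ℝ) : ℂ) * (Real.log t : ℝ))
      set τ := Real.tan (Real.pi * α / 2)
      calc _ = Complex.I * (τ : ℂ) * ((t : ℂ) * (((α - 1 : ℝ) : ℂ) * (Real.log t : ℝ) * E)) := by
            push_cast; ring
        _ = _ := by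
            rw [h3, mul_sub, h5]
            push_cast
            ring
    rw [stdExponent, hpow, hsk, Real.sign_of_pos ht]
    congr 1
    have h6 : t ^ α * (t ^ (1 - α) - 1) = t - t ^ α := by
      rw [mul_sub, ← Real.rpow_add ht, add_sub_cancel, Real.rpow_one, mul_one]
    have h7 : ((t ^ α : ℝ) : ℂ) * ((t ^ (1 - α) : ℝ) - 1) = t - (t ^ α : ℝ) := by
      exact_mod_cast congrArg (fun x : ℝ => (x : ℂ)) h6
    push_cast
    linear_combination (Complex.I * β * Complex.tan (Real.pi * α / 2)) * h7

theorem stdKernel_eq (q : StdVar) (z : ℂ) :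
    stdKernel q z = Complex.exp (-(Complex.I * z) * q.1) *
      Complex.exp (stdExponent q.2.1 q.2.2 z) := by
  rw [← Complex.exp_add]; rfl

theorem stdKernel_ofReal {q : StdVar} (hq : q ∈ stdDomain) {t : ℝ} (ht : 0 < t) :
    stdKernel q t = Complex.exp (-(Complex.I * (t * q.1 : ℝ))) * m0Chf 0 1 q.2.1 q.2.2 t := by
  rw [stdKernel_eq, cexp_stdExponent hq _ ht]
  congr 2
  push_cast
  ring

theorem norm_stdKernel_ofReal {q : StdVar} (hq : q ∈ stdDomain) {t : ℝ} (ht : 0 < t) :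
    ‖stdKernel q t‖ = Real.exp (-t ^ q.2.1) := by
  have := norm_m0CharFun ![0, 1, q.2.1, q.2.2] t
  simp only [m0CharFun, muIx, sigmaIx, alphaIx, betaIx, Matrix.cons_val] at this
  rw [stdKernel_ofReal hq ht, norm_mul, this, one_mul, abs_of_pos ht]
  simp [Complex.norm_exp, -Complex.ofReal_mul]

theorem integrableOn_stdKernel_ofReal {q : StdVar} (hq : q ∈ stdDomain) :
    IntegrableOn (fun t : ℝ => stdKernel q t) (Ioi 0) := by
  have h1 := integrableOn_rpow_mul_exp_neg_mul_rpow (s := 0) (p := q.2.1)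
      (b := 1) (by norm_num) hq.1 one_pos
  refine Integrable.mono' h1
    ((measurable_stdKernel q).comp Complex.measurable_ofReal).aestronglyMeasurable ?_
  refine (ae_restrict_iff' measurableSet_Ioi).2 (ae_of_all _ fun t ht => ?_)
  rw [norm_stdKernel_ofReal hq ht]
  simp

theorem integrableOn_stdKernel_horPath {q : StdVar} (hq : q ∈ stdDomain) :
    IntegrableOn (fun t : ℝ => stdKernel q (horPath t)) (Ioi 0) := by
  obtain ⟨bound, hbi, hbd⟩ := exists_horPath_bound hq.1 hq.2 |q.2.2|
  refine Integrable.mono' (hbi.const_mul (Real.exp (-q.1)))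
    ((measurable_stdKernel q).comp continuous_horPath.measurable).aestronglyMeasurable ?_
  refine (ae_restrict_iff' measurableSet_Ioi).2 (ae_of_all _ fun t ht => ?_)
  refine le_trans ?_ (hbd t ht q ⟨le_rfl, le_rfl⟩ le_rfl)
  refine le_mul_of_one_le_right (norm_nonneg _) (one_le_pow₀ ?_)
  linarith [coeffSize_nonneg q.2.1 (horPath t)]

theorem differentiableAt_stdKernel (q : StdVar) {z : ℂ} (hz : z ∈ Complex.slitPlane) :
    DifferentiableAt ℂ (stdKernel q) z := by
  have hl : DifferentiableAt ℂ Complex.log z := (Complex.hasStrictDerivAt_log hz).hasDerivAt.differentiableAt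
  have he : DifferentiableAt ℂ
      (fun z => expMoment 0 ((q.2.1 - 1 : ℝ) * Complex.log z)) z :=
    (hasDerivAt_expMoment 0 _).differentiableAt.comp z (hl.const_mul _)
  unfold stdKernel stdPhase powCoeff skewCoeff
  fun_prop

/-- Near the origin the exponent is small. -/
theorem tendsto_coeffSize_zero {α : ℝ} (hα : 0 < α) :
    Tendsto (coeffSize α) (nhdsWithin 0 {0}ᶜ) (nhds 0) := by
  set m := min α 1
  have hm : 0 < m := lt_min hα one_pos
  have hc : Tendsto (fun z : ℂ => (5 + 1 / (m / 6)) ^ 3 * ‖z‖ ^ (m / 2))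
      (nhdsWithin 0 {0}ᶜ) (nhds 0) := by
    have : Continuous fun z : ℂ => (5 + 1 / (m / 6)) ^ 3 * ‖z‖ ^ (m / 2) := by
      have h2 : 0 ≤ m / 2 := by positivity
      exact continuous_const.mul (continuous_norm.rpow_const fun _ => Or.inr h2)
    have h := (this.tendsto 0).mono_left (nhdsWithin_le_nhds (s := {0}ᶜ))
    simpa [Real.zero_rpow (by positivity : m / 2 ≠ 0)] using h
  refine squeeze_zero' (Eventually.of_forall fun z => coeffSize_nonneg α z) ?_ hc
  have hball : ∀ᶠ z : ℂ in nhdsWithin 0 {0}ᶜ, z ∈ Metric.ball (0 : ℂ) 1 :=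
    nhdsWithin_le_nhds (Metric.ball_mem_nhds 0 one_pos)
  filter_upwards [hball, self_mem_nhdsWithin] with z hz1 hz0
  have hp : 0 < ‖z‖ := norm_pos_iff.2 hz0
  have h1 : ‖z‖ < 1 := by simpa using hz1
  have e1 : 1 + ‖Complex.log z‖ ≤ 5 + |Real.log ‖z‖| := by
    have h2 := Complex.norm_le_abs_re_add_abs_im (Complex.log z)
    rw [Complex.log_re, Complex.log_im] at h2
    linarith [Complex.abs_arg_le_pi z, Real.pi_le_four]
  have e2 : ‖z‖ ^ (m / 6) * (5 + |Real.log ‖z‖|) ≤ 5 + 1 / (m / 6) := by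
    have h2 := rpow_mul_log_bound (m := m / 6) (by positivity) hp h1.le
    have h3 : ‖z‖ ^ (m / 6) ≤ 1 := Real.rpow_le_one hp.le h1.le (by positivity)
    linarith
  have e3 : max ‖z‖ (‖z‖ ^ α) ≤ ‖z‖ ^ m := by
    refine max_le ?_ ?_
    · nth_rw 1 [← Real.rpow_one ‖z‖]
      exact Real.rpow_le_rpow_of_exponent_ge hp h1.le (min_le_right _ _)
    · exact Real.rpow_le_rpow_of_exponent_ge hp h1.le (min_le_left _ _)
  -- Half of the exponent absorbs the three logarithms at `m/6` each; the other half tends to `0`.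
  have e4 : ‖z‖ ^ m = (‖z‖ ^ (m / 6)) ^ 3 * ‖z‖ ^ (m / 2) := by
    rw [← Real.rpow_natCast, ← Real.rpow_mul hp.le, ← Real.rpow_add hp]
    congr 1; push_cast; ring
  have e5 := Real.rpow_nonneg hp.le (m / 6)
  have e6 := Real.rpow_nonneg hp.le (m / 2)
  rw [coeffSize]
  calc _ ≤ (5 + |Real.log ‖z‖|) ^ 3 * ((‖z‖ ^ (m / 6)) ^ 3 * ‖z‖ ^ (m / 2)) := by
        rw [← e4]; gcongr
    _ = (‖z‖ ^ (m / 6) * (5 + |Real.log ‖z‖|)) ^ 3 * ‖z‖ ^ (m / 2) := by ring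
    _ ≤ _ := by gcongr

/-- The continuous extension of `stdKernel` to the origin. -/
noncomputable def stdKernelExt (q : StdVar) : ℂ → ℂ := Function.update (stdKernel q) 0 1

theorem stdKernelExt_of_ne (q : StdVar) {z : ℂ} (hz : z ≠ 0) : stdKernelExt q z = stdKernel q z :=
  Function.update_of_ne hz _ _

/-- The convention `log 0 = 0` gives `stdKernel` the value `e⁻¹` at `0`, so the correct limit `1`
has to be inserted there. Cauchy's theorem needs continuity on the closed rectangle, of which `0` is
a corner. -/
theorem continuousAt_stdKernelExt_zero {q : StdVar} (hq : q ∈ stdDomain) :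
    ContinuousAt (stdKernelExt q) 0 := by
  rw [stdKernelExt, continuousAt_update_same]
  obtain ⟨C, hC0, hC⟩ := norm_stdExponent_le hq.1 hq.2 |q.2.2|
  have h1 : Tendsto (stdExponent q.2.1 q.2.2) (nhdsWithin 0 {0}ᶜ) (nhds 0) := by
    have h2 := (tendsto_coeffSize_zero hq.1).const_mul C
    rw [mul_zero] at h2
    refine squeeze_zero_norm' ?_ h2
    filter_upwards [self_mem_nhdsWithin] with z hz
    exact hC _ ⟨le_rfl, le_rfl⟩ _ le_rfl z hz
  have h2 : Tendsto (fun z : ℂ => -(Complex.I * z) * (q.1 : ℂ)) (nhdsWithin 0 {0}ᶜ) (nhds 0) := by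
    have : Continuous fun z : ℂ => -(Complex.I * z) * (q.1 : ℂ) := by fun_prop
    have h := (this.tendsto 0).mono_left (nhdsWithin_le_nhds (s := {0}ᶜ))
    simpa using h
  have h3 := (Complex.continuous_exp.tendsto _).comp (h2.add h1)
  rw [add_zero, Complex.exp_zero] at h3
  exact h3

theorem mem_slitPlane_of_re_nonneg {z : ℂ} (h : 0 ≤ z.re) (h0 : z ≠ 0) :
    z ∈ Complex.slitPlane := by
  rw [Complex.mem_slitPlane_iff]
  rcases h.lt_or_eq with h | h
  · exact Or.inl h
  · exact Or.inr fun h2 => h0 (Complex.ext h.symm h2)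

theorem continuousAt_stdKernelExt {q : StdVar} (hq : q ∈ stdDomain) {z : ℂ} (h : 0 ≤ z.re) :
    ContinuousAt (stdKernelExt q) z := by
  rcases eq_or_ne z 0 with rfl | h0
  · exact continuousAt_stdKernelExt_zero hq
  · refine ((differentiableAt_stdKernel q
      (mem_slitPlane_of_re_nonneg h h0)).continuousAt).congr ?_
    filter_upwards [isOpen_ne.mem_nhds h0] with w hw
    exact (stdKernelExt_of_ne q hw).symm

/-- Cauchy's theorem on `[0, R] × [-1, 0]`: the rectangle lies in the closed right half-plane, where
the branch point `0` is the only obstruction to holomorphy, and it is a boundary point. -/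
theorem stdKernel_rectangle {q : StdVar} (hq : q ∈ stdDomain) {R : ℝ} (hR : 0 < R) :
    ∫ t in (0 : ℝ)..R, stdKernel q t =
      (∫ t in (0 : ℝ)..R, stdKernel q (horPath t)) -
        Complex.I * vertInt q -
        Complex.I * ∫ v in (0 : ℝ)..(-1), stdKernel q (R + v * Complex.I) := by
  have hrect := Complex.integral_boundary_rect_eq_zero_of_continuousOn_of_differentiableOn
    (stdKernelExt q) 0 (R - Complex.I) ?_ ?_
  · simp only [Complex.zero_re, Complex.zero_im, Complex.sub_re, Complex.sub_im, Complex.ofReal_re,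
      Complex.ofReal_im, Complex.I_re, Complex.I_im, sub_zero, zero_sub, Complex.ofReal_zero,
      zero_mul, add_zero, zero_add, smul_eq_mul] at hrect
    have e1 : ∫ t in (0 : ℝ)..R, stdKernelExt q t = ∫ t in (0 : ℝ)..R, stdKernel q t := by
      refine intervalIntegral.integral_congr_ae (ae_of_all _ fun t ht => ?_)
      rw [uIoc_of_le hR.le] at ht
      exact stdKernelExt_of_ne q (by exact_mod_cast ht.1.ne')
    have e2 : ∫ t in (0 : ℝ)..R, stdKernelExt q (t + (-1 : ℝ) * Complex.I) =
        ∫ t in (0 : ℝ)..R, stdKernel q (horPath t) := by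
      refine intervalIntegral.integral_congr fun t _ => ?_
      have : (t : ℂ) + (-1 : ℝ) * Complex.I = horPath t := by
        simp [horPath, sub_eq_add_neg]
      rw [this]
      exact stdKernelExt_of_ne q (horPath_ne_zero t)
    have e3 : ∫ v in (0 : ℝ)..(-1), stdKernelExt q (R + v * Complex.I) =
        ∫ v in (0 : ℝ)..(-1), stdKernel q (R + v * Complex.I) := by
      refine intervalIntegral.integral_congr fun v _ => stdKernelExt_of_ne q fun h => ?_
      have := congrArg Complex.re h
      simp at this
      exact hR.ne' this
    have e4 : ∫ v in (0 : ℝ)..(-1), stdKernelExt q (v * Complex.I) = -vertInt q := by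
      have h1 := intervalIntegral.integral_comp_neg (a := 0) (b := 1)
        (fun v : ℝ => stdKernelExt q (v * Complex.I))
      rw [neg_zero] at h1
      rw [intervalIntegral.integral_symm, ← h1, vertInt,
        intervalIntegral.integral_of_le zero_le_one, integral_Ioc_eq_integral_Ioo]
      congr 1
      refine setIntegral_congr_fun measurableSet_Ioo fun u hu => ?_
      have : ((-u : ℝ) : ℂ) * Complex.I = vertPath u := by
        simp [vertPath, mul_comm]
      rw [this]
      exact stdKernelExt_of_ne q (vertPath_ne_zero hu.1)
    rw [e1, e2, e3, e4] at hrect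
    linear_combination hrect
  · intro z hz
    refine (continuousAt_stdKernelExt hq ?_).continuousWithinAt
    have := hz.1
    simp only [mem_preimage, Complex.zero_re, Complex.sub_re, Complex.ofReal_re, Complex.I_re,
      sub_zero, uIcc_of_le hR.le] at this
    exact this.1
  · intro z hz
    have h1 := hz.1
    simp only [mem_preimage, Complex.zero_re, Complex.sub_re, Complex.ofReal_re, Complex.I_re,
      sub_zero, min_eq_left hR.le, max_eq_right hR.le] at h1
    have h0 : z ≠ 0 := fun h => by rw [h] at h1; exact lt_irrefl _ h1.1
    refine DifferentiableAt.differentiableWithinAt ?_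
    refine (differentiableAt_stdKernel q
      (mem_slitPlane_of_re_nonneg h1.1.le h0)).congr_of_eventuallyEq ?_
    filter_upwards [isOpen_ne.mem_nhds h0] with w hw
    exact stdKernelExt_of_ne q hw

theorem tendsto_stdKernel_rightEdge {q : StdVar} (hq : q ∈ stdDomain) :
    Tendsto (fun R : ℝ => ∫ v in (0 : ℝ)..(-1), stdKernel q (R + v * Complex.I)) atTop
      (nhds 0) := by
  obtain ⟨C, hC⟩ := exists_re_stdExponent_le hq.1 hq.2 |q.2.2|
  have h1 : Tendsto (fun R : ℝ => Real.exp |q.1| * Real.exp (C - R ^ q.2.1 / 4)) atTop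
      (nhds 0) := by
    have h2 : Tendsto (fun R : ℝ => C - R ^ q.2.1 / 4) atTop atBot := by
      simp only [sub_eq_add_neg]
      exact tendsto_atBot_add_const_left _ _ (tendsto_neg_atTop_atBot.comp
        ((tendsto_rpow_atTop hq.1).atTop_div_const (by norm_num)))
    have := (Real.tendsto_exp_atBot.comp h2).const_mul (Real.exp |q.1|)
    rwa [mul_zero] at this
  refine squeeze_zero_norm' ?_ h1
  filter_upwards [eventually_ge_atTop 1] with R hR
  refine (intervalIntegral.norm_integral_le_of_norm_le_const
    (C := Real.exp |q.1| * Real.exp (C - R ^ q.2.1 / 4)) fun v hv => ?_).trans (by simp)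
  rw [uIoc_of_ge (by norm_num)] at hv
  have hre : ((R : ℂ) + v * Complex.I).re = R := by simp
  have him : ((R : ℂ) + v * Complex.I).im = v := by simp
  have hv1 : |v| ≤ 1 := abs_le.2 ⟨hv.1.le, hv.2.trans zero_le_one⟩
  have h3 := hC _ ⟨le_rfl, le_rfl⟩ q.2.2 le_rfl ((R : ℂ) + v * Complex.I)
    (by rw [hre]; linarith) (by rwa [him])
    (by have := Complex.re_le_norm ((R : ℂ) + v * Complex.I); rw [hre] at this; linarith)
  rw [hre] at h3
  rw [norm_stdKernel, him]
  gcongr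
  calc q.1 * v ≤ |q.1| * |v| := by rw [← abs_mul]; exact le_abs_self _
    _ ≤ |q.1| := mul_le_of_le_one_right (abs_nonneg _) hv1

theorem integral_stdKernel_ofReal {q : StdVar} (hq : q ∈ stdDomain) :
    ∫ t in Ioi (0 : ℝ), stdKernel q t = horInt q - Complex.I * vertInt q := by
  have h1 := intervalIntegral_tendsto_integral_Ioi 0 (integrableOn_stdKernel_ofReal hq) tendsto_id
  have h2 := intervalIntegral_tendsto_integral_Ioi 0 (integrableOn_stdKernel_horPath hq) tendsto_id
  have h3 := (h2.sub_const (Complex.I * vertInt q)).sub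
    ((tendsto_stdKernel_rightEdge hq).const_mul Complex.I)
  rw [mul_zero, sub_zero] at h3
  refine tendsto_nhds_unique (h1.congr' ?_) h3
  filter_upwards [eventually_gt_atTop 0] with R hR
  exact stdKernel_rectangle hq hR

theorem m0Chf_neg (α β t : ℝ) : m0Chf 0 1 α β (-t) = star (m0Chf 0 1 α β t) := by
  unfold m0Chf
  rw [Complex.star_def]
  split_ifs
  · rw [← Complex.exp_conj]
    congr 1
    simp only [map_add, map_sub, map_neg, map_mul, Complex.conj_ofReal, Complex.conj_I, abs_neg,
      mul_neg]
    push_cast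
    ring
  · rw [← Complex.exp_conj]
    congr 1
    simp only [map_add, map_neg, map_mul, map_one, Complex.conj_ofReal, Complex.conj_I,
      abs_neg, mul_neg, Real.sign_neg]
    push_cast
    ring

/-- The standard density in terms of the inversion formula over the real line. -/
theorem stdDensity_eq {q : StdVar} (hq : q ∈ stdDomain) :
    stdDensity q = (1 / (2 * Real.pi)) *
      (∫ t : ℝ, Complex.exp (-(Complex.I * (t * q.1 : ℝ))) * m0Chf 0 1 q.2.1 q.2.2 t).re := by
  set g : ℝ → ℂ := fun t =>
    Complex.exp (-(Complex.I * (t * q.1 : ℝ))) * m0Chf 0 1 q.2.1 q.2.2 t with hg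
  have hconj : ∀ t, g (-t) = star (g t) := by
    intro t
    rw [hg]
    simp only [star_mul']
    rw [← m0Chf_neg, Complex.star_def, ← Complex.exp_conj]
    congr 2
    simp
  have hre : ∀ t, (g t).re = (g |t|).re := by
    intro t
    rcases abs_choice t with h | h
    · rw [h]
    · rw [h, hconj, Complex.star_def, Complex.conj_re]
  have hpos : IntegrableOn g (Ioi 0) :=
    (integrableOn_stdKernel_ofReal hq).congr_fun (fun t ht => stdKernel_ofReal hq ht)
      measurableSet_Ioi
  have hneg : IntegrableOn g (Iic 0) := by
    rw [integrableOn_Iic_iff_integrableOn_Iio]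
    have h1 : IntegrableOn (fun t => star (g t)) (Ioi 0) := by
      exact ContinuousLinearMap.integrable_comp (Complex.conjCLE : ℂ →L[ℝ] ℂ) hpos
    have h2 := ((Measure.measurePreserving_neg (volume : Measure ℝ)).integrableOn_comp_preimage
      (Homeomorph.neg ℝ).measurableEmbedding).2 h1
    have h3 : (Neg.neg ⁻¹' Ioi (0 : ℝ)) = Iio 0 := by ext; simp
    rw [h3] at h2
    refine h2.congr_fun (fun t _ => ?_) measurableSet_Iio
    simp only [Function.comp_apply, hconj, star_star]
  have hint : Integrable g := by
    rw [← integrableOn_univ, ← Iic_union_Ioi (a := (0 : ℝ))]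
    exact hneg.union hpos
  have h1 : (∫ t, g t).re = 2 * (∫ t in Ioi (0 : ℝ), g t).re := by
    have e1 : ∫ t, (g t).re = (∫ t, g t).re := integral_re hint
    have e2 : ∫ t in Ioi (0 : ℝ), (g t).re = (∫ t in Ioi (0 : ℝ), g t).re := integral_re hpos
    -- Conjugate symmetry makes the real part of the integrand even, which gives twice the half-line
    -- integral.
    rw [← e1, ← e2, ← integral_comp_abs (f := fun t => (g t).re)]
    exact integral_congr_ae (ae_of_all _ hre)
  have h2 : ∫ t in Ioi (0 : ℝ), g t = horInt q - Complex.I * vertInt q := by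
    rw [← integral_stdKernel_ofReal hq]
    exact setIntegral_congr_fun measurableSet_Ioi fun t ht => (stdKernel_ofReal hq ht).symm
  -- The vertical piece enters as `Re(-iV) = Im V`, so only its imaginary part matters for the
  -- tails.
  rw [h1, h2, stdDensity, Complex.sub_re, Complex.I_mul_re]
  field_simp
  ring

/-! ### Reduction to location `0` and scale `1`. -/

theorem m0CharFun_eq {θ : Fin 4 → ℝ} (hσ : 0 < θ sigmaIx) (t : ℝ) :
    m0CharFun θ t = Complex.exp (Complex.I * (θ muIx * t : ℝ)) *
      m0Chf 0 1 (θ alphaIx) (θ betaIx) (θ sigmaIx * t) := by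
  have hs : Real.sign (θ sigmaIx * t) = Real.sign t := by
    rcases lt_trichotomy t 0 with h | h | h
    · rw [Real.sign_of_neg h, Real.sign_of_neg (mul_neg_of_pos_of_neg hσ h)]
    · simp [h]
    · rw [Real.sign_of_pos h, Real.sign_of_pos (mul_pos hσ h)]
  unfold m0CharFun m0Chf
  split_ifs
  · rw [← Complex.exp_add]
    congr 1
    simp only [one_mul, zero_mul, Complex.ofReal_zero, mul_zero, add_zero]
    ring
  · rw [← Complex.exp_add]
    congr 1
    simp only [one_mul, zero_mul, Complex.ofReal_zero, mul_zero, add_zero, hs]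
    ring

/-- The density is a location-scale transform of the standard density. -/
theorem m0Density_eq {θ : Fin 4 → ℝ} (hσ : 0 < θ sigmaIx) (hα : θ alphaIx ∈ Ioo (0 : ℝ) 2)
    (x : ℝ) : m0Density x θ = (θ sigmaIx)⁻¹ *
      stdDensity ((x - θ muIx) / θ sigmaIx, θ alphaIx, θ betaIx) := by
  have hq : ((x - θ muIx) / θ sigmaIx, θ alphaIx, θ betaIx) ∈ stdDomain := hα
  rw [stdDensity_eq hq, m0Density]
  have h1 := Measure.integral_comp_mul_left (fun t : ℝ =>
    Complex.exp (-(Complex.I * (t * ((x - θ muIx) / θ sigmaIx) : ℝ))) *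
      m0Chf 0 1 (θ alphaIx) (θ betaIx) t) (θ sigmaIx)
  have h2 : ∀ t : ℝ, Complex.exp (-(Complex.I * (t * x : ℝ))) * m0CharFun θ t =
      Complex.exp (-(Complex.I * (θ sigmaIx * t * ((x - θ muIx) / θ sigmaIx) : ℝ))) *
      m0Chf 0 1 (θ alphaIx) (θ betaIx) (θ sigmaIx * t) := by
    intro t
    rw [m0CharFun_eq hσ, ← mul_assoc, ← Complex.exp_add]
    congr 2
    have : θ sigmaIx * t * ((x - θ muIx) / θ sigmaIx) = t * (x - θ muIx) := by field_simp
    rw [this]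
    push_cast
    ring
  simp_rw [h2]
  rw [h1, Complex.real_smul, Complex.re_ofReal_mul, abs_of_pos (inv_pos.2 hσ)]
  ring

/-! ### Laplace transforms of powers with logarithms. -/

theorem one_add_abs_log_le {η s : ℝ} (hη : 0 < η) (hs : 0 < s) :
    1 + |Real.log s| ≤ (1 + 1 / η) * (s ^ η + s ^ (-η)) := by
  have hp := Real.rpow_pos_of_pos hs η
  have hn := Real.rpow_pos_of_pos hs (-η)
  have h1 : 1 ≤ s ^ η + s ^ (-η) := by
    rcases le_total 1 s with h | h
    · linarith [Real.one_le_rpow h hη.le]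
    · linarith [Real.one_le_rpow_of_pos_of_le_one_of_nonpos hs h (neg_nonpos.2 hη.le)]
  have h2 : |Real.log s| ≤ 1 / η * (s ^ η + s ^ (-η)) := by
    have e1 := Real.log_le_rpow_div hs.le hη
    have e2 := Real.log_le_rpow_div (inv_pos.2 hs).le hη
    rw [Real.log_inv, Real.inv_rpow hs.le, ← Real.rpow_neg hs.le] at e2
    have e3 : 1 / η * (s ^ η + s ^ (-η)) = s ^ η / η + s ^ (-η) / η := by ring
    have e4 : 0 ≤ s ^ η / η := by positivity
    have e5 : 0 ≤ s ^ (-η) / η := by positivity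
    rw [e3, abs_le]
    constructor <;> linarith
  linarith

theorem integrableOn_rpow_mul_log_mul_exp {p : ℝ} (hp : 0 < p) (k : ℕ) :
    IntegrableOn (fun s : ℝ => s ^ p * (1 + |Real.log s|) ^ k * Real.exp (-s)) (Ioi 0) := by
  -- This choice makes `k η < 1`, so both exponents `p ± k η` stay above `-1`.
  set η : ℝ := 1 / (k + 1) with hη
  have hη0 : 0 < η := by positivity
  have hkη : k * η < 1 := by
    rw [hη, mul_one_div, div_lt_one (by positivity)]; linarith
  have hkη0 : 0 ≤ k * η := by positivity
  have h1 := integrableOn_rpow_mul_exp_neg_mul_rpow (s := p + k * η) (p := 1) (b := 1)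
    (by linarith) one_pos one_pos
  have h2 := integrableOn_rpow_mul_exp_neg_mul_rpow (s := p - k * η) (p := 1) (b := 1)
    (by linarith) one_pos one_pos
  refine Integrable.mono' ((h1.add h2).const_mul ((1 + 1 / η) ^ k * 2 ^ k)) ?_ ?_
  · exact Measurable.aestronglyMeasurable (by fun_prop)
  · refine (ae_restrict_iff' measurableSet_Ioi).2 (ae_of_all _ fun s hs => ?_)
    have hs' : (0 : ℝ) < s := hs
    have e1 := one_add_abs_log_le hη0 hs'
    have hpp := Real.rpow_pos_of_pos hs' p
    have ha := Real.rpow_pos_of_pos hs' η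
    have hb := Real.rpow_pos_of_pos hs' (-η)
    rw [Real.norm_of_nonneg (by positivity)]
    simp only [Pi.add_apply, Real.rpow_one, neg_mul, one_mul]
    have e2 : (s ^ η + s ^ (-η)) ^ k ≤ 2 ^ k * (s ^ (k * η) + s ^ (-(k * η))) := by
      have e3 : s ^ (k * η) = (s ^ η) ^ k := by
        rw [mul_comm, Real.rpow_mul hs'.le, Real.rpow_natCast]
      have e4 : s ^ (-(k * η)) = (s ^ (-η)) ^ k := by
        rw [← mul_neg, mul_comm, Real.rpow_mul hs'.le, Real.rpow_natCast]
      rw [e3, e4]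
      rcases le_total (s ^ η) (s ^ (-η)) with h | h
      · calc _ ≤ (2 * s ^ (-η)) ^ k := by gcongr; linarith
          _ = 2 ^ k * (s ^ (-η)) ^ k := mul_pow _ _ _
          _ ≤ _ := by gcongr; linarith [pow_pos ha k]
      · calc _ ≤ (2 * s ^ η) ^ k := by gcongr; linarith
          _ = 2 ^ k * (s ^ η) ^ k := mul_pow _ _ _
          _ ≤ _ := by gcongr; linarith [pow_pos hb k]
    calc _ ≤ s ^ p * ((1 + 1 / η) * (s ^ η + s ^ (-η))) ^ k * Real.exp (-s) := by gcongr
      _ = (1 + 1 / η) ^ k * (s ^ p * (s ^ η + s ^ (-η)) ^ k * Real.exp (-s)) := by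
        rw [mul_pow]; ring
      _ ≤ (1 + 1 / η) ^ k *
          (s ^ p * (2 ^ k * (s ^ (k * η) + s ^ (-(k * η)))) * Real.exp (-s)) := by gcongr
      _ = _ := by
        rw [Real.rpow_add hs', sub_eq_add_neg, Real.rpow_add hs']; ring

/-- A Watson type lemma: the Laplace transform of a function of size `u ^ p |log u| ^ k`. -/
theorem isBigO_laplace {p : ℝ} (hp : 0 < p) (k : ℕ) {f : ℝ → ℝ → ℝ} {C : ℝ}
    (hf : ∀ y : ℝ, ∀ u ∈ Ioo (0 : ℝ) 1,
      |f y u| ≤ C * (Real.exp (-u * y) * (u ^ p * (1 + |Real.log u|) ^ k))) :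
    (fun y => ∫ u in Ioo (0 : ℝ) 1, f y u) =O[atTop]
      fun y : ℝ => y ^ (-(1 + p)) * Real.log y ^ k := by
  set g : ℝ → ℝ := fun s => s ^ p * (1 + |Real.log s|) ^ k * Real.exp (-s) with hg
  have hgi : IntegrableOn g (Ioi 0) := integrableOn_rpow_mul_log_mul_exp hp k
  have hg0 : ∀ s ∈ Ioi (0 : ℝ), 0 ≤ g s := fun s hs => by
    have hs' : (0 : ℝ) < s := hs
    positivity
  set A := ∫ s in Ioi (0 : ℝ), g s
  have hA : 0 ≤ A := setIntegral_nonneg measurableSet_Ioi hg0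
  refine IsBigO.of_bound (|C| * 2 ^ k * A) ?_
  filter_upwards [eventually_ge_atTop (Real.exp 1)] with y hy
  have hy0 : 0 < y := (Real.exp_pos 1).trans_le hy
  have hlog : 1 ≤ Real.log y := by
    rw [Real.le_log_iff_exp_le hy0]; exact hy
  have hpt : ∀ u ∈ Ioo (0 : ℝ) 1,
      ‖f y u‖ ≤ |C| * (y ^ (-p) * (2 * Real.log y) ^ k) * g (y * u) := by
    intro u hu
    have hu0 := hu.1
    have hyu : 0 < y * u := mul_pos hy0 hu0
    -- After the substitution `s = y u` the logarithm splits as a sum; `log y ≥ 1`, hence the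
    -- threshold `y ≥ e`, turns the sum into a product separating `y` from `s`.
    have e1 : 1 + |Real.log u| ≤ (2 * Real.log y) * (1 + |Real.log (y * u)|) := by
      have h1 : Real.log u = Real.log (y * u) - Real.log y := by
        rw [Real.log_mul hy0.ne' hu0.ne']; ring
      have h2 : |Real.log u| ≤ |Real.log (y * u)| + Real.log y := by
        rw [h1]
        refine (abs_sub _ _).trans ?_
        rw [abs_of_nonneg (zero_le_one.trans hlog)]
      have h3 := abs_nonneg (Real.log (y * u))
      nlinarith
    have e2 : u ^ p = y ^ (-p) * (y * u) ^ p := by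
      rw [Real.mul_rpow hy0.le hu0.le, ← mul_assoc, ← Real.rpow_add hy0]
      simp
    have e3 : Real.exp (-u * y) = Real.exp (-(y * u)) := by congr 1; ring
    calc ‖f y u‖ ≤ C * (Real.exp (-u * y) * (u ^ p * (1 + |Real.log u|) ^ k)) := hf y u hu
      _ ≤ |C| * (Real.exp (-u * y) * (u ^ p * (1 + |Real.log u|) ^ k)) := by
        gcongr; exact le_abs_self C
      _ ≤ |C| * (Real.exp (-u * y) *
          (u ^ p * ((2 * Real.log y) * (1 + |Real.log (y * u)|)) ^ k)) := by gcongr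
      _ = _ := by rw [mul_pow, e2, e3, hg]; ring
  have hci : IntegrableOn (fun u => g (y * u)) (Ioi 0) := by
    have := (integrableOn_Ioi_comp_mul_left_iff g 0 hy0).2 (by rwa [mul_zero])
    exact this
  have hsub : Ioo (0 : ℝ) 1 ⊆ Ioi 0 := fun u hu => hu.1
  have h1 : ‖∫ u in Ioo (0 : ℝ) 1, f y u‖ ≤
      ∫ u in Ioo (0 : ℝ) 1, |C| * (y ^ (-p) * (2 * Real.log y) ^ k) * g (y * u) :=
    norm_integral_le_of_norm_le ((hci.mono_set hsub).const_mul _)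
      ((ae_restrict_iff' measurableSet_Ioo).2 (ae_of_all _ hpt))
  have h2 : ∫ u in Ioo (0 : ℝ) 1, g (y * u) ≤ y⁻¹ * A := by
    have e : ∫ u in Ioi (0 : ℝ), g (y * u) = y⁻¹ * A := by
      have := integral_comp_mul_left_Ioi g 0 hy0
      rwa [mul_zero, smul_eq_mul] at this
    rw [← e]
    refine setIntegral_mono_set hci ?_ hsub.eventuallyLE
    exact (ae_restrict_iff' measurableSet_Ioi).2 (ae_of_all _ fun u hu =>
      hg0 _ (mul_pos hy0 hu))
  rw [integral_const_mul] at h1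
  have h3 : 0 ≤ y ^ (-(1 + p)) * Real.log y ^ k :=
    mul_nonneg (Real.rpow_nonneg hy0.le _) (pow_nonneg (by linarith) _)
  rw [Real.norm_of_nonneg h3]
  have h4 := Real.rpow_nonneg hy0.le (-p)
  have h5 : 0 ≤ Real.log y := by linarith
  calc _ ≤ _ := h1
    _ ≤ |C| * (y ^ (-p) * (2 * Real.log y) ^ k) * (y⁻¹ * A) := by gcongr
    _ = |C| * 2 ^ k * A * (y ^ (-p) * y⁻¹ * Real.log y ^ k) := by rw [mul_pow]; ring
    _ = _ := by
      rw [← Real.rpow_neg_one y, ← Real.rpow_add hy0]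
      congr 3
      ring

/-! ### Imaginary parts on the vertical segment. -/

/-- Bounded functions on `(0, 1)` with imaginary part `O(u ^ α |log u| ^ k)`. -/
def ImTame (α : ℝ) (k : ℕ) (X : ℝ → ℂ) : Prop :=
  ∃ C : ℝ, 0 ≤ C ∧ ∀ u ∈ Ioo (0 : ℝ) 1, ‖X u‖ ≤ C ∧
    |(X u).im| ≤ C * (u ^ α * (1 + |Real.log u|) ^ k)

theorem ImTame.mono {α : ℝ} {j k : ℕ} {X : ℝ → ℂ} (h : ImTame α j X) (hjk : j ≤ k) :
    ImTame α k X := by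
  obtain ⟨C, hC0, hC⟩ := h
  refine ⟨C, hC0, fun u hu => ⟨(hC u hu).1, (hC u hu).2.trans ?_⟩⟩
  have := Real.rpow_nonneg hu.1.le α
  gcongr
  linarith [abs_nonneg (Real.log u)]

theorem ImTame.add {α : ℝ} {k : ℕ} {X Y : ℝ → ℂ} (hX : ImTame α k X) (hY : ImTame α k Y) :
    ImTame α k fun u => X u + Y u := by
  obtain ⟨C, hC0, hC⟩ := hX
  obtain ⟨D, hD0, hD⟩ := hY
  refine ⟨C + D, by positivity, fun u hu => ⟨?_, ?_⟩⟩
  · exact (norm_add_le _ _).trans (add_le_add (hC u hu).1 (hD u hu).1)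
  · rw [Complex.add_im, add_mul]
    exact (abs_add_le _ _).trans (add_le_add (hC u hu).2 (hD u hu).2)

/-- Since `Im(XY) = Re X · Im Y + Im X · Re Y`, the real parts need only be bounded. This is why
boundedness is built into `ImTame`. -/
theorem ImTame.mul {α : ℝ} {k : ℕ} {X Y : ℝ → ℂ} (hX : ImTame α k X) (hY : ImTame α k Y) :
    ImTame α k fun u => X u * Y u := by
  obtain ⟨C, hC0, hC⟩ := hX
  obtain ⟨D, hD0, hD⟩ := hY
  refine ⟨2 * (C * D), by positivity, fun u hu => ⟨?_, ?_⟩⟩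
  · rw [norm_mul]
    have := mul_le_mul (hC u hu).1 (hD u hu).1 (norm_nonneg _) hC0
    have : 0 ≤ C * D := by positivity
    linarith
  · rw [Complex.mul_im]
    have h1 := (Complex.abs_re_le_norm (X u)).trans (hC u hu).1
    have h2 := (Complex.abs_re_le_norm (Y u)).trans (hD u hu).1
    have e1 := mul_le_mul h1 (hD u hu).2 (abs_nonneg _) hC0
    have e2 := mul_le_mul h2 (hC u hu).2 (abs_nonneg _) hD0
    refine (abs_add_le _ _).trans ?_
    rw [abs_mul, abs_mul, mul_comm |(X u).im|]
    linarith

theorem imTame_ofReal (α c : ℝ) : ImTame α 0 fun _ => (c : ℂ) := by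
  refine ⟨|c|, abs_nonneg c, fun u hu => ⟨by simp, ?_⟩⟩
  have := Real.rpow_nonneg hu.1.le α
  simp only [Complex.ofReal_im, abs_zero]
  positivity

/-- The modulus of `e^X` stays bounded, and `|sin(Im X)| ≤ |Im X|` transfers the smallness. -/
theorem ImTame.cexp {α : ℝ} {k : ℕ} {X : ℝ → ℂ} (hX : ImTame α k X) :
    ImTame α k fun u => Complex.exp (X u) := by
  obtain ⟨C, hC0, hC⟩ := hX
  have he : ∀ u ∈ Ioo (0 : ℝ) 1, Real.exp (X u).re ≤ Real.exp C := fun u hu =>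
    Real.exp_le_exp.2 ((Complex.re_le_norm _).trans (hC u hu).1)
  refine ⟨Real.exp C * (1 + C), by positivity, fun u hu => ⟨?_, ?_⟩⟩
  · rw [Complex.norm_exp]
    have := he u hu
    nlinarith [Real.exp_pos C]
  · rw [Complex.exp_im, abs_mul, Real.abs_exp]
    have h1 : |Real.sin (X u).im| ≤ C * (u ^ α * (1 + |Real.log u|) ^ k) :=
      Real.abs_sin_le_abs.trans (hC u hu).2
    have h2 : 0 ≤ u ^ α * (1 + |Real.log u|) ^ k := by
      have := Real.rpow_nonneg hu.1.le α
      positivity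
    calc _ ≤ Real.exp C * (C * (u ^ α * (1 + |Real.log u|) ^ k)) :=
          mul_le_mul (he u hu) h1 (abs_nonneg _) (Real.exp_pos C).le
      _ ≤ _ := by
        rw [mul_assoc]
        gcongr
        linarith

theorem imTame_powCoeff {α : ℝ} (hα : α ∈ Ioo (0 : ℝ) 2) {k : ℕ} (hk : k ≤ 3) :
    ImTame α k fun u => powCoeff k α (vertPath u) := by
  obtain ⟨S, hS⟩ := exists_coeffSize_vertPath_le hα.1
  refine ⟨max |S| (3 ^ k), by positivity, fun u hu => ⟨?_, ?_⟩⟩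
  · exact (norm_powCoeff_le hk α (vertPath_ne_zero hu.1)).trans
      ((hS α le_rfl u hu).trans ((le_abs_self S).trans (le_max_left _ _)))
  · refine (Complex.abs_im_le_norm _).trans ?_
    simp only [powCoeff]
    rw [norm_neg, norm_mul, norm_pow, norm_cexp_mul_log α (vertPath_ne_zero hu.1),
      norm_vertPath hu.1]
    have h1 : ‖Complex.log (vertPath u)‖ ≤ 3 * (1 + |Real.log u|) := by
      linarith [norm_log_vertPath_le hu.1, abs_nonneg (Real.log u)]
    have h2 := Real.rpow_nonneg hu.1.le α
    calc _ ≤ (3 * (1 + |Real.log u|)) ^ k * u ^ α := by gcongr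
      _ = 3 ^ k * (u ^ α * (1 + |Real.log u|) ^ k) := by rw [mul_pow]; ring
      _ ≤ _ := by
        gcongr
        exact le_max_right _ _

theorem skewCoeff_vertPath (α : ℝ) {u : ℝ} : skewCoeff α (vertPath u) =
    -((u * cotCoeff α : ℝ) : ℂ) * (Complex.log (vertPath u) *
      expMoment 0 ((α - 1 : ℝ) * Complex.log (vertPath u))) := by
  rw [skewCoeff]
  have : -(Complex.I * vertPath u) = -(u : ℂ) := by
    rw [vertPath, mul_neg, ← mul_assoc, Complex.I_mul_I]; ring
  rw [this]
  push_cast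
  ring

/-- For `z = -iu` and `α ≠ 1` the skew term is a real multiple of `u (z^(α-1) - 1)`, and the
subtracted `1` is real. The slower contributions `u` for `α > 1` and `u log u` for `α = 1` thus drop
out of the imaginary part; this cancellation produces the exponent `1 + α`. -/
theorem im_skewCoeff_vertPath {α : ℝ} (hα : α ∈ Ioo (0 : ℝ) 2) {u : ℝ} (hu : 0 < u) :
    (skewCoeff α (vertPath u)).im = u ^ α * Real.sin (Real.pi * α / 2) := by
  rw [skewCoeff_vertPath, ← Complex.ofReal_neg, Complex.im_ofReal_mul]
  rcases eq_or_ne α 1 with rfl | h1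
  · rw [cotCoeff_one, log_vertPath hu]
    have hp := Real.pi_ne_zero
    simp [expMoment_zero_zero]
    field_simp
  · have h2 : α - 1 ≠ 0 := sub_ne_zero.2 h1
    set E := Complex.log (vertPath u) * expMoment 0 ((α - 1 : ℝ) * Complex.log (vertPath u))
      with hE
    have h3 : ((α - 1 : ℝ) : ℂ) * E = Complex.exp ((α - 1 : ℝ) * Complex.log (vertPath u)) - 1 := by
      rw [← mul_expMoment_zero, hE, mul_assoc]
    have h4 := congrArg Complex.im h3
    rw [Complex.im_ofReal_mul, Complex.sub_im, Complex.exp_im, Complex.re_ofReal_mul,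
      Complex.im_ofReal_mul, log_vertPath hu, Complex.one_im, sub_zero] at h4
    have h5 : ((Real.log u : ℂ) - Complex.I * (Real.pi / 2 : ℝ)).re = Real.log u := by simp
    have h6 : ((Real.log u : ℂ) - Complex.I * (Real.pi / 2 : ℝ)).im = -(Real.pi / 2) := by simp
    rw [h5, h6, mul_comm (α - 1) (Real.log u), ← Real.rpow_def_of_pos hu,
      show (α - 1) * -(Real.pi / 2) = -(Real.pi * (α - 1) / 2) by ring, Real.sin_neg] at h4
    have h7 := cotCoeff_mul_sin α hα
    have h8 : Real.sin (Real.pi * α / 2) = Real.cos (Real.pi * (α - 1) / 2) := by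
      rw [← Real.sin_add_pi_div_two]; congr 1; ring
    have h9 : u ^ α = u * u ^ (α - 1) := by
      rw [← Real.rpow_one_add' hu.le (by simpa using hα.1.ne'), add_sub_cancel]
    rw [h8, h9]
    refine mul_left_cancel₀ h2 ?_
    linear_combination (-(u * cotCoeff α)) * h4 + (u * u ^ (α - 1)) * h7

theorem hasDerivAt_im {f : ℝ → ℂ} {f' : ℂ} {x : ℝ} (h : HasDerivAt f f' x) :
    HasDerivAt (fun x => (f x).im) f'.im x :=
  (Complex.imCLM.hasFDerivAt.comp_hasDerivAt x h)

/-- The closed form of the imaginary part is differentiated in `α` at fixed `u` and identified by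
uniqueness of the derivative, so the higher moments are never evaluated. -/
theorem im_skewCoeffDeriv_vertPath {α : ℝ} (hα : α ∈ Ioo (0 : ℝ) 2) {u : ℝ} (hu : 0 < u) :
    (skewCoeffDeriv α (vertPath u)).im =
      u ^ α * (Real.log u * Real.sin (Real.pi * α / 2) +
        Real.pi / 2 * Real.cos (Real.pi * α / 2)) := by
  have h1 := hasDerivAt_im (hasDerivAt_skewCoeff hα (vertPath u))
  have hl : HasDerivAt (fun α : ℝ => Real.pi * α / 2) (Real.pi / 2) α := by
    simpa using ((hasDerivAt_id α).const_mul Real.pi).div_const 2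
  have h2 := ((Real.hasStrictDerivAt_const_rpow hu α).hasDerivAt).mul hl.sin
  have h3 := h2.congr_of_eventuallyEq (f₁ := fun α => (skewCoeff α (vertPath u)).im) (by
    filter_upwards [isOpen_Ioo.mem_nhds hα] with a ha using im_skewCoeff_vertPath ha hu)
  rw [h1.unique h3]
  ring

theorem im_skewCoeffDerivTwo_vertPath {α : ℝ} (hα : α ∈ Ioo (0 : ℝ) 2) {u : ℝ} (hu : 0 < u) :
    (skewCoeffDerivTwo α (vertPath u)).im =
      u ^ α * (Real.log u ^ 2 * Real.sin (Real.pi * α / 2) +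
        Real.pi * Real.log u * Real.cos (Real.pi * α / 2) -
        (Real.pi / 2) ^ 2 * Real.sin (Real.pi * α / 2)) := by
  have h1 := hasDerivAt_im (hasDerivAt_skewCoeffDeriv hα (vertPath u))
  have hl : HasDerivAt (fun α : ℝ => Real.pi * α / 2) (Real.pi / 2) α := by
    simpa using ((hasDerivAt_id α).const_mul Real.pi).div_const 2
  have h2 := ((Real.hasStrictDerivAt_const_rpow hu α).hasDerivAt).mul
    ((hl.sin.const_mul (Real.log u)).add (hl.cos.const_mul (Real.pi / 2)))
  have h3 := h2.congr_of_eventuallyEq (f₁ := fun α => (skewCoeffDeriv α (vertPath u)).im) (by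
    filter_upwards [isOpen_Ioo.mem_nhds hα] with a ha using im_skewCoeffDeriv_vertPath ha hu)
  rw [h1.unique h3]
  simp only [Pi.add_apply]
  ring

theorem imTame_of_im_le {α : ℝ} (hα : α ∈ Ioo (0 : ℝ) 2) {k : ℕ} {X : ℝ → ℂ} {C D : ℝ}
    (h1 : ∀ u ∈ Ioo (0 : ℝ) 1, ‖X u‖ ≤ C * coeffSize α (vertPath u)) (hC : 0 ≤ C)
    (h2 : ∀ u ∈ Ioo (0 : ℝ) 1, |(X u).im| ≤ D * (u ^ α * (1 + |Real.log u|) ^ k)) :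
    ImTame α k X := by
  obtain ⟨S, hS⟩ := exists_coeffSize_vertPath_le hα.1
  refine ⟨max |C * S| |D|, by positivity, fun u hu => ⟨?_, ?_⟩⟩
  · refine (h1 u hu).trans (le_trans ?_ ((le_abs_self (C * S)).trans (le_max_left _ _)))
    have := hS α le_rfl u hu
    gcongr
  · refine (h2 u hu).trans ?_
    have := Real.rpow_nonneg hu.1.le α
    gcongr
    exact (le_abs_self D).trans (le_max_right _ _)

theorem imTame_skewCoeff {α : ℝ} (hα : α ∈ Ioo (0 : ℝ) 2) :
    ImTame α 0 fun u => skewCoeff α (vertPath u) := by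
  obtain ⟨C, hC1, hC⟩ := exists_skewCoeff_bound hα.1 hα.2
  refine imTame_of_im_le hα (D := 1)
    (fun u hu => (hC α ⟨le_rfl, le_rfl⟩ _ (vertPath_ne_zero hu.1)).1) (by linarith) fun u hu => ?_
  have := Real.rpow_nonneg hu.1.le α
  rw [im_skewCoeff_vertPath hα hu.1, abs_mul, abs_of_nonneg this, pow_zero, mul_one, one_mul]
  exact mul_le_of_le_one_right this (Real.abs_sin_le_one _)

theorem imTame_skewCoeffDeriv {α : ℝ} (hα : α ∈ Ioo (0 : ℝ) 2) :
    ImTame α 1 fun u => skewCoeffDeriv α (vertPath u) := by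
  obtain ⟨C, hC1, hC⟩ := exists_skewCoeff_bound hα.1 hα.2
  refine imTame_of_im_le hα (D := 2)
    (fun u hu => (hC α ⟨le_rfl, le_rfl⟩ _ (vertPath_ne_zero hu.1)).2.1) (by linarith)
    fun u hu => ?_
  have h0 := Real.rpow_nonneg hu.1.le α
  rw [im_skewCoeffDeriv_vertPath hα hu.1, abs_mul, abs_of_nonneg h0]
  have hs := Real.abs_sin_le_one (Real.pi * α / 2)
  have hc := Real.abs_cos_le_one (Real.pi * α / 2)
  have hl := abs_nonneg (Real.log u)
  have h1 : |Real.log u * Real.sin (Real.pi * α / 2) + Real.pi / 2 * Real.cos (Real.pi * α / 2)| ≤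
      |Real.log u| * 1 + 2 * 1 := by
    refine (abs_add_le _ _).trans ?_
    rw [abs_mul, abs_mul, abs_of_pos Real.pi_div_two_pos]
    have := Real.pi_le_four
    gcongr
    linarith
  calc _ ≤ u ^ α * (|Real.log u| * 1 + 2 * 1) := by gcongr
    _ ≤ u ^ α * (2 * (1 + |Real.log u|) ^ 1) := by gcongr; linarith
    _ = _ := by ring

theorem imTame_skewCoeffDerivTwo {α : ℝ} (hα : α ∈ Ioo (0 : ℝ) 2) :
    ImTame α 2 fun u => skewCoeffDerivTwo α (vertPath u) := by
  obtain ⟨C, hC1, hC⟩ := exists_skewCoeff_bound hα.1 hα.2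
  refine imTame_of_im_le hα (D := 4)
    (fun u hu => (hC α ⟨le_rfl, le_rfl⟩ _ (vertPath_ne_zero hu.1)).2.2) (by linarith)
    fun u hu => ?_
  have h0 := Real.rpow_nonneg hu.1.le α
  rw [im_skewCoeffDerivTwo_vertPath hα hu.1, abs_mul, abs_of_nonneg h0]
  have hs := Real.abs_sin_le_one (Real.pi * α / 2)
  have hc := Real.abs_cos_le_one (Real.pi * α / 2)
  have hl := abs_nonneg (Real.log u)
  have hp := Real.pi_le_four
  have h1 : |Real.log u ^ 2 * Real.sin (Real.pi * α / 2) +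
        Real.pi * Real.log u * Real.cos (Real.pi * α / 2) -
        (Real.pi / 2) ^ 2 * Real.sin (Real.pi * α / 2)| ≤
      |Real.log u| ^ 2 * 1 + 4 * |Real.log u| * 1 + 2 ^ 2 * 1 := by
    refine (abs_sub _ _).trans ((add_le_add_left (abs_add_le _ _) _).trans ?_)
    simp only [abs_mul, abs_pow, abs_of_pos Real.pi_div_two_pos, abs_of_pos Real.pi_pos]
    gcongr
    linarith
  calc _ ≤ u ^ α * (|Real.log u| ^ 2 * 1 + 4 * |Real.log u| * 1 + 2 ^ 2 * 1) := by gcongr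
    _ ≤ u ^ α * (4 * (1 + |Real.log u|) ^ 2) := by gcongr; nlinarith
    _ = _ := by ring

/-! ### Tails of the standard density and its derivatives at `+∞`. -/

/-- The gauge function `y ^ (-p) (log y) ^ k`. -/
noncomputable def tailGauge (p : ℝ) (k : ℕ) (y : ℝ) : ℝ := y ^ (-p) * Real.log y ^ k

theorem stdKernel_vertPath (y α β u : ℝ) : stdKernel (y, α, β) (vertPath u) =
    (Real.exp (-u * y) : ℝ) * Complex.exp (stdExponent α β (vertPath u)) := by
  rw [stdKernel_eq, Complex.ofReal_exp]
  have : -(Complex.I * vertPath u) = -(u : ℂ) := by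
    rw [vertPath, mul_neg, ← mul_assoc, Complex.I_mul_I]; ring
  rw [this]
  push_cast
  rfl

theorem imTame_cexp_stdExponent {α : ℝ} (hα : α ∈ Ioo (0 : ℝ) 2) (β : ℝ) :
    ImTame α 0 fun u => Complex.exp (stdExponent α β (vertPath u)) := by
  refine ImTame.cexp ?_
  have h1 := imTame_powCoeff hα (k := 0) (by norm_num)
  exact h1.add ((imTame_ofReal α β).mul (imTame_skewCoeff hα))

/-- If `stdKernel` times a coefficient has small imaginary part on the vertical path, its integral
has small imaginary part. -/
theorem isBigO_im_vert_of_bound {α β p : ℝ} (hp : 0 < p) {k : ℕ} {X : ℝ → ℂ} {C : ℝ}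
    (hX : ∀ u ∈ Ioo (0 : ℝ) 1, |(Complex.exp (stdExponent α β (vertPath u)) * X u).im| ≤
      C * (u ^ p * (1 + |Real.log u|) ^ k)) :
    (fun y => (∫ u in Ioo (0 : ℝ) 1, stdKernel (y, α, β) (vertPath u) * X u).im)
      =O[atTop] tailGauge (1 + p) k := by
  have h1 : ∀ y, ∀ u ∈ Ioo (0 : ℝ) 1, |(stdKernel (y, α, β) (vertPath u) * X u).im| ≤
      C * (Real.exp (-u * y) * (u ^ p * (1 + |Real.log u|) ^ k)) := by
    intro y u hu
    rw [stdKernel_vertPath, mul_assoc, Complex.im_ofReal_mul, abs_mul, Real.abs_exp]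
    have := mul_le_mul_of_nonneg_left (hX u hu) (Real.exp_pos (-u * y)).le
    linarith
  have h2 := isBigO_laplace hp k (f := fun y u => (stdKernel (y, α, β) (vertPath u) * X u).im) h1
  refine (IsBigO.of_bound 1 (Eventually.of_forall fun y => ?_)).trans h2
  rw [one_mul]
  -- Without integrability the complex integral is `0` by default and the estimate is trivial, so no
  -- integrability hypothesis is needed.
  by_cases hi : IntegrableOn (fun u => stdKernel (y, α, β) (vertPath u) * X u) (Ioo 0 1)
  · have e : ∫ u in Ioo (0 : ℝ) 1, (stdKernel (y, α, β) (vertPath u) * X u).im =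
      (∫ u in Ioo (0 : ℝ) 1, stdKernel (y, α, β) (vertPath u) * X u).im := integral_im hi
    rw [e]
  · rw [integral_undef hi]
    simp

/-- Each derivative in `y` brings a factor `u` up to sign. Being real, `u^n` passes through the
imaginary part and improves the decay by `n` powers. -/
theorem isBigO_im_vert {α β : ℝ} (hα : α ∈ Ioo (0 : ℝ) 2) {k : ℕ} {X : ℝ → ℂ}
    (hX : ImTame α k X) (n : ℕ) :
    (fun y => (∫ u in Ioo (0 : ℝ) 1, stdKernel (y, α, β) (vertPath u) * ((u : ℂ) ^ n * X u)).im)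
      =O[atTop] tailGauge (1 + α + n) k := by
  obtain ⟨C, hC0, hC⟩ := ((imTame_cexp_stdExponent hα β).mono (Nat.zero_le k)).mul hX
  rw [add_assoc]
  refine isBigO_im_vert_of_bound (p := α + n) (C := C) (by linarith [hα.1, n.cast_nonneg (α := ℝ)])
    fun u hu => ?_
  have h1 := (hC u hu).2
  have h2 : Complex.exp (stdExponent α β (vertPath u)) * ((u : ℂ) ^ n * X u) =
      ((u ^ n : ℝ) : ℂ) * (Complex.exp (stdExponent α β (vertPath u)) * X u) := by
    push_cast; ring
  rw [h2, Complex.im_ofReal_mul, abs_mul, abs_of_nonneg (pow_nonneg hu.1.le n),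
    Real.rpow_add hu.1, Real.rpow_natCast]
  have := mul_le_mul_of_nonneg_left h1 (pow_nonneg hu.1.le n)
  linarith

theorem isBigO_exp_neg (p : ℝ) (k : ℕ) :
    (fun y : ℝ => Real.exp (-y)) =O[atTop] tailGauge p k := by
  have h1 := (isLittleO_exp_neg_mul_rpow_atTop one_pos (-p)).isBigO
  simp only [neg_mul, one_mul] at h1
  refine h1.trans (IsBigO.of_bound 1 ?_)
  filter_upwards [eventually_ge_atTop (Real.exp 1)] with y hy
  have hy0 : 0 < y := (Real.exp_pos 1).trans_le hy
  have hlog : 1 ≤ Real.log y := by rw [Real.le_log_iff_exp_le hy0]; exact hy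
  have h2 := Real.rpow_nonneg hy0.le (-p)
  rw [tailGauge, Real.norm_of_nonneg h2,
    Real.norm_of_nonneg (mul_nonneg h2 (pow_nonneg (by linarith) k)), one_mul]
  exact le_mul_of_one_le_right h2 (one_le_pow₀ hlog)

/-- The horizontal part of the contour and its derivatives contribute exponentially small terms. -/
theorem exists_horInt_bound {α : ℝ} (hα : α ∈ Ioo (0 : ℝ) 2) (β : ℝ) :
    ∃ C : ℝ, ∀ y : ℝ, ‖horInt (y, α, β)‖ ≤ C * Real.exp (-y) ∧
      ‖∫ t in Ioi (0 : ℝ), stdKernelD (y, α, β) (horPath t)‖ ≤ C * Real.exp (-y) ∧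
      ‖∫ t in Ioi (0 : ℝ), stdKernelDD (y, α, β) (horPath t)‖ ≤ C * Real.exp (-y) := by
  obtain ⟨B, hB0, hB⟩ := exists_stdKernel_derivs_bound hα.1 hα.2 |β|
  obtain ⟨bound, hbi, hbd⟩ := exists_horPath_bound hα.1 hα.2 |β|
  refine ⟨B * ∫ t in Ioi (0 : ℝ), bound t, fun y => ?_⟩
  have key : ∀ t ∈ Ioi (0 : ℝ), B * (‖stdKernel (y, α, β) (horPath t)‖ *
      (1 + coeffSize α (horPath t)) ^ 2) ≤ B * Real.exp (-y) * bound t := fun t ht => by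
    rw [mul_assoc]
    exact mul_le_mul_of_nonneg_left (hbd t ht (y, α, β) ⟨le_rfl, le_rfl⟩ le_rfl) hB0
  have hb := fun t => hB (y, α, β) ⟨le_rfl, le_rfl⟩ le_rfl (horPath t) (horPath_ne_zero t)
  have hbi' : IntegrableOn (fun t => B * Real.exp (-y) * bound t) (Ioi 0) := hbi.const_mul _
  have e : ∫ t in Ioi (0 : ℝ), B * Real.exp (-y) * bound t =
      (B * ∫ t in Ioi (0 : ℝ), bound t) * Real.exp (-y) := by
    rw [integral_const_mul]; ring
  rw [← e]
  refine ⟨?_, ?_, ?_⟩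
  · exact norm_integral_le_of_norm_le hbi' ((ae_restrict_iff' measurableSet_Ioi).2
      (ae_of_all _ fun t ht => (hb t).1.trans (key t ht)))
  · exact norm_integral_le_of_norm_le hbi' ((ae_restrict_iff' measurableSet_Ioi).2
      (ae_of_all _ fun t ht => (hb t).2.1.trans (key t ht)))
  · exact norm_integral_le_of_norm_le hbi' ((ae_restrict_iff' measurableSet_Ioi).2
      (ae_of_all _ fun t ht => (hb t).2.2.trans (key t ht)))

theorem integral_clm_apply_of_le {E F T : Type*} [NormedAddCommGroup E] [NormedSpace ℝ E]
    [NormedAddCommGroup F] [NormedSpace ℝ F] [CompleteSpace F] [MeasurableSpace T]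
    {μ : Measure T} {f : T → E →L[ℝ] F} {bound : T → ℝ} (hm : AEStronglyMeasurable f μ)
    (hi : Integrable bound μ) (hb : ∀ᵐ t ∂μ, ‖f t‖ ≤ bound t) (v : E) :
    (∫ t, f t ∂μ) v = ∫ t, f t v ∂μ ∧ Integrable (fun t => f t v) μ := by
  have hf : Integrable f μ := hi.mono' hm hb
  exact ⟨ContinuousLinearMap.integral_apply hf v,
    (ContinuousLinearMap.apply ℝ F v).integrable_comp hf⟩

theorem exists_stdKernel_derivs_vertPath_bound {q : StdVar} (hq : q ∈ stdDomain) :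
    ∃ C : ℝ, ∀ᵐ u ∂(volume.restrict (Ioo (0 : ℝ) 1)),
      ‖stdKernelD q (vertPath u)‖ ≤ C ∧ ‖stdKernelDD q (vertPath u)‖ ≤ C := by
  obtain ⟨B, hB0, hB⟩ := exists_stdKernel_derivs_bound hq.1 hq.2 |q.2.2|
  obtain ⟨C, hC0, hC⟩ := exists_vertPath_bound hq.1 hq.2 |q.2.2|
  have key : ∀ u ∈ Ioo (0 : ℝ) 1, B * (‖stdKernel q (vertPath u)‖ *
      (1 + coeffSize q.2.1 (vertPath u)) ^ 2) ≤ B * (C * Real.exp |q.1|) := fun u hu => by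
    refine mul_le_mul_of_nonneg_left ((hC u hu q ⟨le_rfl, le_rfl⟩ le_rfl).trans ?_) hB0
    gcongr
    calc -u * q.1 ≤ |u| * |q.1| := by rw [← abs_mul, neg_mul]; exact neg_le_abs _
      _ ≤ |q.1| := mul_le_of_le_one_left (abs_nonneg _) (by rw [abs_of_pos hu.1]; exact hu.2.le)
  have hb := fun u (hu : u ∈ Ioo (0 : ℝ) 1) =>
    hB q ⟨le_rfl, le_rfl⟩ le_rfl (vertPath u) (vertPath_ne_zero hu.1)
  exact ⟨B * (C * Real.exp |q.1|), (ae_restrict_iff' measurableSet_Ioo).2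
    (ae_of_all _ fun u hu => ⟨(hb u hu).2.1.trans (key u hu), (hb u hu).2.2.trans (key u hu)⟩)⟩

theorem integrableOn_stdKernelD_vertPath {q : StdVar} (hq : q ∈ stdDomain) :
    IntegrableOn (fun u => stdKernelD q (vertPath u)) (Ioo 0 1) := by
  obtain ⟨C, hC⟩ := exists_stdKernel_derivs_vertPath_bound hq
  exact Integrable.mono' (integrable_const C) ((stronglyMeasurable_stdKernelD q).comp_measurable
      continuous_vertPath.measurable).aestronglyMeasurable (hC.mono fun u hu => hu.1)

/-- The derivative of `stdDensity` at `q` in the direction `w`. -/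
noncomputable def stdDensityD (w : StdVar) (q : StdVar) : ℝ :=
  (1 / Real.pi) * (((∫ u in Ioo (0 : ℝ) 1, stdKernelD q (vertPath u)) w).im +
    ((∫ t in Ioi (0 : ℝ), stdKernelD q (horPath t)) w).re)

/-- The second derivative of `stdDensity` at `q` in the directions `v` and `w`. -/
noncomputable def stdDensityDD (v w : StdVar) (q : StdVar) : ℝ :=
  (1 / Real.pi) * (((∫ u in Ioo (0 : ℝ) 1, stdKernelDD q (vertPath u)) v w).im +
    ((∫ t in Ioi (0 : ℝ), stdKernelDD q (horPath t)) v w).re)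

theorem hasFDerivAt_stdDensity {q : StdVar} (hq : q ∈ stdDomain) :
    ∃ L : StdVar →L[ℝ] ℝ, HasFDerivAt stdDensity L q ∧ ∀ w, L w = stdDensityD w q := by
  have h1 := (Complex.imCLM.hasFDerivAt (x := vertInt q)).comp q (vertInt_smooth.2.1 q hq)
  have h2 := (Complex.reCLM.hasFDerivAt (x := horInt q)).comp q (horInt_smooth.2.1 q hq)
  refine ⟨_, (h1.add h2).const_mul (1 / Real.pi), fun w => ?_⟩
  simp [stdDensityD, mul_add]

theorem hasFDerivAt_stdDensityD (w : StdVar) {q : StdVar} (hq : q ∈ stdDomain) :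
    ∃ L : StdVar →L[ℝ] ℝ, HasFDerivAt (stdDensityD w) L q ∧ ∀ v, L v = stdDensityDD v w q := by
  have e1 := (vertInt_smooth.2.2 q hq).clm_apply (hasFDerivAt_const w q)
  have e2 := (horInt_smooth.2.2 q hq).clm_apply (hasFDerivAt_const w q)
  have h1 := (Complex.imCLM.hasFDerivAt).comp q e1
  have h2 := (Complex.reCLM.hasFDerivAt).comp q e2
  refine ⟨_, (h1.add h2).const_mul (1 / Real.pi), fun v => ?_⟩
  simp [stdDensityDD, mul_add]

theorem isBigO_re_of_le {F : ℝ → ℂ} {C : ℝ} (h : ∀ y, ‖F y‖ ≤ C * Real.exp (-y)) (p : ℝ) (k : ℕ) :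
    (fun y => (F y).re) =O[atTop] tailGauge p k := by
  refine (IsBigO.of_bound C (Eventually.of_forall fun y => ?_)).trans (isBigO_exp_neg p k)
  rw [Real.norm_of_nonneg (Real.exp_pos _).le]
  exact (Complex.abs_re_le_norm _).trans (h y)

theorem isBigO_horInt {α : ℝ} (hα : α ∈ Ioo (0 : ℝ) 2) (β : ℝ) (p : ℝ) (k : ℕ) :
    ((fun y => (horInt (y, α, β)).re) =O[atTop] tailGauge p k) ∧
    (∀ w : StdVar, (fun y => ((∫ t in Ioi (0 : ℝ), stdKernelD (y, α, β) (horPath t)) w).re)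
      =O[atTop] tailGauge p k) ∧
    (∀ v w : StdVar, (fun y => ((∫ t in Ioi (0 : ℝ), stdKernelDD (y, α, β) (horPath t)) v w).re)
      =O[atTop] tailGauge p k) := by
  obtain ⟨C, hC⟩ := exists_horInt_bound hα β
  refine ⟨isBigO_re_of_le (fun y => (hC y).1) p k, fun w => ?_, fun v w => ?_⟩
  · refine isBigO_re_of_le (C := C * ‖w‖) (fun y => ?_) p k
    refine (ContinuousLinearMap.le_opNorm _ _).trans ?_
    have := mul_le_mul_of_nonneg_right (hC y).2.1 (norm_nonneg w)
    linarith
  · refine isBigO_re_of_le (C := C * ‖v‖ * ‖w‖) (fun y => ?_) p k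
    refine (ContinuousLinearMap.le_opNorm₂ _ _ _).trans ?_
    have := mul_le_mul_of_nonneg_right (mul_le_mul_of_nonneg_right (hC y).2.2 (norm_nonneg v))
      (norm_nonneg w)
    linarith

theorem isBigO_stdDensity {α : ℝ} (hα : α ∈ Ioo (0 : ℝ) 2) (β : ℝ) :
    (fun y => stdDensity (y, α, β)) =O[atTop] tailGauge (1 + α) 0 := by
  have h1 := isBigO_im_vert (β := β) hα (imTame_ofReal α 1) 0
  simp only [pow_zero, Complex.ofReal_one, mul_one, Nat.cast_zero, add_zero] at h1
  exact (h1.add (isBigO_horInt hα β _ _).1).const_mul_left _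

theorem isBigO_stdDensityD {α : ℝ} (hα : α ∈ Ioo (0 : ℝ) 2) (β : ℝ) {w : StdVar} {n k : ℕ}
    {X : ℝ → ℂ} (hX : ImTame α k X)
    (h : ∀ y u, stdPhaseD (y, α, β) (vertPath u) w = (u : ℂ) ^ n * X u) :
    (fun y => stdDensityD w (y, α, β)) =O[atTop] tailGauge (1 + α + n) k := by
  have h1 := isBigO_im_vert (β := β) hα hX n
  refine (IsBigO.add (h1.congr_left fun y => ?_)
    ((isBigO_horInt hα β _ _).2.1 w)).const_mul_left _
  rw [ContinuousLinearMap.integral_apply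
    (integrableOn_stdKernelD_vertPath (q := (y, α, β)) hα)]
  refine congrArg Complex.im (integral_congr_ae (ae_of_all _ fun u => ?_))
  simp only [stdKernelD, smul_apply, smul_eq_mul, h]

theorem stdKernelDD_apply (q : StdVar) (z : ℂ) (v w : StdVar) :
    stdKernelDD q z v w = stdKernel q z *
      (stdPhaseDD q z v w + stdPhaseD q z v * stdPhaseD q z w) := by
  simp only [stdKernelDD, stdKernelD, add_apply, smul_apply, smul_eq_mul,
    ContinuousLinearMap.smulRight_apply]
  ring

theorem stdDensityDD_vert_eq {α : ℝ} (hα : α ∈ Ioo (0 : ℝ) 2) (y β : ℝ) (v w : StdVar) :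
    (∫ u in Ioo (0 : ℝ) 1, stdKernelDD (y, α, β) (vertPath u)) v w =
    ∫ u in Ioo (0 : ℝ) 1, stdKernel (y, α, β) (vertPath u) *
      (stdPhaseDD (y, α, β) (vertPath u) v w + stdPhaseD (y, α, β) (vertPath u) v *
        stdPhaseD (y, α, β) (vertPath u) w) := by
  obtain ⟨C, hC⟩ := exists_stdKernel_derivs_vertPath_bound (q := (y, α, β)) hα
  have h1 := integral_clm_apply_of_le (f := fun u => stdKernelDD (y, α, β) (vertPath u))
    ((stronglyMeasurable_stdKernelDD _).comp_measurable
    continuous_vertPath.measurable).aestronglyMeasurable (integrable_const C)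
    (hC.mono fun u hu => hu.2) v
  rw [h1.1, ContinuousLinearMap.integral_apply h1.2]
  exact integral_congr_ae (ae_of_all _ fun u => stdKernelDD_apply _ _ _ _)

theorem isBigO_stdDensityDD_of {α : ℝ} (hα : α ∈ Ioo (0 : ℝ) 2) (β : ℝ) {v w : StdVar} {p : ℝ}
    {k : ℕ} {Y : ℝ → ℂ}
    (h1 : (fun y => (∫ u in Ioo (0 : ℝ) 1, stdKernel (y, α, β) (vertPath u) * Y u).im)
      =O[atTop] tailGauge p k)
    (h : ∀ y u, stdPhaseDD (y, α, β) (vertPath u) v w + stdPhaseD (y, α, β) (vertPath u) v *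
        stdPhaseD (y, α, β) (vertPath u) w = Y u) :
    (fun y => stdDensityDD v w (y, α, β)) =O[atTop] tailGauge p k := by
  refine (IsBigO.add (h1.congr_left fun y => ?_)
    ((isBigO_horInt hα β _ _).2.2 v w)).const_mul_left _
  rw [stdDensityDD_vert_eq hα]
  simp only [h]

/-- The coordinate directions. -/
abbrev dirY : StdVar := (1, 0, 0)
/-- The coordinate direction of `α`. -/
abbrev dirA : StdVar := (0, 1, 0)
/-- The coordinate direction of `β`. -/
abbrev dirB : StdVar := (0, 0, 1)

theorem stdPhaseD_vertPath_dirY (q : StdVar) (u : ℝ) :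
    stdPhaseD q (vertPath u) dirY = -(u : ℂ) := by
  simp only [stdPhaseD, add_apply, smul_apply, smul_eq_mul, coordY_apply, coordA_apply,
    coordB_apply, vertPath]
  push_cast
  linear_combination (u : ℂ) * Complex.I_sq

theorem stdPhaseD_dirA (q : StdVar) (z : ℂ) : stdPhaseD q z dirA = stdPhaseA q z := by
  simp [stdPhaseD]

theorem stdPhaseD_dirB (q : StdVar) (z : ℂ) : stdPhaseD q z dirB = skewCoeff q.2.1 z := by
  simp [stdPhaseD]

theorem stdPhaseDD_apply (q : StdVar) (z : ℂ) (v w : StdVar) : stdPhaseDD q z v w =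
    (stdPhaseAA q z * v.2.1 + skewCoeffDeriv q.2.1 z * v.2.2) * w.2.1 +
      skewCoeffDeriv q.2.1 z * v.2.1 * w.2.2 := by
  simp [stdPhaseDD]

theorem imTame_stdPhaseA {α : ℝ} (hα : α ∈ Ioo (0 : ℝ) 2) (y β : ℝ) :
    ImTame α 1 fun u => stdPhaseA (y, α, β) (vertPath u) :=
  (imTame_powCoeff hα (k := 1) (by norm_num)).add
    (((imTame_ofReal α β).mono (Nat.zero_le 1)).mul (imTame_skewCoeffDeriv hα))

theorem imTame_stdPhaseAA {α : ℝ} (hα : α ∈ Ioo (0 : ℝ) 2) (y β : ℝ) :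
    ImTame α 2 fun u => stdPhaseAA (y, α, β) (vertPath u) :=
  (imTame_powCoeff hα (k := 2) (by norm_num)).add
    (((imTame_ofReal α β).mono (Nat.zero_le 2)).mul (imTame_skewCoeffDerivTwo hα))

/-- Differentiation of the exponent gives `-u` in `y`, a coefficient with one logarithm in `α`, and
one without logarithms in `β`; the gauges record exactly this. -/
theorem isBigO_stdDensityD_dirs {α : ℝ} (hα : α ∈ Ioo (0 : ℝ) 2) (β : ℝ) :
    ((fun y => stdDensityD dirY (y, α, β)) =O[atTop] tailGauge (2 + α) 0) ∧
    ((fun y => stdDensityD dirA (y, α, β)) =O[atTop] tailGauge (1 + α) 1) ∧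
    ((fun y => stdDensityD dirB (y, α, β)) =O[atTop] tailGauge (1 + α) 0) := by
  refine ⟨?_, ?_, ?_⟩
  · have := isBigO_stdDensityD hα β (w := dirY) (n := 1) (imTame_ofReal α (-1)) fun y u => by
      rw [stdPhaseD_vertPath_dirY]; push_cast; ring
    rwa [show 1 + α + (1 : ℕ) = 2 + α by push_cast; ring] at this
  · have := isBigO_stdDensityD hα β (w := dirA) (n := 0) (imTame_stdPhaseA hα 0 β) fun y u => by
      rw [stdPhaseD_dirA, pow_zero, one_mul]; rfl
    simpa using this
  · have := isBigO_stdDensityD hα β (w := dirB) (n := 0) (imTame_skewCoeff hα) fun y u => by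
      rw [stdPhaseD_dirB, pow_zero, one_mul]
    simpa using this

theorem isBigO_stdDensityDD_dirs {α : ℝ} (hα : α ∈ Ioo (0 : ℝ) 2) (β : ℝ) :
    ((fun y => stdDensityDD dirY dirY (y, α, β)) =O[atTop] tailGauge (3 + α) 0) ∧
    ((fun y => stdDensityDD dirY dirA (y, α, β)) =O[atTop] tailGauge (2 + α) 1) ∧
    ((fun y => stdDensityDD dirY dirB (y, α, β)) =O[atTop] tailGauge (2 + α) 0) ∧
    ((fun y => stdDensityDD dirA dirA (y, α, β)) =O[atTop] tailGauge (1 + α) 2) ∧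
    ((fun y => stdDensityDD dirA dirB (y, α, β)) =O[atTop] tailGauge (1 + α) 1) ∧
    ((fun y => stdDensityDD dirB dirB (y, α, β)) =O[atTop] tailGauge (1 + α) 0) := by
  have hA := imTame_stdPhaseA hα 0 β
  have hAA := imTame_stdPhaseAA hα 0 β
  have hb := imTame_skewCoeff hα
  have hb' := imTame_skewCoeffDeriv hα
  have hm := (imTame_ofReal α (-1))
  refine ⟨?_, ?_, ?_, ?_, ?_, ?_⟩
  · have := isBigO_stdDensityDD_of hα β (v := dirY) (w := dirY)
      (isBigO_im_vert (β := β) hα (imTame_ofReal α 1) 2) fun y u => by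
      rw [stdPhaseDD_apply, stdPhaseD_vertPath_dirY]; push_cast; ring
    rwa [show 1 + α + (2 : ℕ) = 3 + α by push_cast; ring] at this
  · have := isBigO_stdDensityDD_of hα β (v := dirY) (w := dirA)
      (isBigO_im_vert (β := β) hα ((hm.mono (Nat.zero_le 1)).mul hA) 1) fun y u => by
      rw [stdPhaseDD_apply, stdPhaseD_vertPath_dirY, stdPhaseD_dirA]
      change _ + -(u : ℂ) * stdPhaseA (0, α, β) (vertPath u) = _
      push_cast; ring
    rwa [show 1 + α + (1 : ℕ) = 2 + α by push_cast; ring] at this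
  · have := isBigO_stdDensityDD_of hα β (v := dirY) (w := dirB)
      (isBigO_im_vert (β := β) hα (hm.mul hb) 1) fun y u => by
      rw [stdPhaseDD_apply, stdPhaseD_vertPath_dirY, stdPhaseD_dirB]; push_cast; ring
    rwa [show 1 + α + (1 : ℕ) = 2 + α by push_cast; ring] at this
  · have := isBigO_stdDensityDD_of hα β (v := dirA) (w := dirA)
      (isBigO_im_vert (β := β) hα (hAA.add ((hA.mono one_le_two).mul (hA.mono one_le_two))) 0)
      fun y u => by
      rw [stdPhaseDD_apply, stdPhaseD_dirA]
      change (stdPhaseAA (0, α, β) (vertPath u) * _ + _) * _ + _ +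
        stdPhaseA (0, α, β) (vertPath u) * stdPhaseA (0, α, β) (vertPath u) = _
      push_cast; ring
    simpa using this
  · have := isBigO_stdDensityDD_of hα β (v := dirA) (w := dirB)
      (isBigO_im_vert (β := β) hα (hb'.add (hA.mul (hb.mono (Nat.zero_le 1)))) 0)
      fun y u => by
      rw [stdPhaseDD_apply, stdPhaseD_dirA, stdPhaseD_dirB]
      change _ + stdPhaseA (0, α, β) (vertPath u) * _ = _
      push_cast; ring
    simpa using this
  · have := isBigO_stdDensityDD_of hα β (v := dirB) (w := dirB)
      (isBigO_im_vert (β := β) hα (hb.mul hb) 0)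
      fun y u => by
      rw [stdPhaseDD_apply, stdPhaseD_dirB]; push_cast; ring
    simpa using this

/-! ### The improved bounds at `α = 1`. -/

/-- Here the coefficient is `-(2/π) u log(-iu)`: its real part has size `u |log u|`, while the angle
`-π/2` makes the imaginary part exactly `u`. -/
theorem skewCoeff_one_vertPath_bound {u : ℝ} (hu : u ∈ Ioo (0 : ℝ) 1) :
    ‖skewCoeff 1 (vertPath u)‖ ≤ 3 * (u * (1 + |Real.log u|)) ∧
      (skewCoeff 1 (vertPath u)).im = u := by
  constructor
  · rw [skewCoeff_vertPath, cotCoeff_one]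
    simp only [sub_self, Complex.ofReal_zero, zero_mul, expMoment_zero_zero, mul_one]
    rw [norm_mul, norm_neg, Complex.norm_real, Real.norm_eq_abs, abs_mul, abs_of_pos hu.1]
    have h1 : |2 / Real.pi| ≤ 1 := by
      rw [abs_of_pos (by positivity), div_le_one Real.pi_pos]
      exact Real.two_le_pi
    have h2 : ‖Complex.log (vertPath u)‖ ≤ 3 * (1 + |Real.log u|) := by
      linarith [norm_log_vertPath_le hu.1, abs_nonneg (Real.log u)]
    have hu0 := hu.1.le
    calc _ ≤ u * 1 * (3 * (1 + |Real.log u|)) := by gcongr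
      _ = _ := by ring
  · rw [im_skewCoeff_vertPath ⟨one_pos, one_lt_two⟩ hu.1, Real.rpow_one, mul_one,
      Real.sin_pi_div_two, mul_one]

theorem mul_one_add_abs_log_le {u : ℝ} (hu : u ∈ Ioo (0 : ℝ) 1) :
    u * (1 + |Real.log u|) ≤ 4 := by
  have := rpow_mul_log_bound one_pos hu.1 hu.2.le
  rw [Real.rpow_one] at this
  linarith [hu.1]

/-- With `b` the coefficient of `β` and `G` the remaining exponential, `Im(b²) = 2 Re b · Im b` and
`Re(b²) · Im G` are both `O(u² |log u|)`. The general product rule for `ImTame` would give only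
`O(u)`. -/
theorem isBigO_stdDensityDD_dirB_one (β : ℝ) :
    (fun y => stdDensityDD dirB dirB (y, 1, β)) =O[atTop] tailGauge 3 1 := by
  have h1 : (1 : ℝ) ∈ Ioo (0 : ℝ) 2 := ⟨one_pos, one_lt_two⟩
  obtain ⟨C, hC0, hC⟩ := imTame_cexp_stdExponent h1 β
  refine isBigO_stdDensityDD_of h1 β (v := dirB) (w := dirB)
    (Y := fun u => skewCoeff 1 (vertPath u) * skewCoeff 1 (vertPath u)) ?_ fun y u => by
      rw [stdPhaseDD_apply, stdPhaseD_dirB]; push_cast; ring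
  rw [show (3 : ℝ) = 1 + 2 by norm_num]
  -- The constant is `42 = 6 + 36`, from the bounds on `Im(b²)` and `Re(b²)` below.
  refine isBigO_im_vert_of_bound two_pos (C := 42 * C) fun u hu => ?_
  obtain ⟨hG, hGi⟩ := hC u hu
  obtain ⟨hb, hbi⟩ := skewCoeff_one_vertPath_bound hu
  have hul := mul_one_add_abs_log_le hu
  rw [Real.rpow_one, pow_zero, mul_one] at hGi
  rw [pow_one, Real.rpow_two]
  set G := Complex.exp (stdExponent 1 β (vertPath u))
  set b := skewCoeff 1 (vertPath u)
  set ℓ := 1 + |Real.log u|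
  have hℓ : 0 ≤ ℓ := by positivity
  have hu0 := hu.1.le
  have e1 : |(b * b).im| ≤ 6 * (u ^ 2 * ℓ) := by
    have : (b * b).im = 2 * b.re * b.im := by rw [Complex.mul_im]; ring
    rw [this, hbi, abs_mul, abs_mul, abs_two, abs_of_nonneg hu0]
    have := (Complex.abs_re_le_norm b).trans hb
    calc 2 * |b.re| * u ≤ 2 * (3 * (u * ℓ)) * u := by gcongr
      _ = _ := by ring
  have e2 : |(b * b).re| ≤ 36 * (u * ℓ) := by
    refine (Complex.abs_re_le_norm _).trans ?_
    rw [norm_mul]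
    calc ‖b‖ * ‖b‖ ≤ (3 * (u * ℓ)) * (3 * 4) := by
          gcongr
          exact hb.trans (by linarith)
      _ = _ := by ring
  have e3 := (Complex.abs_re_le_norm G).trans hG
  rw [Complex.mul_im]
  refine (abs_add_le _ _).trans ?_
  rw [abs_mul, abs_mul]
  calc _ ≤ C * (6 * (u ^ 2 * ℓ)) + C * u * (36 * (u * ℓ)) := by gcongr
    _ = _ := by ring

theorem abs_sin_sub_self_le (x : ℝ) : |Real.sin x - x| ≤ 2 * x ^ 2 := by
  rcases le_total |x| 1 with h | h
  · have h1 := Real.sin_bound h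
    have h2 : |x| ^ 3 ≤ |x| ^ 2 := pow_le_pow_of_le_one (abs_nonneg x) h (by norm_num)
    have h3 : |x| ^ 4 ≤ |x| ^ 2 := pow_le_pow_of_le_one (abs_nonneg x) h (by norm_num)
    have h4 : |x ^ 3 / 6| = |x| ^ 3 / 6 := by rw [abs_div, abs_pow]; norm_num
    have h5 : Real.sin x - x = (Real.sin x - (x - x ^ 3 / 6)) - x ^ 3 / 6 := by ring
    rw [h5]
    refine (abs_sub _ _).trans ?_
    rw [h4, ← sq_abs x]
    nlinarith [sq_nonneg |x|]
  · refine (abs_sub _ _).trans ?_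
    have h1 := Real.abs_sin_le_abs (x := x)
    rw [← sq_abs x]
    nlinarith

theorem abs_exp_sub_one_le (x : ℝ) : |Real.exp x - 1| ≤ |x| * Real.exp |x| := by
  have h1 := Real.add_one_le_exp x
  have h2 := Real.add_one_le_exp (-x)
  have h3 : Real.exp x * Real.exp (-x) = 1 := by rw [← Real.exp_add]; simp
  have h4 := Real.exp_pos x
  rcases le_total 0 x with h | h
  · rw [abs_of_nonneg h, abs_of_nonneg (by linarith)]
    nlinarith
  · have h5 : Real.exp x ≤ 1 := Real.exp_le_one_iff.2 h
    rw [abs_of_nonpos h, abs_of_nonpos (by linarith)]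
    nlinarith

/-- For `α = 1` the imaginary part of the characteristic function on the vertical path is linear
up to an error `O(u² |log u|)`. -/
theorem im_cexp_stdExponent_one (β : ℝ) : ∃ C : ℝ, ∀ u ∈ Ioo (0 : ℝ) 1,
    |(Complex.exp (stdExponent 1 β (vertPath u))).im - (1 + β) * u| ≤
      C * (u ^ 2 * (1 + |Real.log u|)) := by
  refine ⟨|β| * 3 * Real.exp (|β| * 12) * |1 + β| + 2 * (1 + β) ^ 2, fun u hu => ?_⟩
  obtain ⟨hb, hbi⟩ := skewCoeff_one_vertPath_bound hu
  have hul := mul_one_add_abs_log_le hu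
  have hpow : powCoeff 0 1 (vertPath u) = -vertPath u := by
    simp [powCoeff, Complex.exp_log (vertPath_ne_zero hu.1)]
  have him : (stdExponent 1 β (vertPath u)).im = (1 + β) * u := by
    rw [stdExponent, hpow, Complex.add_im, Complex.neg_im, vertPath_im, Complex.im_ofReal_mul, hbi]
    ring
  have hre : (stdExponent 1 β (vertPath u)).re = β * (skewCoeff 1 (vertPath u)).re := by
    rw [stdExponent, hpow, Complex.add_re, Complex.neg_re, Complex.re_ofReal_mul]
    simp [vertPath]
  rw [Complex.exp_im, him, hre]
  set a := β * (skewCoeff 1 (vertPath u)).re with ha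
  set ℓ := 1 + |Real.log u| with hℓ
  have hℓ1 : 1 ≤ ℓ := by rw [hℓ]; linarith [abs_nonneg (Real.log u)]
  have hu0 := hu.1.le
  have ha1 : |a| ≤ |β| * (3 * (u * ℓ)) := by
    rw [ha, abs_mul]
    gcongr
    exact (Complex.abs_re_le_norm _).trans hb
  have ha2 : |a| ≤ |β| * 12 := ha1.trans (by gcongr; linarith)
  have e1 : |Real.exp a - 1| ≤ |β| * (3 * (u * ℓ)) * Real.exp (|β| * 12) :=
    (abs_exp_sub_one_le a).trans (by gcongr)
  have e2 : |Real.sin ((1 + β) * u)| ≤ |1 + β| * u := by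
    refine Real.abs_sin_le_abs.trans ?_
    rw [abs_mul, abs_of_nonneg hu0]
  have e3 := abs_sin_sub_self_le ((1 + β) * u)
  -- The first term is `O(u |log u|) · O(u)` and the second is the quadratic error of linearising
  -- the sine.
  have e4 : Real.exp a * Real.sin ((1 + β) * u) - (1 + β) * u =
      (Real.exp a - 1) * Real.sin ((1 + β) * u) + (Real.sin ((1 + β) * u) - (1 + β) * u) := by ring
  rw [e4]
  refine (abs_add_le _ _).trans ?_
  rw [abs_mul]
  calc _ ≤ |β| * (3 * (u * ℓ)) * Real.exp (|β| * 12) * (|1 + β| * u) + 2 * ((1 + β) * u) ^ 2 := by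
        gcongr
    _ = |β| * 3 * Real.exp (|β| * 12) * |1 + β| * (u ^ 2 * ℓ) + 2 * (1 + β) ^ 2 * (u ^ 2 * 1) := by
        ring
    _ ≤ |β| * 3 * Real.exp (|β| * 12) * |1 + β| * (u ^ 2 * ℓ) + 2 * (1 + β) ^ 2 * (u ^ 2 * ℓ) := by
        gcongr
    _ = _ := by ring

/-- The integrand is `u` times `∂²/∂y² (y² e^{-uy})`, which is also the total `u`-derivative of
`e^{-uy}(u² - y u³)`. Only an exponentially small boundary term at `u = 1` survives. -/
theorem laplace_moment_combination (y : ℝ) :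
    ∫ u in (0 : ℝ)..1, Real.exp (-u * y) * (2 * u - 4 * y * u ^ 2 + y ^ 2 * u ^ 3) =
      Real.exp (-y) * (1 - y) := by
  have h : ∀ u ∈ uIcc (0 : ℝ) 1, HasDerivAt (fun u => Real.exp (-u * y) * (u ^ 2 - y * u ^ 3))
      (Real.exp (-u * y) * (2 * u - 4 * y * u ^ 2 + y ^ 2 * u ^ 3)) u := by
    intro u _
    have h1 : HasDerivAt (fun u : ℝ => Real.exp (-u * y)) (Real.exp (-u * y) * (-1 * y)) u :=
      (((hasDerivAt_id u).neg).mul_const y).exp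
    have h2 : HasDerivAt (fun u : ℝ => u ^ 2 - y * u ^ 3) (2 * u - y * (3 * u ^ 2)) u :=
      ((hasDerivAt_pow 2 u).sub ((hasDerivAt_pow 3 u).const_mul y)).congr_deriv (by norm_num)
    refine (h1.mul h2).congr_deriv ?_
    ring
  rw [intervalIntegral.integral_eq_sub_of_hasDerivAt h
    (Continuous.intervalIntegrable (by fun_prop) _ _)]
  simp

theorem isBigO_tailGauge_mul_pow (p : ℝ) (k n : ℕ) {f : ℝ → ℝ}
    (h : f =O[atTop] tailGauge (p + n) k) : (fun y => y ^ n * f y) =O[atTop] tailGauge p k := by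
  refine ((isBigO_refl (fun y : ℝ => y ^ n) atTop).mul h).congr' EventuallyEq.rfl ?_
  filter_upwards [eventually_gt_atTop 0] with y hy
  rw [tailGauge, tailGauge, ← mul_assoc, ← Real.rpow_natCast, ← Real.rpow_add hy]
  congr 2
  ring

/-- The combination is `(y² g)''`, which annihilates `y⁻²`. The linear part `(1 + β) u` of the
imaginary part leaves only a boundary term. For the remainder `r = O(u² |log u|)` every factor `y^n`
is matched by `u^n`, so each term is `O(y⁻³ log y)`. -/
theorem isBigO_stdDensity_scale_one (β : ℝ) :
    (fun y => 2 * stdDensity (y, 1, β) + 4 * (y * stdDensityD dirY (y, 1, β)) +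
      y ^ 2 * stdDensityDD dirY dirY (y, 1, β)) =O[atTop] tailGauge 3 1 := by
  have h1 : (1 : ℝ) ∈ Ioo (0 : ℝ) 2 := ⟨one_pos, one_lt_two⟩
  obtain ⟨C, hC⟩ := im_cexp_stdExponent_one β
  obtain ⟨D, hD0, hD⟩ := imTame_cexp_stdExponent h1 β
  set r : ℝ → ℝ := fun u => (Complex.exp (stdExponent 1 β (vertPath u))).im - (1 + β) * u with hr
  have hrm : Measurable r := by
    have := continuous_vertPath.measurable
    have h2 : Measurable fun u => stdExponent 1 β (vertPath u) := by
      unfold stdExponent; fun_prop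
    fun_prop
  have hR : ∀ n : ℕ, (fun y => ∫ u in Ioo (0 : ℝ) 1, Real.exp (-u * y) * (u ^ n * r u))
      =O[atTop] tailGauge (3 + n) 1 := by
    intro n
    have := isBigO_laplace (p := 2 + n) (by positivity) 1 (C := C)
      (f := fun y u => Real.exp (-u * y) * (u ^ n * r u)) fun y u hu => by
        rw [abs_mul, Real.abs_exp, abs_mul, abs_of_nonneg (pow_nonneg hu.1.le n),
          Real.rpow_add hu.1, Real.rpow_two, Real.rpow_natCast, pow_one]
        have h3 := mul_le_mul_of_nonneg_left (hC u hu)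
          (mul_nonneg (Real.exp_pos (-u * y)).le (pow_nonneg hu.1.le n))
        calc _ = Real.exp (-u * y) * u ^ n * |r u| := by ring
          _ ≤ _ := h3
          _ = _ := by ring
    rwa [← add_assoc, show (1 : ℝ) + 2 = 3 by norm_num] at this
  have hri : ∀ (n : ℕ) (y : ℝ), IntegrableOn (fun u => Real.exp (-u * y) * (u ^ n * r u))
      (Ioo 0 1) := by
    intro n y
    refine Integrable.mono' (integrable_const (Real.exp |y| * (D + |1 + β|)))
      (by fun_prop) ((ae_restrict_iff' measurableSet_Ioo).2 (ae_of_all _ fun u hu => ?_))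
    rw [norm_mul, norm_mul, Real.norm_of_nonneg (Real.exp_pos _).le,
      Real.norm_of_nonneg (pow_nonneg hu.1.le n)]
    have e1 : -u * y ≤ |y| := by
      calc -u * y ≤ |u| * |y| := by rw [← abs_mul, neg_mul]; exact neg_le_abs _
        _ ≤ |y| := mul_le_of_le_one_left (abs_nonneg _) (by rw [abs_of_pos hu.1]; exact hu.2.le)
    have e2 : |r u| ≤ D + |1 + β| := by
      refine (abs_sub _ _).trans (add_le_add ((Complex.abs_im_le_norm _).trans (hD u hu).1) ?_)
      rw [abs_mul, abs_of_pos hu.1]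
      exact mul_le_of_le_one_right (abs_nonneg _) hu.2.le
    have hu0 := hu.1
    calc _ ≤ Real.exp |y| * (1 * (D + |1 + β|)) := by
          gcongr
          · exact pow_le_one₀ hu.1.le hu.2.le
          · exact e2
      _ = _ := by ring
  have hki : ∀ (n : ℕ) (y : ℝ), IntegrableOn
      (fun u => stdKernel (y, 1, β) (vertPath u) * (u : ℂ) ^ n) (Ioo 0 1) := by
    intro n y
    have hm := continuous_vertPath.measurable
    refine Integrable.mono' (integrable_const (Real.exp |y| * D))
      (Measurable.aestronglyMeasurable (by fun_prop))
      ((ae_restrict_iff' measurableSet_Ioo).2 (ae_of_all _ fun u hu => ?_))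
    rw [stdKernel_vertPath, norm_mul, norm_mul, Complex.norm_real, norm_pow, Complex.norm_real,
      Real.norm_of_nonneg (Real.exp_pos _).le, Real.norm_of_nonneg hu.1.le]
    have e1 : -u * y ≤ |y| := by
      calc -u * y ≤ |u| * |y| := by rw [← abs_mul, neg_mul]; exact neg_le_abs _
        _ ≤ |y| := mul_le_of_le_one_left (abs_nonneg _) (by rw [abs_of_pos hu.1]; exact hu.2.le)
    have hu0 := hu.1
    calc _ ≤ Real.exp |y| * D * 1 := by
          gcongr
          · exact (hD u hu).1
          · exact pow_le_one₀ hu.1.le hu.2.le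
      _ = _ := by ring
  have hmi : ∀ (n : ℕ) (y : ℝ), IntegrableOn
      (fun u : ℝ => (1 + β) * (Real.exp (-u * y) * u ^ (n + 1))) (Ioo 0 1) := fun n y =>
    (Continuous.integrableOn_Icc (by fun_prop)).mono_set Ioo_subset_Icc_self
  have hV : ∀ (n : ℕ) (y : ℝ),
      (∫ u in Ioo (0 : ℝ) 1, stdKernel (y, 1, β) (vertPath u) * (u : ℂ) ^ n).im =
      (1 + β) * (∫ u in Ioo (0 : ℝ) 1, Real.exp (-u * y) * u ^ (n + 1)) +
        ∫ u in Ioo (0 : ℝ) 1, Real.exp (-u * y) * (u ^ n * r u) := by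
    intro n y
    have e : ∫ u in Ioo (0 : ℝ) 1, (stdKernel (y, 1, β) (vertPath u) * (u : ℂ) ^ n).im =
      (∫ u in Ioo (0 : ℝ) 1, stdKernel (y, 1, β) (vertPath u) * (u : ℂ) ^ n).im :=
      integral_im (hki n y)
    rw [← e, ← integral_const_mul, ← integral_add (hmi n y) (hri n y)]
    refine integral_congr_ae (ae_of_all _ fun u => ?_)
    simp only [hr]
    rw [stdKernel_vertPath, ← Complex.ofReal_pow, Complex.im_mul_ofReal, Complex.im_ofReal_mul]
    ring
  have hM : ∀ y : ℝ, 2 * (∫ u in Ioo (0 : ℝ) 1, Real.exp (-u * y) * u ^ (0 + 1)) -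
      4 * (y * ∫ u in Ioo (0 : ℝ) 1, Real.exp (-u * y) * u ^ (1 + 1)) +
      y ^ 2 * (∫ u in Ioo (0 : ℝ) 1, Real.exp (-u * y) * u ^ (2 + 1)) =
      Real.exp (-y) * (1 - y) := by
    intro y
    rw [← laplace_moment_combination, intervalIntegral.integral_of_le zero_le_one,
      integral_Ioc_eq_integral_Ioo]
    have hi : ∀ n : ℕ, ∀ c : ℝ, IntegrableOn (fun u : ℝ => c * (Real.exp (-u * y) * u ^ n))
      (Ioo 0 1) := fun n c =>
      (Continuous.integrableOn_Icc (by fun_prop)).mono_set Ioo_subset_Icc_self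
    have hs : IntegrableOn (fun u : ℝ => 2 * (Real.exp (-u * y) * u ^ (0 + 1)) -
        4 * y * (Real.exp (-u * y) * u ^ (1 + 1))) (Ioo 0 1) := (hi _ _).sub (hi _ _)
    rw [← mul_assoc, ← integral_const_mul, ← integral_const_mul, ← integral_const_mul,
      ← integral_sub (hi _ _) (hi _ _), ← integral_add hs (hi _ _)]
    refine integral_congr_ae (ae_of_all _ fun u => ?_)
    ring
  -- The combination splits into the boundary term of the linear part, the remainder `r`, and the
  -- horizontal part of the contour.
  have key : ∀ y, 2 * stdDensity (y, 1, β) + 4 * (y * stdDensityD dirY (y, 1, β)) +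
      y ^ 2 * stdDensityDD dirY dirY (y, 1, β) = (1 / Real.pi) * (
        (1 + β) * (Real.exp (-y) - y ^ 1 * Real.exp (-y)) +
        (2 * (∫ u in Ioo (0 : ℝ) 1, Real.exp (-u * y) * (u ^ 0 * r u)) -
        4 * (y ^ 1 * ∫ u in Ioo (0 : ℝ) 1, Real.exp (-u * y) * (u ^ 1 * r u)) +
        y ^ 2 * ∫ u in Ioo (0 : ℝ) 1, Real.exp (-u * y) * (u ^ 2 * r u)) +
        (2 * (horInt (y, 1, β)).re +
        4 * (y ^ 1 * ((∫ t in Ioi (0 : ℝ), stdKernelD (y, 1, β) (horPath t)) dirY).re) +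
        y ^ 2 * ((∫ t in Ioi (0 : ℝ), stdKernelDD (y, 1, β) (horPath t)) dirY dirY).re)) := by
    intro y
    have e0 : (vertInt (y, 1, β)).im =
        (∫ u in Ioo (0 : ℝ) 1, stdKernel (y, 1, β) (vertPath u) * (u : ℂ) ^ 0).im := by
      simp [vertInt]
    have e1 : ((∫ u in Ioo (0 : ℝ) 1, stdKernelD (y, 1, β) (vertPath u)) dirY).im =
        -(∫ u in Ioo (0 : ℝ) 1, stdKernel (y, 1, β) (vertPath u) * (u : ℂ) ^ 1).im := by
      rw [ContinuousLinearMap.integral_apply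
        (integrableOn_stdKernelD_vertPath (q := (y, 1, β)) h1), ← Complex.neg_im, ← integral_neg]
      refine congrArg Complex.im (integral_congr_ae (ae_of_all _ fun u => ?_))
      simp only [stdKernelD, smul_apply, smul_eq_mul, stdPhaseD_vertPath_dirY]
      ring
    have e2 : ((∫ u in Ioo (0 : ℝ) 1, stdKernelDD (y, 1, β) (vertPath u)) dirY dirY).im =
        (∫ u in Ioo (0 : ℝ) 1, stdKernel (y, 1, β) (vertPath u) * (u : ℂ) ^ 2).im := by
      rw [stdDensityDD_vert_eq h1]
      refine congrArg Complex.im (integral_congr_ae (ae_of_all _ fun u => ?_))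
      simp only [stdPhaseDD_apply, stdPhaseD_vertPath_dirY]
      push_cast
      ring
    rw [stdDensity, stdDensityD, stdDensityDD, e0, e1, e2, hV, hV, hV]
    linear_combination ((1 / Real.pi) * (1 + β)) * hM y
  simp_rw [key]
  refine IsBigO.const_mul_left (IsBigO.add (IsBigO.add ?_ ?_) ?_) _
  · exact ((isBigO_exp_neg 3 1).sub (isBigO_tailGauge_mul_pow 3 1 1
      (isBigO_exp_neg _ 1))).const_mul_left _
  · refine (IsBigO.sub ?_ ?_).add ?_
    · have := hR 0
      rw [Nat.cast_zero, add_zero] at this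
      exact this.const_mul_left _
    · exact (isBigO_tailGauge_mul_pow 3 1 1 (hR 1)).const_mul_left _
    · exact isBigO_tailGauge_mul_pow 3 1 2 (hR 2)
  · refine (IsBigO.add ?_ ?_).add ?_
    · exact (isBigO_horInt h1 β 3 1).1.const_mul_left _
    · exact (isBigO_tailGauge_mul_pow 3 1 1 ((isBigO_horInt h1 β _ 1).2.1 dirY)).const_mul_left _
    · exact isBigO_tailGauge_mul_pow 3 1 2 ((isBigO_horInt h1 β _ 1).2.2 dirY dirY)

/-! ### Reflection and two-sided tail bounds. -/

/-- The reflection `(y, α, β) ↦ (-y, α, -β)`. -/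
noncomputable def reflect : StdVar →L[ℝ] StdVar :=
  (-(ContinuousLinearMap.fst ℝ ℝ (ℝ × ℝ))).prod
    (((ContinuousLinearMap.fst ℝ ℝ ℝ).comp (ContinuousLinearMap.snd ℝ ℝ (ℝ × ℝ))).prod
      (-((ContinuousLinearMap.snd ℝ ℝ ℝ).comp (ContinuousLinearMap.snd ℝ ℝ (ℝ × ℝ)))))

theorem reflect_apply (q : StdVar) : reflect q = (-q.1, q.2.1, -q.2.2) := rfl

theorem m0Chf_neg_beta (α β t : ℝ) : m0Chf 0 1 α (-β) t = m0Chf 0 1 α β (-t) := by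
  unfold m0Chf
  split_ifs
  · congr 1
    simp only [abs_neg, mul_neg]
    push_cast
    ring
  · congr 1
    simp only [abs_neg, mul_neg, Real.sign_neg]
    push_cast
    ring

/-- Changing the sign of `β` in the characteristic function is the same as changing the sign of `t`;
the substitution `t ↦ -t` in the inversion integral does the rest. -/
theorem stdDensity_reflect {q : StdVar} (hq : q ∈ stdDomain) :
    stdDensity (reflect q) = stdDensity q := by
  have hq' : reflect q ∈ stdDomain := hq
  rw [stdDensity_eq hq', stdDensity_eq hq, ← integral_neg_eq_self]
  congr 3
  funext t
  simp only [reflect_apply, m0Chf_neg_beta, neg_neg, mul_neg, neg_mul]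

theorem stdDensityD_reflect {q : StdVar} (hq : q ∈ stdDomain) (w : StdVar) :
    stdDensityD (reflect w) (reflect q) = stdDensityD w q := by
  have hq' : reflect q ∈ stdDomain := hq
  obtain ⟨L, hL, hLw⟩ := hasFDerivAt_stdDensity hq
  obtain ⟨L', hL', hLw'⟩ := hasFDerivAt_stdDensity hq'
  have h1 : HasFDerivAt stdDensity (L'.comp reflect) q :=
    (hL'.comp q reflect.hasFDerivAt).congr_of_eventuallyEq (by
      filter_upwards [isOpen_stdDomain.mem_nhds hq] with p hp using (stdDensity_reflect hp).symm)
  rw [← hLw, ← hLw', hL.unique h1]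
  rfl

theorem stdDensityDD_reflect {q : StdVar} (hq : q ∈ stdDomain) (v w : StdVar) :
    stdDensityDD (reflect v) (reflect w) (reflect q) = stdDensityDD v w q := by
  have hq' : reflect q ∈ stdDomain := hq
  obtain ⟨L, hL, hLw⟩ := hasFDerivAt_stdDensityD w hq
  obtain ⟨L', hL', hLw'⟩ := hasFDerivAt_stdDensityD (reflect w) hq'
  have h1 : HasFDerivAt (stdDensityD w) (L'.comp reflect) q :=
    (hL'.comp q reflect.hasFDerivAt).congr_of_eventuallyEq (by
      filter_upwards [isOpen_stdDomain.mem_nhds hq] with p hp using (stdDensityD_reflect hp w).symm)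
  rw [← hLw, ← hLw', hL.unique h1]
  rfl

theorem stdDensityD_neg (w q : StdVar) : stdDensityD (-w) q = -stdDensityD w q := by
  simp only [stdDensityD, map_neg, Complex.neg_im, Complex.neg_re]
  ring

theorem stdDensityDD_neg_left (v w q : StdVar) :
    stdDensityDD (-v) w q = -stdDensityDD v w q := by
  simp only [stdDensityDD, map_neg, neg_apply, Complex.neg_im, Complex.neg_re]
  ring

theorem stdDensityDD_neg_right (v w q : StdVar) :
    stdDensityDD v (-w) q = -stdDensityDD v w q := by
  simp only [stdDensityDD, map_neg, Complex.neg_im, Complex.neg_re]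
  ring

theorem reflect_dirY : reflect dirY = -dirY := by simp [reflect_apply]
theorem reflect_dirA : reflect dirA = dirA := by simp [reflect_apply]
theorem reflect_dirB : reflect dirB = -dirB := by simp [reflect_apply]

/-- Two-sided tail bounds from one-sided ones, by reflection. -/
theorem tailBound_of_reflect {F : StdVar → ℝ} {α p : ℝ} {k : ℕ}
    (h : ∀ β, (fun y => F (y, α, β)) =O[atTop] tailGauge p k)
    (hR : ∀ y β, |F (-y, α, -β)| = |F (y, α, β)|) (β : ℝ) :
    TailBound (fun y => F (y, α, β)) p k := by
  rw [TailBound, IsOrderBornology.cobounded_eq, isBigO_sup]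
  constructor
  · have h1 := (h (-β)).comp_tendsto tendsto_neg_atBot_atTop
    have h2 : (fun y => F (y, α, β)) =O[atBot] fun y => F (-y, α, -β) :=
      IsBigO.of_bound 1 (Eventually.of_forall fun y => by
        rw [one_mul, Real.norm_eq_abs, Real.norm_eq_abs, hR])
    refine (h2.trans h1).congr' EventuallyEq.rfl ?_
    filter_upwards [eventually_lt_atBot 0] with y hy
    rw [Function.comp_apply, tailGauge, abs_of_neg hy]
  · refine (h β).congr' EventuallyEq.rfl ?_
    filter_upwards [eventually_gt_atTop 0] with y hy
    rw [tailGauge, abs_of_pos hy]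

theorem tailBound_stdDensity {α : ℝ} (hα : α ∈ Ioo (0 : ℝ) 2) (β : ℝ) :
    TailBound (fun y => stdDensity (y, α, β)) (1 + α) 0 :=
  tailBound_of_reflect (isBigO_stdDensity hα)
    (fun y β => congrArg abs (stdDensity_reflect (q := (y, α, β)) hα)) β

theorem tailBound_stdDensityD {α : ℝ} (hα : α ∈ Ioo (0 : ℝ) 2) (β : ℝ) :
    TailBound (fun y => stdDensityD dirY (y, α, β)) (2 + α) 0 ∧
    TailBound (fun y => stdDensityD dirA (y, α, β)) (1 + α) 1 ∧
    TailBound (fun y => stdDensityD dirB (y, α, β)) (1 + α) 0 := by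
  have hr : ∀ w y β, |stdDensityD w (-y, α, -β)| = |stdDensityD (reflect w) (y, α, β)| := by
    intro w y β
    have h := stdDensityD_reflect (q := (-y, α, -β)) hα w
    rw [reflect_apply (-y, α, -β)] at h
    simp only [neg_neg] at h
    rw [h]
  refine ⟨tailBound_of_reflect (fun β => (isBigO_stdDensityD_dirs hα β).1) (fun y β => ?_) β,
    tailBound_of_reflect (fun β => (isBigO_stdDensityD_dirs hα β).2.1) (fun y β => ?_) β,
    tailBound_of_reflect (fun β => (isBigO_stdDensityD_dirs hα β).2.2) (fun y β => ?_) β⟩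
  · rw [hr, reflect_dirY, stdDensityD_neg, abs_neg]
  · rw [hr, reflect_dirA]
  · rw [hr, reflect_dirB, stdDensityD_neg, abs_neg]

theorem stdDensityDD_neg_neg {α : ℝ} (hα : α ∈ Ioo (0 : ℝ) 2) (v w : StdVar) (y β : ℝ) :
    stdDensityDD v w (-y, α, -β) = stdDensityDD (reflect v) (reflect w) (y, α, β) := by
  have h := stdDensityDD_reflect (q := (-y, α, -β)) hα v w
  rw [reflect_apply (-y, α, -β)] at h
  simp only [neg_neg] at h
  rw [h]

theorem tailBound_stdDensityDD {α : ℝ} (hα : α ∈ Ioo (0 : ℝ) 2) (β : ℝ) :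
    TailBound (fun y => stdDensityDD dirY dirY (y, α, β)) (3 + α) 0 ∧
    TailBound (fun y => stdDensityDD dirY dirA (y, α, β)) (2 + α) 1 ∧
    TailBound (fun y => stdDensityDD dirY dirB (y, α, β)) (2 + α) 0 ∧
    TailBound (fun y => stdDensityDD dirA dirA (y, α, β)) (1 + α) 2 ∧
    TailBound (fun y => stdDensityDD dirA dirB (y, α, β)) (1 + α) 1 ∧
    TailBound (fun y => stdDensityDD dirB dirB (y, α, β)) (1 + α) 0 := by
  have h := isBigO_stdDensityDD_dirs hα
  refine ⟨tailBound_of_reflect (fun β => (h β).1) (fun y β => ?_) β,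
    tailBound_of_reflect (fun β => (h β).2.1) (fun y β => ?_) β,
    tailBound_of_reflect (fun β => (h β).2.2.1) (fun y β => ?_) β,
    tailBound_of_reflect (fun β => (h β).2.2.2.1) (fun y β => ?_) β,
    tailBound_of_reflect (fun β => (h β).2.2.2.2.1) (fun y β => ?_) β,
    tailBound_of_reflect (fun β => (h β).2.2.2.2.2) (fun y β => ?_) β⟩ <;>
  simp only [stdDensityDD_neg_neg hα, reflect_dirY, reflect_dirA, reflect_dirB,
    stdDensityDD_neg_left, stdDensityDD_neg_right, abs_neg]

theorem tailBound_one (β : ℝ) :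
    TailBound (fun y => stdDensityDD dirB dirB (y, 1, β)) 3 1 ∧
    TailBound (fun y => 2 * stdDensity (y, 1, β) + 4 * (y * stdDensityD dirY (y, 1, β)) +
      y ^ 2 * stdDensityDD dirY dirY (y, 1, β)) 3 1 := by
  have h1 : (1 : ℝ) ∈ Ioo (0 : ℝ) 2 := ⟨one_pos, one_lt_two⟩
  constructor
  · refine tailBound_of_reflect isBigO_stdDensityDD_dirB_one (fun y β => ?_) β
    rw [stdDensityDD_neg_neg h1, reflect_dirB, stdDensityDD_neg_left, stdDensityDD_neg_right,
      neg_neg]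
  -- The combination is even under reflection, because `y` and the `y`-derivative change sign
  -- together.
  · refine tailBound_of_reflect (F := fun q => 2 * stdDensity q + 4 * (q.1 * stdDensityD dirY q) +
      q.1 ^ 2 * stdDensityDD dirY dirY q) isBigO_stdDensity_scale_one (fun y β => ?_) β
    have e1 := stdDensity_reflect (q := (y, 1, β)) h1
    have e2 := stdDensityD_reflect (q := (y, 1, β)) h1 dirY
    rw [reflect_apply (y, 1, β)] at e1 e2
    rw [reflect_dirY, stdDensityD_neg] at e2
    rw [stdDensityDD_neg_neg h1, reflect_dirY, stdDensityDD_neg_left, stdDensityDD_neg_right,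
      neg_neg, e1, ← e2]
    congr 1
    ring

/-! ### Joint smoothness in `(x, θ)`. -/

/-- Parameters with `σ > 0` and `0 < α < 2`. -/
def smoothParams : Set (Fin 4 → ℝ) := {θ | 0 < θ sigmaIx ∧ θ alphaIx ∈ Ioo (0 : ℝ) 2}

theorem isOpen_smoothParams : IsOpen smoothParams :=
  (isOpen_lt continuous_const (continuous_apply _)).inter
    (isOpen_Ioo.preimage (continuous_apply _))

theorem eventually_update_mem {s : Set (Fin 4 → ℝ)} {θ : Fin 4 → ℝ} (h : s ∈ nhds θ)
    (i : Fin 4) : ∀ᶠ r in nhds (θ i), Function.update θ i r ∈ s := by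
  have hc : Continuous fun r : ℝ => Function.update θ i r := continuous_const.update i continuous_id
  have := hc.continuousAt (x := θ i)
  rw [ContinuousAt, Function.update_eq_self] at this
  exact this h

/-- An interior point cannot have `α = 2`, since `α` could then be increased past `2`. The
restriction on `β` is dropped because the contour estimates hold for every real `β`. -/
theorem interior_ThetaM_subset : interior ThetaM ⊆ smoothParams := by
  intro θ hθ
  obtain ⟨hσ, hα, -⟩ := interior_subset hθ
  refine ⟨hσ, hα.1, lt_of_le_of_ne hα.2 fun h => ?_⟩
  obtain ⟨r, hr, hmem⟩ :=
    (eventually_update_mem (mem_interior_iff_mem_nhds.1 hθ) alphaIx).exists_gt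
  have := hmem.2.1.2
  rw [Function.update_self] at this
  linarith

/-- The standardized argument. -/
noncomputable def stdArg (x : ℝ) (θ : Fin 4 → ℝ) : StdVar :=
  ((x - θ muIx) / θ sigmaIx, θ alphaIx, θ betaIx)

theorem stdArg_mem {θ : Fin 4 → ℝ} (hθ : θ ∈ smoothParams) (x : ℝ) : stdArg x θ ∈ stdDomain := hθ.2

theorem m0Density_eq_stdArg {θ : Fin 4 → ℝ} (hθ : θ ∈ smoothParams) (x : ℝ) :
    m0Density x θ = (θ sigmaIx)⁻¹ * stdDensity (stdArg x θ) := m0Density_eq hθ.1 hθ.2 x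

/-- The density as a function of all variables. -/
noncomputable def jointDensity (z : ℝ × (Fin 4 → ℝ)) : ℝ := m0Density z.1 z.2

/-- The domain of smoothness of the joint density. -/
def jointDomain : Set (ℝ × (Fin 4 → ℝ)) := univ ×ˢ smoothParams

theorem isOpen_jointDomain : IsOpen jointDomain := isOpen_univ.prod isOpen_smoothParams

theorem mem_jointDomain {θ : Fin 4 → ℝ} (hθ : θ ∈ smoothParams) (x : ℝ) : (x, θ) ∈ jointDomain :=
  ⟨mem_univ _, hθ⟩

/-- Regularity in all five variables at once: the mixed derivatives, their joint continuity and
their symmetry are then values of the first two Fréchet derivatives on coordinate directions. -/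
theorem contDiffOn_jointDensity : ContDiffOn ℝ 2 jointDensity jointDomain := by
  have hc : ∀ i : Fin 4, ContDiffOn ℝ 2 (fun z : ℝ × (Fin 4 → ℝ) => z.2 i) jointDomain := fun i =>
    ((contDiff_apply ℝ ℝ i).comp contDiff_snd).contDiffOn
  have hσ : ∀ z ∈ jointDomain, z.2 sigmaIx ≠ 0 := fun z hz => hz.2.1.ne'
  have h1 : ContDiffOn ℝ 2 (fun z : ℝ × (Fin 4 → ℝ) => stdArg z.1 z.2) jointDomain :=
    ((contDiffOn_fst.sub (hc muIx)).div (hc sigmaIx) hσ).prodMk ((hc alphaIx).prodMk (hc betaIx))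
  refine (((hc sigmaIx).inv hσ).mul (contDiffOn_stdDensity.comp h1 fun z hz =>
    stdArg_mem hz.2 z.1)).congr fun z hz => m0Density_eq_stdArg hz.2 z.1

/-- The direction of the coordinate `θᵢ`. -/
def dirTheta (i : Fin 4) : ℝ × (Fin 4 → ℝ) := (0, Pi.single i 1)

/-- The direction of `x`. -/
def dirX : ℝ × (Fin 4 → ℝ) := (1, 0)

theorem contDiffOn_fderiv_jointDensity : ContDiffOn ℝ 1 (fderiv ℝ jointDensity) jointDomain :=
  ((contDiffOn_succ_iff_fderiv_of_isOpen (n := 1) isOpen_jointDomain).1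
    contDiffOn_jointDensity).2.2

theorem contDiffOn_fderiv_jointDensity_apply (w : ℝ × (Fin 4 → ℝ)) :
    ContDiffOn ℝ 1 (fun z => fderiv ℝ jointDensity z w) jointDomain :=
  contDiffOn_fderiv_jointDensity.clm_apply contDiffOn_const

theorem hasFDerivAt_jointDensity {z : ℝ × (Fin 4 → ℝ)} (hz : z ∈ jointDomain) :
    HasFDerivAt jointDensity (fderiv ℝ jointDensity z) z :=
  ((contDiffOn_jointDensity.contDiffAt (isOpen_jointDomain.mem_nhds hz)).differentiableAt
    (by simp)).hasFDerivAt

theorem hasFDerivAt_fderiv_jointDensity {z : ℝ × (Fin 4 → ℝ)} (hz : z ∈ jointDomain) :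
    HasFDerivAt (fderiv ℝ jointDensity) (fderiv ℝ (fderiv ℝ jointDensity) z) z :=
  ((contDiffOn_fderiv_jointDensity.contDiffAt (isOpen_jointDomain.mem_nhds hz)).differentiableAt
    (by simp)).hasFDerivAt

theorem hasFDerivAt_fderiv_jointDensity_apply (w : ℝ × (Fin 4 → ℝ)) {z : ℝ × (Fin 4 → ℝ)}
    (hz : z ∈ jointDomain) : HasFDerivAt (fun z => fderiv ℝ jointDensity z w)
      ((fderiv ℝ (fderiv ℝ jointDensity) z).flip w) z := by
  refine ((hasFDerivAt_fderiv_jointDensity hz).clm_apply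
    (hasFDerivAt_const w z)).congr_fderiv (ContinuousLinearMap.ext fun v => ?_)
  simp

theorem hasDerivAt_thetaPath (x : ℝ) (θ : Fin 4 → ℝ) (i : Fin 4) :
    HasDerivAt (fun s : ℝ => (x, Function.update θ i s)) (dirTheta i) (θ i) :=
  (hasDerivAt_const _ x).prodMk (hasDerivAt_update θ i (θ i))

theorem hasDerivAt_xPath (x : ℝ) (θ : Fin 4 → ℝ) :
    HasDerivAt (fun y : ℝ => (y, θ)) dirX x :=
  (hasDerivAt_id x).prodMk (hasDerivAt_const x θ)

theorem partialTheta_eq {F : ℝ × (Fin 4 → ℝ) → ℝ} {L : ℝ × (Fin 4 → ℝ) →L[ℝ] ℝ} {x : ℝ}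
    {θ : Fin 4 → ℝ} (h : HasFDerivAt F L (x, θ)) (i : Fin 4) :
    partialTheta i (fun θ => F (x, θ)) θ = L (dirTheta i) := by
  refine HasDerivAt.deriv (HasFDerivAt.comp_hasDerivAt (θ i) ?_ (hasDerivAt_thetaPath x θ i))
  rwa [Function.update_eq_self]

theorem partialTheta_congr {F G : (Fin 4 → ℝ) → ℝ} {θ : Fin 4 → ℝ} (hθ : θ ∈ smoothParams)
    (h : ∀ θ ∈ smoothParams, F θ = G θ) (i : Fin 4) : partialTheta i F θ = partialTheta i G θ :=
  EventuallyEq.deriv_eq ((eventually_update_mem (isOpen_smoothParams.mem_nhds hθ) i).mono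
    fun _ hr => h _ hr)

theorem fTheta_eq {θ : Fin 4 → ℝ} (hθ : θ ∈ smoothParams) (x : ℝ) (i : Fin 4) :
    fTheta i x θ = fderiv ℝ jointDensity (x, θ) (dirTheta i) :=
  partialTheta_eq (hasFDerivAt_jointDensity (mem_jointDomain hθ x)) i

theorem fX_eq {θ : Fin 4 → ℝ} (hθ : θ ∈ smoothParams) (x : ℝ) :
    fX x θ = fderiv ℝ jointDensity (x, θ) dirX := by
  have h := (hasFDerivAt_jointDensity (mem_jointDomain hθ x)).comp_hasDerivAt x
    (hasDerivAt_xPath x θ)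
  exact h.deriv

theorem fThetaX_eq {θ : Fin 4 → ℝ} (hθ : θ ∈ smoothParams) (x : ℝ) (i : Fin 4) :
    fThetaX i x θ = fderiv ℝ (fderiv ℝ jointDensity) (x, θ) dirX (dirTheta i) := by
  have h1 : (fun y => fTheta i y θ) = fun y => fderiv ℝ jointDensity (y, θ) (dirTheta i) :=
    funext fun y => fTheta_eq hθ y i
  rw [fThetaX, h1]
  exact ((hasFDerivAt_fderiv_jointDensity_apply (dirTheta i)
    (mem_jointDomain hθ x)).comp_hasDerivAt x (hasDerivAt_xPath x θ)).deriv

theorem fThetaTheta_eq {θ : Fin 4 → ℝ} (hθ : θ ∈ smoothParams) (x : ℝ) (i j : Fin 4) :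
    fThetaTheta i j x θ =
      fderiv ℝ (fderiv ℝ jointDensity) (x, θ) (dirTheta i) (dirTheta j) := by
  rw [fThetaTheta, partialTheta_congr hθ (fun θ' h => fTheta_eq h x j)]
  exact partialTheta_eq (hasFDerivAt_fderiv_jointDensity_apply (dirTheta j)
    (mem_jointDomain hθ x)) i

theorem partialTheta_fX_eq {θ : Fin 4 → ℝ} (hθ : θ ∈ smoothParams) (x : ℝ) (i : Fin 4) :
    partialTheta i (fX x) θ =
      fderiv ℝ (fderiv ℝ jointDensity) (x, θ) (dirTheta i) dirX := by
  rw [partialTheta_congr hθ (fun θ' h => fX_eq h x)]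
  exact partialTheta_eq (hasFDerivAt_fderiv_jointDensity_apply dirX (mem_jointDomain hθ x)) i

theorem jointDensity_symm {z : ℝ × (Fin 4 → ℝ)} (hz : z ∈ jointDomain)
    (v w : ℝ × (Fin 4 → ℝ)) : fderiv ℝ (fderiv ℝ jointDensity) z v w =
      fderiv ℝ (fderiv ℝ jointDensity) z w v :=
  ((contDiffOn_jointDensity.contDiffAt (isOpen_jointDomain.mem_nhds hz)).isSymmSndFDerivAt
    (by simp)) v w

theorem contDiffOn_m0Density (x : ℝ) : ContDiffOn ℝ 2 (m0Density x) smoothParams :=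
  contDiffOn_jointDensity.comp (f := fun θ => (x, θ)) (contDiffOn_const.prodMk contDiffOn_id)
    fun _ hθ => mem_jointDomain hθ x

theorem contDiff_fTheta {θ : Fin 4 → ℝ} (hθ : θ ∈ smoothParams) (i : Fin 4) :
    ContDiff ℝ 1 (fun x : ℝ => fTheta i x θ) := by
  rw [funext fun x => fTheta_eq hθ x i, ← contDiffOn_univ]
  exact (contDiffOn_fderiv_jointDensity_apply (dirTheta i)).comp (f := fun x : ℝ => (x, θ))
    (contDiffOn_id.prodMk contDiffOn_const) fun x _ => mem_jointDomain hθ x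

theorem continuousOn_fTheta (i : Fin 4) :
    ContinuousOn (fun p : ℝ × (Fin 4 → ℝ) => fTheta i p.1 p.2) jointDomain :=
  (contDiffOn_fderiv_jointDensity_apply (dirTheta i)).continuousOn.congr
    fun p hp => fTheta_eq hp.2 p.1 i

theorem continuousOn_fderiv_fderiv_jointDensity (v w : ℝ × (Fin 4 → ℝ)) :
    ContinuousOn (fun z => fderiv ℝ (fderiv ℝ jointDensity) z v w) jointDomain := by
  have h := ((contDiffOn_succ_iff_fderiv_of_isOpen (n := 0) isOpen_jointDomain).1
    contDiffOn_fderiv_jointDensity).2.2.continuousOn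
  exact (h.clm_apply continuousOn_const).clm_apply continuousOn_const

theorem continuousOn_fThetaX (i : Fin 4) :
    ContinuousOn (fun p : ℝ × (Fin 4 → ℝ) => fThetaX i p.1 p.2) jointDomain :=
  (continuousOn_fderiv_fderiv_jointDensity dirX (dirTheta i)).congr
    fun p hp => fThetaX_eq hp.2 p.1 i

theorem continuousOn_fThetaTheta (i j : Fin 4) :
    ContinuousOn (fun p : ℝ × (Fin 4 → ℝ) => fThetaTheta i j p.1 p.2) jointDomain :=
  (continuousOn_fderiv_fderiv_jointDensity (dirTheta i) (dirTheta j)).congr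
    fun p hp => fThetaTheta_eq hp.2 p.1 i j

theorem differentiable_m0Density {θ : Fin 4 → ℝ} (hθ : θ ∈ smoothParams) :
    Differentiable ℝ (fun x : ℝ => m0Density x θ) := by
  intro x
  have h := (hasFDerivAt_jointDensity (mem_jointDomain hθ x)).comp_hasDerivAt x
    (hasDerivAt_xPath x θ)
  exact h.differentiableAt

theorem differentiableOn_fX (x : ℝ) : DifferentiableOn ℝ (fX x) smoothParams := by
  have h : DifferentiableOn ℝ (fun θ => fderiv ℝ jointDensity (x, θ) dirX) smoothParams :=
    ((contDiffOn_fderiv_jointDensity_apply dirX).differentiableOn one_ne_zero).comp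
      (f := fun θ => (x, θ)) (by fun_prop) fun _ hθ => mem_jointDomain hθ x
  exact h.congr fun θ hθ => fX_eq hθ x

/-! ### Chain rules through the standardised argument. -/

theorem hasDerivAt_comp_affine {G : StdVar → ℝ} {L : StdVar →L[ℝ] ℝ} {φ : ℝ → ℝ} {φ' t α β : ℝ}
    (hG : HasFDerivAt G L (φ t, α, β)) (hφ : HasDerivAt φ φ' t) :
    HasDerivAt (fun s => G (φ s, α, β)) (φ' * L dirY) t := by
  have h1 : HasDerivAt (fun s => (φ s, α, β)) (φ', (0 : ℝ), (0 : ℝ)) t :=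
    hφ.prodMk ((hasDerivAt_const t α).prodMk (hasDerivAt_const t β))
  refine (hG.comp_hasDerivAt t h1).congr_deriv ?_
  have : ((φ', (0 : ℝ), (0 : ℝ)) : StdVar) = φ' • dirY := by simp
  rw [this, map_smul, smul_eq_mul]

theorem hasDerivAt_stdArg_x {G : StdVar → ℝ} {L : StdVar →L[ℝ] ℝ} {x : ℝ} {θ : Fin 4 → ℝ}
    (hG : HasFDerivAt G L (stdArg x θ)) :
    HasDerivAt (fun y => G (stdArg y θ)) ((θ sigmaIx)⁻¹ * L dirY) x := by
  refine hasDerivAt_comp_affine (φ := fun y => (y - θ muIx) / θ sigmaIx) hG ?_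
  simpa using ((hasDerivAt_id x).sub_const (θ muIx)).div_const (θ sigmaIx)

theorem hasDerivAt_stdArg_mu {G : StdVar → ℝ} {L : StdVar →L[ℝ] ℝ} {x : ℝ} {θ : Fin 4 → ℝ}
    (hG : HasFDerivAt G L (stdArg x θ)) :
    HasDerivAt (fun s => G (stdArg x (Function.update θ muIx s)))
      (-(θ sigmaIx)⁻¹ * L dirY) (θ muIx) := by
  have h := hasDerivAt_comp_affine (φ := fun s => (x - s) / θ sigmaIx) (t := θ muIx)
    (φ' := -(θ sigmaIx)⁻¹) hG
    (by simpa [neg_div] using ((hasDerivAt_id (θ muIx)).const_sub x).div_const (θ sigmaIx))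
  exact h

theorem hasDerivAt_stdArg_sigma {G : StdVar → ℝ} {L : StdVar →L[ℝ] ℝ} {x : ℝ} {θ : Fin 4 → ℝ}
    (hσ : 0 < θ sigmaIx) (hG : HasFDerivAt G L (stdArg x θ)) :
    HasDerivAt (fun s => G (stdArg x (Function.update θ sigmaIx s)))
      (-((stdArg x θ).1 / θ sigmaIx) * L dirY) (θ sigmaIx) := by
  have h := hasDerivAt_comp_affine (φ := fun s => (x - θ muIx) / s) (t := θ sigmaIx)
    (φ' := -((stdArg x θ).1 / θ sigmaIx)) hG (by
      refine ((hasDerivAt_const (θ sigmaIx) (x - θ muIx)).div (hasDerivAt_id (θ sigmaIx))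
        hσ.ne').congr_deriv ?_
      simp only [stdArg, id]
      field_simp
      ring)
  exact h

theorem hasDerivAt_stdArg_alpha {G : StdVar → ℝ} {L : StdVar →L[ℝ] ℝ} {x : ℝ} {θ : Fin 4 → ℝ}
    (hG : HasFDerivAt G L (stdArg x θ)) :
    HasDerivAt (fun s => G (stdArg x (Function.update θ alphaIx s))) (L dirA) (θ alphaIx) := by
  have h1 : HasDerivAt (fun s => ((x - θ muIx) / θ sigmaIx, s, θ betaIx)) dirA (θ alphaIx) :=
    (hasDerivAt_const _ _).prodMk ((hasDerivAt_id _).prodMk (hasDerivAt_const _ _))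
  have h := HasFDerivAt.comp_hasDerivAt (θ alphaIx) hG h1
  exact h

theorem hasDerivAt_stdArg_beta {G : StdVar → ℝ} {L : StdVar →L[ℝ] ℝ} {x : ℝ} {θ : Fin 4 → ℝ}
    (hG : HasFDerivAt G L (stdArg x θ)) :
    HasDerivAt (fun s => G (stdArg x (Function.update θ betaIx s))) (L dirB) (θ betaIx) := by
  have h1 : HasDerivAt (fun s => ((x - θ muIx) / θ sigmaIx, θ alphaIx, s)) dirB (θ betaIx) :=
    (hasDerivAt_const _ _).prodMk ((hasDerivAt_const _ _).prodMk (hasDerivAt_id _))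
  have h := HasFDerivAt.comp_hasDerivAt (θ betaIx) hG h1
  exact h

/-! ### Tail bounds under multiplication by powers and affine changes of variable. -/

theorem eventually_cobounded_le_abs (r : ℝ) : ∀ᶠ x : ℝ in Bornology.cobounded ℝ, r ≤ |x| :=
  tendsto_norm_cobounded_atTop.eventually_ge_atTop r

theorem TailBound.self_pow_mul {F : ℝ → ℝ} {p : ℝ} {k : ℕ} (n : ℕ) (h : TailBound F (p + n) k) :
    TailBound (fun y => y ^ n * F y) p k := by
  rw [TailBound] at h ⊢
  refine ((isBigO_refl (fun y : ℝ => y ^ n) _).mul h).trans (IsBigO.of_norm_eventuallyLE ?_)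
  filter_upwards [eventually_cobounded_le_abs 1] with x hx
  have hx0 : 0 < |x| := by linarith
  have hl := Real.log_nonneg hx
  rw [norm_mul, Real.norm_of_nonneg (r := |x| ^ _ * _) (by positivity), norm_pow,
    Real.norm_eq_abs, ← mul_assoc, ← Real.rpow_natCast, ← Real.rpow_add hx0]
  apply le_of_eq
  congr 2
  ring

/-- Far out, `|x|/(2σ) ≤ |(x - m)/σ| ≤ |x|²`. The lower bound controls the negative power and the
crude upper bound costs only a factor `2` in the logarithm. -/
theorem TailBound.comp_affine {F : ℝ → ℝ} {p : ℝ} {k : ℕ} (hp : 0 ≤ p) (h : TailBound F p k)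
    (m : ℝ) {σ : ℝ} (hσ : 0 < σ) : TailBound (fun x => F ((x - m) / σ)) p k := by
  have ht : Tendsto (fun x : ℝ => (x - m) / σ) (Bornology.cobounded ℝ)
      (Bornology.cobounded ℝ) := by
    rw [IsOrderBornology.cobounded_eq]
    exact ((tendsto_atBot_add_const_right _ (-m) tendsto_id).atBot_div_const hσ).sup_sup
      ((tendsto_atTop_add_const_right _ (-m) tendsto_id).atTop_div_const hσ)
  refine (IsBigO.comp_tendsto h ht).trans (IsBigO.of_bound ((2 * σ) ^ p * 2 ^ k) ?_)
  filter_upwards [eventually_cobounded_le_abs (2 * |m|), eventually_cobounded_le_abs (2 / σ),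
    eventually_cobounded_le_abs 2, ht (eventually_cobounded_le_abs 1)] with x h1 h2 h3 h4
  have hx0 : 0 < |x| := by linarith
  have h4 : 1 ≤ |(x - m) / σ| := h4
  have hl := Real.log_nonneg (by linarith : 1 ≤ |x|)
  have hl' := Real.log_nonneg h4
  have hlow : |x| / (2 * σ) ≤ |(x - m) / σ| := by
    rw [abs_div, abs_of_pos hσ, div_le_div_iff₀ (by positivity) hσ]
    nlinarith [abs_sub_abs_le_abs_sub x m]
  have hup : |(x - m) / σ| ≤ |x| ^ 2 := by
    rw [abs_div, abs_of_pos hσ, div_le_iff₀ hσ]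
    rw [div_le_iff₀ hσ] at h2
    nlinarith [abs_sub x m]
  have hlog : Real.log |(x - m) / σ| ≤ 2 * Real.log |x| := by
    refine (Real.log_le_log (by linarith) hup).trans_eq ?_
    rw [Real.log_pow]
    norm_num
  have hpow : |(x - m) / σ| ^ (-p) ≤ (2 * σ) ^ p * |x| ^ (-p) := by
    refine (Real.rpow_le_rpow_of_nonpos (by positivity) hlow (by linarith)).trans_eq ?_
    rw [Real.div_rpow hx0.le (by positivity), Real.rpow_neg (by positivity : 0 ≤ 2 * σ),
      div_inv_eq_mul, mul_comm]
  rw [Function.comp_apply, Real.norm_of_nonneg (by positivity),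
    Real.norm_of_nonneg (by positivity)]
  refine (mul_le_mul hpow (pow_le_pow_left₀ hl' hlog k) (by positivity) (by positivity)).trans_eq ?_
  rw [mul_pow]
  ring

/-! ### Derivatives of the density in terms of the standard density, and transfer of the tail
bounds. -/

section

variable {x : ℝ} {θ : Fin 4 → ℝ}

theorem fX_eq_std (hθ : θ ∈ smoothParams) :
    fX x θ = (θ sigmaIx)⁻¹ * ((θ sigmaIx)⁻¹ * stdDensityD dirY (stdArg x θ)) := by
  obtain ⟨L, hL, hLw⟩ := hasFDerivAt_stdDensity (stdArg_mem hθ x)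
  rw [fX, funext fun y => m0Density_eq_stdArg hθ y, ← hLw]
  exact ((hasDerivAt_stdArg_x hL).const_mul _).deriv

theorem fTheta_mu_eq_std (hθ : θ ∈ smoothParams) :
    fTheta muIx x θ = -((θ sigmaIx)⁻¹ ^ 2) * stdDensityD dirY (stdArg x θ) := by
  obtain ⟨L, hL, hLw⟩ := hasFDerivAt_stdDensity (stdArg_mem hθ x)
  rw [fTheta, partialTheta_congr hθ (fun _ h => m0Density_eq_stdArg h x), ← hLw]
  refine HasDerivAt.deriv (((hasDerivAt_stdArg_mu hL).const_mul (θ sigmaIx)⁻¹).congr_deriv ?_)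
  ring

theorem fTheta_sigma_eq_std (hθ : θ ∈ smoothParams) :
    fTheta sigmaIx x θ = -((θ sigmaIx)⁻¹ ^ 2) *
      (stdDensity (stdArg x θ) + (stdArg x θ).1 * stdDensityD dirY (stdArg x θ)) := by
  obtain ⟨L, hL, hLw⟩ := hasFDerivAt_stdDensity (stdArg_mem hθ x)
  rw [fTheta, partialTheta_congr hθ (fun _ h => m0Density_eq_stdArg h x), ← hLw]
  refine HasDerivAt.deriv (((hasDerivAt_inv hθ.1.ne').mul
    (hasDerivAt_stdArg_sigma hθ.1 hL)).congr_deriv ?_)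
  simp only [Function.update_eq_self]
  ring

theorem fTheta_alpha_eq_std (hθ : θ ∈ smoothParams) :
    fTheta alphaIx x θ = (θ sigmaIx)⁻¹ * stdDensityD dirA (stdArg x θ) := by
  obtain ⟨L, hL, hLw⟩ := hasFDerivAt_stdDensity (stdArg_mem hθ x)
  rw [fTheta, partialTheta_congr hθ (fun _ h => m0Density_eq_stdArg h x), ← hLw]
  exact ((hasDerivAt_stdArg_alpha hL).const_mul (θ sigmaIx)⁻¹).deriv

theorem fTheta_beta_eq_std (hθ : θ ∈ smoothParams) :
    fTheta betaIx x θ = (θ sigmaIx)⁻¹ * stdDensityD dirB (stdArg x θ) := by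
  obtain ⟨L, hL, hLw⟩ := hasFDerivAt_stdDensity (stdArg_mem hθ x)
  rw [fTheta, partialTheta_congr hθ (fun _ h => m0Density_eq_stdArg h x), ← hLw]
  exact ((hasDerivAt_stdArg_beta hL).const_mul (θ sigmaIx)⁻¹).deriv

theorem fTheta_mu_eq_neg_fX (hθ : θ ∈ smoothParams) : fTheta muIx x θ = -fX x θ := by
  rw [fTheta_mu_eq_std hθ, fX_eq_std hθ]
  ring

theorem fThetaX_eq_partialTheta_fX (hθ : θ ∈ smoothParams) (i : Fin 4) :
    fThetaX i x θ = partialTheta i (fX x) θ := by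
  rw [fThetaX_eq hθ, partialTheta_fX_eq hθ, jointDensity_symm (mem_jointDomain hθ x)]

theorem fThetaTheta_comm (hθ : θ ∈ smoothParams) (i j : Fin 4) :
    fThetaTheta i j x θ = fThetaTheta j i x θ := by
  rw [fThetaTheta_eq hθ, fThetaTheta_eq hθ, jointDensity_symm (mem_jointDomain hθ x)]

theorem fThetaX_eq_neg_fThetaTheta (hθ : θ ∈ smoothParams) (i : Fin 4) :
    fThetaX i x θ = -fThetaTheta muIx i x θ := by
  rw [fThetaTheta_comm hθ, fThetaTheta, fThetaX_eq_partialTheta_fX hθ,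
    partialTheta_congr hθ (fun _ h => fTheta_mu_eq_neg_fX h) i]
  simp only [partialTheta, deriv.fun_neg, neg_neg]

theorem fThetaX_mu_eq_std (hθ : θ ∈ smoothParams) :
    fThetaX muIx x θ = -((θ sigmaIx)⁻¹ ^ 3) * stdDensityDD dirY dirY (stdArg x θ) := by
  obtain ⟨L, hL, hLw⟩ := hasFDerivAt_stdDensityD dirY (stdArg_mem hθ x)
  rw [fThetaX, funext fun y => fTheta_mu_eq_std hθ, ← hLw]
  refine HasDerivAt.deriv (((hasDerivAt_stdArg_x hL).const_mul _).congr_deriv ?_)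
  ring

/-- Interchanging derivatives reduces this to `∂/∂σ` of `f'`, which contains the single function
`stdDensityD dirY`. -/
theorem fThetaX_sigma_eq_std (hθ : θ ∈ smoothParams) :
    fThetaX sigmaIx x θ = -((θ sigmaIx)⁻¹ ^ 3) * (2 * stdDensityD dirY (stdArg x θ) +
      (stdArg x θ).1 * stdDensityDD dirY dirY (stdArg x θ)) := by
  obtain ⟨L, hL, hLw⟩ := hasFDerivAt_stdDensityD dirY (stdArg_mem hθ x)
  rw [fThetaX_eq_partialTheta_fX hθ, partialTheta_congr hθ (fun _ h => fX_eq_std h), ← hLw]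
  refine HasDerivAt.deriv (((hasDerivAt_inv hθ.1.ne').mul ((hasDerivAt_inv hθ.1.ne').mul
    (hasDerivAt_stdArg_sigma hθ.1 hL))).congr_deriv ?_)
  simp only [Function.update_eq_self, Pi.mul_apply]
  ring

theorem fThetaX_alpha_eq_std (hθ : θ ∈ smoothParams) :
    fThetaX alphaIx x θ = (θ sigmaIx)⁻¹ ^ 2 * stdDensityDD dirY dirA (stdArg x θ) := by
  obtain ⟨L, hL, hLw⟩ := hasFDerivAt_stdDensityD dirA (stdArg_mem hθ x)
  rw [fThetaX, funext fun y => fTheta_alpha_eq_std hθ, ← hLw]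
  refine HasDerivAt.deriv (((hasDerivAt_stdArg_x hL).const_mul _).congr_deriv ?_)
  ring

theorem fThetaX_beta_eq_std (hθ : θ ∈ smoothParams) :
    fThetaX betaIx x θ = (θ sigmaIx)⁻¹ ^ 2 * stdDensityDD dirY dirB (stdArg x θ) := by
  obtain ⟨L, hL, hLw⟩ := hasFDerivAt_stdDensityD dirB (stdArg_mem hθ x)
  rw [fThetaX, funext fun y => fTheta_beta_eq_std hθ, ← hLw]
  refine HasDerivAt.deriv (((hasDerivAt_stdArg_x hL).const_mul _).congr_deriv ?_)
  ring

theorem hasDerivAt_stdArg_fst_sigma (hσ : 0 < θ sigmaIx) :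
    HasDerivAt (fun s => (stdArg x (Function.update θ sigmaIx s)).1)
      (-((stdArg x θ).1 / θ sigmaIx)) (θ sigmaIx) :=
  (hasDerivAt_stdArg_sigma (G := fun q => q.1) (L := ContinuousLinearMap.fst ℝ ℝ (ℝ × ℝ)) hσ
    hasFDerivAt_fst).congr_deriv (by simp)

/-- The bracket is `(y² g)''`, the form in which the cancellation at `α = 1` becomes visible. -/
theorem fThetaTheta_sigma_sigma_eq_std (hθ : θ ∈ smoothParams) :
    fThetaTheta sigmaIx sigmaIx x θ = (θ sigmaIx)⁻¹ ^ 3 * (2 * stdDensity (stdArg x θ) +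
      4 * ((stdArg x θ).1 * stdDensityD dirY (stdArg x θ)) +
      (stdArg x θ).1 ^ 2 * stdDensityDD dirY dirY (stdArg x θ)) := by
  obtain ⟨L, hL, hLw⟩ := hasFDerivAt_stdDensity (stdArg_mem hθ x)
  obtain ⟨L', hL', hLw'⟩ := hasFDerivAt_stdDensityD dirY (stdArg_mem hθ x)
  rw [fThetaTheta, partialTheta_congr hθ (fun _ h => fTheta_sigma_eq_std h), ← hLw']
  refine HasDerivAt.deriv (((((hasDerivAt_inv hθ.1.ne').pow 2).neg).mul
    ((hasDerivAt_stdArg_sigma hθ.1 hL).add ((hasDerivAt_stdArg_fst_sigma hθ.1).mul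
      (hasDerivAt_stdArg_sigma hθ.1 hL')))).congr_deriv ?_)
  simp only [Function.update_eq_self, hLw, Pi.mul_apply, Pi.add_apply, Pi.neg_apply, Pi.pow_apply]
  norm_num
  ring

theorem fThetaTheta_sigma_alpha_eq_std (hθ : θ ∈ smoothParams) :
    fThetaTheta sigmaIx alphaIx x θ = -((θ sigmaIx)⁻¹ ^ 2) * (stdDensityD dirA (stdArg x θ) +
      (stdArg x θ).1 * stdDensityDD dirY dirA (stdArg x θ)) := by
  obtain ⟨L, hL, hLw⟩ := hasFDerivAt_stdDensityD dirA (stdArg_mem hθ x)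
  rw [fThetaTheta, partialTheta_congr hθ (fun _ h => fTheta_alpha_eq_std h), ← hLw]
  refine HasDerivAt.deriv (((hasDerivAt_inv hθ.1.ne').mul
    (hasDerivAt_stdArg_sigma hθ.1 hL)).congr_deriv ?_)
  simp only [Function.update_eq_self]
  ring

theorem fThetaTheta_sigma_beta_eq_std (hθ : θ ∈ smoothParams) :
    fThetaTheta sigmaIx betaIx x θ = -((θ sigmaIx)⁻¹ ^ 2) * (stdDensityD dirB (stdArg x θ) +
      (stdArg x θ).1 * stdDensityDD dirY dirB (stdArg x θ)) := by
  obtain ⟨L, hL, hLw⟩ := hasFDerivAt_stdDensityD dirB (stdArg_mem hθ x)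
  rw [fThetaTheta, partialTheta_congr hθ (fun _ h => fTheta_beta_eq_std h), ← hLw]
  refine HasDerivAt.deriv (((hasDerivAt_inv hθ.1.ne').mul
    (hasDerivAt_stdArg_sigma hθ.1 hL)).congr_deriv ?_)
  simp only [Function.update_eq_self]
  ring

theorem fThetaTheta_alpha_alpha_eq_std (hθ : θ ∈ smoothParams) :
    fThetaTheta alphaIx alphaIx x θ = (θ sigmaIx)⁻¹ * stdDensityDD dirA dirA (stdArg x θ) := by
  obtain ⟨L, hL, hLw⟩ := hasFDerivAt_stdDensityD dirA (stdArg_mem hθ x)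
  rw [fThetaTheta, partialTheta_congr hθ (fun _ h => fTheta_alpha_eq_std h), ← hLw]
  exact ((hasDerivAt_stdArg_alpha hL).const_mul (θ sigmaIx)⁻¹).deriv

theorem fThetaTheta_alpha_beta_eq_std (hθ : θ ∈ smoothParams) :
    fThetaTheta alphaIx betaIx x θ = (θ sigmaIx)⁻¹ * stdDensityDD dirA dirB (stdArg x θ) := by
  obtain ⟨L, hL, hLw⟩ := hasFDerivAt_stdDensityD dirB (stdArg_mem hθ x)
  rw [fThetaTheta, partialTheta_congr hθ (fun _ h => fTheta_beta_eq_std h), ← hLw]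
  exact ((hasDerivAt_stdArg_alpha hL).const_mul (θ sigmaIx)⁻¹).deriv

theorem fThetaTheta_beta_beta_eq_std (hθ : θ ∈ smoothParams) :
    fThetaTheta betaIx betaIx x θ = (θ sigmaIx)⁻¹ * stdDensityDD dirB dirB (stdArg x θ) := by
  obtain ⟨L, hL, hLw⟩ := hasFDerivAt_stdDensityD dirB (stdArg_mem hθ x)
  rw [fThetaTheta, partialTheta_congr hθ (fun _ h => fTheta_beta_eq_std h), ← hLw]
  exact ((hasDerivAt_stdArg_beta hL).const_mul (θ sigmaIx)⁻¹).deriv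

/-- Tail bounds of a standardized function pass to the location-scale family. -/
theorem TailBound.comp_stdArg {G : StdVar → ℝ} {p : ℝ} {k : ℕ} (hp : 0 ≤ p)
    (hθ : θ ∈ smoothParams) (c : ℝ)
    (h : TailBound (fun y => G (y, θ alphaIx, θ betaIx)) p k) {F : ℝ → ℝ}
    (hF : ∀ x, F x = c * G (stdArg x θ)) : TailBound F p k := by
  rw [funext hF]
  exact (TailBound.comp_affine hp h (θ muIx) hθ.1).const_mul_left c

theorem TailBound.add {F G : ℝ → ℝ} {p : ℝ} {k : ℕ} (hF : TailBound F p k)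
    (hG : TailBound G p k) : TailBound (fun y => F y + G y) p k :=
  IsBigO.add hF hG

theorem tailBound_of_mem_smoothParams (hθ : θ ∈ smoothParams) :
    TailBound (fun x => m0Density x θ) (1 + θ alphaIx) 0 ∧
    TailBound (fun x => fTheta muIx x θ) (2 + θ alphaIx) 0 ∧
    TailBound (fun x => fTheta sigmaIx x θ) (1 + θ alphaIx) 0 ∧
    TailBound (fun x => fTheta alphaIx x θ) (1 + θ alphaIx) 1 ∧
    TailBound (fun x => fTheta betaIx x θ) (1 + θ alphaIx) 0 ∧
    TailBound (fun x => fThetaX muIx x θ) (3 + θ alphaIx) 0 ∧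
    TailBound (fun x => fThetaX sigmaIx x θ) (2 + θ alphaIx) 0 ∧
    TailBound (fun x => fThetaX alphaIx x θ) (2 + θ alphaIx) 1 ∧
    TailBound (fun x => fThetaX betaIx x θ) (2 + θ alphaIx) 0 ∧
    TailBound (fun x => fThetaTheta sigmaIx sigmaIx x θ) (1 + θ alphaIx) 0 ∧
    TailBound (fun x => fThetaTheta sigmaIx alphaIx x θ) (1 + θ alphaIx) 1 ∧
    TailBound (fun x => fThetaTheta sigmaIx betaIx x θ) (1 + θ alphaIx) 0 ∧
    TailBound (fun x => fThetaTheta alphaIx alphaIx x θ) (1 + θ alphaIx) 2 ∧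
    TailBound (fun x => fThetaTheta alphaIx betaIx x θ) (1 + θ alphaIx) 1 ∧
    TailBound (fun x => fThetaTheta betaIx betaIx x θ) (1 + θ alphaIx) 0 := by
  have hα := hθ.2
  have h0 := hα.1
  have hp := tailBound_stdDensity hα (θ betaIx)
  obtain ⟨hY, hA, hB⟩ := tailBound_stdDensityD hα (θ betaIx)
  obtain ⟨hYY, hYA, hYB, hAA, hAB, hBB⟩ := tailBound_stdDensityDD hα (θ betaIx)
  have e1 : 2 + θ alphaIx = 1 + θ alphaIx + (1 : ℕ) := by push_cast; ring
  have e2 : 3 + θ alphaIx = 2 + θ alphaIx + (1 : ℕ) := by push_cast; ring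
  have e3 : 3 + θ alphaIx = 1 + θ alphaIx + (2 : ℕ) := by push_cast; ring
  -- A derivative in `σ` multiplies each `y`-derivative by `y`. This spends exactly the decay that
  -- the `y`-derivative gained, so scale derivatives leave the tail order unchanged.
  have hY1 := TailBound.self_pow_mul 1 (e1 ▸ hY)
  have hYY1 := TailBound.self_pow_mul 1 (e2 ▸ hYY)
  have hYY2 := TailBound.self_pow_mul 2 (e3 ▸ hYY)
  have hYA1 := TailBound.self_pow_mul 1 (e1 ▸ hYA)
  have hYB1 := TailBound.self_pow_mul 1 (e1 ▸ hYB)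
  simp only [pow_one] at hY1 hYY1 hYA1 hYB1
  refine ⟨?_, ?_, ?_, ?_, ?_, ?_, ?_, ?_, ?_, ?_, ?_, ?_, ?_, ?_, ?_⟩
  · exact hp.comp_stdArg (G := stdDensity) (by linarith) hθ _ fun x => m0Density_eq_stdArg hθ x
  · exact hY.comp_stdArg (G := stdDensityD dirY) (by linarith) hθ _ fun x => fTheta_mu_eq_std hθ
  · exact (hp.add hY1).comp_stdArg (G := fun q => stdDensity q + q.1 * stdDensityD dirY q)
      (by linarith) hθ _ fun x => fTheta_sigma_eq_std hθ
  · exact hA.comp_stdArg (G := stdDensityD dirA) (by linarith) hθ _ fun x => fTheta_alpha_eq_std hθ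
  · exact hB.comp_stdArg (G := stdDensityD dirB) (by linarith) hθ _ fun x => fTheta_beta_eq_std hθ
  · exact hYY.comp_stdArg (G := stdDensityDD dirY dirY) (by linarith) hθ _
      fun x => fThetaX_mu_eq_std hθ
  · exact (TailBound.add (hY.const_mul_left 2) hYY1).comp_stdArg
      (G := fun q => 2 * stdDensityD dirY q + q.1 * stdDensityDD dirY dirY q)
      (by linarith) hθ _ fun x => fThetaX_sigma_eq_std hθ
  · exact hYA.comp_stdArg (G := stdDensityDD dirY dirA) (by linarith) hθ _
      fun x => fThetaX_alpha_eq_std hθ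
  · exact hYB.comp_stdArg (G := stdDensityDD dirY dirB) (by linarith) hθ _
      fun x => fThetaX_beta_eq_std hθ
  · exact ((TailBound.add (hp.const_mul_left 2) (hY1.const_mul_left 4)).add hYY2).comp_stdArg
      (G := fun q => 2 * stdDensity q + 4 * (q.1 * stdDensityD dirY q) +
        q.1 ^ 2 * stdDensityDD dirY dirY q)
      (by linarith) hθ _ fun x => fThetaTheta_sigma_sigma_eq_std hθ
  · exact (hA.add hYA1).comp_stdArg
      (G := fun q => stdDensityD dirA q + q.1 * stdDensityDD dirY dirA q)
      (by linarith) hθ _ fun x => fThetaTheta_sigma_alpha_eq_std hθ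
  · exact (hB.add hYB1).comp_stdArg
      (G := fun q => stdDensityD dirB q + q.1 * stdDensityDD dirY dirB q)
      (by linarith) hθ _ fun x => fThetaTheta_sigma_beta_eq_std hθ
  · exact hAA.comp_stdArg (G := stdDensityDD dirA dirA) (by linarith) hθ _
      fun x => fThetaTheta_alpha_alpha_eq_std hθ
  · exact hAB.comp_stdArg (G := stdDensityDD dirA dirB) (by linarith) hθ _
      fun x => fThetaTheta_alpha_beta_eq_std hθ
  · exact hBB.comp_stdArg (G := stdDensityDD dirB dirB) (by linarith) hθ _
      fun x => fThetaTheta_beta_beta_eq_std hθ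

theorem tailBound_of_alpha_eq_one (hθ : θ ∈ smoothParams) (h1 : θ alphaIx = 1) :
    TailBound (fun x => fThetaTheta sigmaIx sigmaIx x θ) 3 1 ∧
    TailBound (fun x => fThetaTheta betaIx betaIx x θ) 3 1 := by
  obtain ⟨hB, hS⟩ := tailBound_one (θ betaIx)
  rw [← h1] at hB hS
  exact ⟨hS.comp_stdArg (G := fun q => 2 * stdDensity q + 4 * (q.1 * stdDensityD dirY q) +
        q.1 ^ 2 * stdDensityDD dirY dirY q)
      (by norm_num) hθ _ fun x => fThetaTheta_sigma_sigma_eq_std hθ,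
    hB.comp_stdArg (G := stdDensityDD dirB dirB) (by norm_num) hθ _
      fun x => fThetaTheta_beta_beta_eq_std hθ⟩

end

/-! ### Restriction to the interior of the parameter space. -/

theorem lemma1 :
    -- smoothness in `θ`, smoothness of the first `θ`-derivatives in `x`, joint continuity
    (∀ x : ℝ, ContDiffOn ℝ 2 (m0Density x) (interior ThetaM)) ∧
    (∀ θ ∈ interior ThetaM, ∀ i : Fin 4, ContDiff ℝ 1 (fun x : ℝ => fTheta i x θ)) ∧
    (∀ i : Fin 4,
      ContinuousOn (fun p : ℝ × (Fin 4 → ℝ) => fTheta i p.1 p.2) (univ ×ˢ interior ThetaM)) ∧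
    (∀ i : Fin 4,
      ContinuousOn (fun p : ℝ × (Fin 4 → ℝ) => fThetaX i p.1 p.2) (univ ×ˢ interior ThetaM)) ∧
    (∀ i j : Fin 4,
      ContinuousOn (fun p : ℝ × (Fin 4 → ℝ) => fThetaTheta i j p.1 p.2)
        (univ ×ˢ interior ThetaM)) ∧
    -- existence and interchangeability of the derivatives, and the location identities
    (∀ θ ∈ interior ThetaM, Differentiable ℝ (fun x : ℝ => m0Density x θ)) ∧
    (∀ x : ℝ, DifferentiableOn ℝ (fX x) (interior ThetaM)) ∧
    (∀ θ ∈ interior ThetaM, ∀ x : ℝ, ∀ i j : Fin 4,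
      fThetaX i x θ = partialTheta i (fX x) θ ∧
      fThetaTheta i j x θ = fThetaTheta j i x θ ∧
      fTheta muIx x θ = -fX x θ ∧
      fThetaX i x θ = -fThetaTheta muIx i x θ) ∧
    -- tail bounds as `|x| → ∞`
    (∀ θ ∈ interior ThetaM,
      TailBound (fun x => m0Density x θ) (1 + θ alphaIx) 0 ∧
      TailBound (fun x => fTheta muIx x θ) (2 + θ alphaIx) 0 ∧
      TailBound (fun x => fTheta sigmaIx x θ) (1 + θ alphaIx) 0 ∧
      TailBound (fun x => fTheta alphaIx x θ) (1 + θ alphaIx) 1 ∧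
      TailBound (fun x => fTheta betaIx x θ) (1 + θ alphaIx) 0 ∧
      TailBound (fun x => fThetaX muIx x θ) (3 + θ alphaIx) 0 ∧
      TailBound (fun x => fThetaX sigmaIx x θ) (2 + θ alphaIx) 0 ∧
      TailBound (fun x => fThetaX alphaIx x θ) (2 + θ alphaIx) 1 ∧
      TailBound (fun x => fThetaX betaIx x θ) (2 + θ alphaIx) 0 ∧
      TailBound (fun x => fThetaTheta sigmaIx sigmaIx x θ) (1 + θ alphaIx) 0 ∧
      TailBound (fun x => fThetaTheta sigmaIx alphaIx x θ) (1 + θ alphaIx) 1 ∧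
      TailBound (fun x => fThetaTheta sigmaIx betaIx x θ) (1 + θ alphaIx) 0 ∧
      TailBound (fun x => fThetaTheta alphaIx alphaIx x θ) (1 + θ alphaIx) 2 ∧
      TailBound (fun x => fThetaTheta alphaIx betaIx x θ) (1 + θ alphaIx) 1 ∧
      TailBound (fun x => fThetaTheta betaIx betaIx x θ) (1 + θ alphaIx) 0) ∧
    -- refined bounds at `α = 1`
    (∀ θ ∈ interior ThetaM, θ alphaIx = 1 →
      TailBound (fun x => fThetaTheta sigmaIx sigmaIx x θ) 3 1 ∧
      TailBound (fun x => fThetaTheta betaIx betaIx x θ) 3 1) := by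
  have hs : interior ThetaM ⊆ smoothParams := interior_ThetaM_subset
  have hs' : (univ : Set ℝ) ×ˢ interior ThetaM ⊆ jointDomain := prod_mono_right hs
  exact ⟨fun x => (contDiffOn_m0Density x).mono hs, fun θ hθ => contDiff_fTheta (hs hθ),
    fun i => (continuousOn_fTheta i).mono hs', fun i => (continuousOn_fThetaX i).mono hs',
    fun i j => (continuousOn_fThetaTheta i j).mono hs',
    fun θ hθ => differentiable_m0Density (hs hθ), fun x => (differentiableOn_fX x).mono hs,
    fun θ hθ x i j => ⟨fThetaX_eq_partialTheta_fX (hs hθ) i, fThetaTheta_comm (hs hθ) i j,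
      fTheta_mu_eq_neg_fX (hs hθ), fThetaX_eq_neg_fThetaTheta (hs hθ) i⟩,
    fun θ hθ => tailBound_of_mem_smoothParams (hs hθ),
    fun θ hθ => tailBound_of_alpha_eq_one (hs hθ)⟩
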